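/- Let $d\ge 1$, $r>0$, $\lambda>0$. Let $\Xi=\sum_{j\in\mathbb Z}\varepsilon_{\xi_j}$ be a homogeneous Poisson point process on $\mathbb R^d$ with rate $\lambda$, let $W^{(j)}$, $j\in\mathbb Z$, be independent standard $d$-dimensional Brownian motions, independent of $(\xi_j)_{j\in\mathbb Z}$, let $B=\{x\in\mathbb R^d:\|x\|\le r\}$, $\rho=\lambda\,\mathrm{vol}(B)$, and for $\sigma>0$ put $$N(t)=\sum_{j\in\mathbb Z}\mathbf 1\{\xi_j+\sigma W^{(j)}_t\in B\},\qquad t\ge 0 .$$ From the observation $\{N(t),\,0\le t\le T\}$ define, for $\alpha\in(0,\tfrac12)$ and $b>0$, $$\hat R(t)=\frac1{T-t}\int_0^{T-t}(N(s)-\rho)(N(s+t)-\rho)\,ds,\qquad \hat H(t)=\frac1\rho\max\{\hat R(t),0\},\qquad \hat\Psi_{\alpha,b}=\int_0^b\frac{\hat H(t)}{t^{1-\alpha}}\,dt .$$ Let $$J(t)=\frac{1}{\mathrm B(\frac{d+1}2,\frac12)\,\Gamma(\frac d2)}\int_0^1\gamma\Big(\frac d2;\frac{2r^2y}{t}\Big)(1-y)^{(d-1)/2}y^{-1/2}\,dy,\qquad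 J_\alpha=\int_0^\infty\frac{J(t)}{t^{1-\alpha}}\,dt,$$ where $\gamma(s;x)=\int_0^x u^{s-1}e^{-u}\,du$ and $\mathrm B$ is the beta function, and let $\hat\sigma^2_*=\big[J_{\alpha_*}/\hat\Psi_{\alpha_*,b_*}\big]^{1/\alpha_*}$ with $$\alpha_*=\frac1{\ln T},\qquad b_*=\begin{cases}(T/\ln^2T)^{1/d},&d>2,\\(T/\ln^3T)^{1/2},&d=2,\\ \sqrt T/\ln^2T,&d=1.\end{cases}$$ Let $\Delta(x,y)=|x-y|/(x+y)$; on the event $\hat\Psi_{\alpha_*,b_*}=0$ the loss $\Delta(\hat\sigma^2_*,\sigma^2)$ is $1$. Then $\hat\sigma_*^2$ is a random variable (measurable up to null sets) for all $T>e^2$ (that is, $0<\alpha_*<\frac12$) and $\sigma>0$, and there is a constant $C$ depending only on $d$ such that, for all $r>0$ and $\lambda>0$, $$\limsup_{T\to\infty}\ \sup_{\sigma>0:\ \sigma^2\le r^2T}\Big\{\Big[\Big(1+\frac1\rho\Big)\Big(\frac r\sigma\Big)^{d\wedge2}+\Big(\frac r\sigma\Big)^{2d}\Big]^{-1}\phi_T^{-1}\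 \mathbb E\big[\Delta(\hat\sigma_*^2,\sigma^2)\big]^2\Big\}\le C,$$ where $\mathbb E[\Delta]^2$ means $\mathbb E[\Delta^2]$ and $$\phi_T=\begin{cases}\ln^2T/T,&d>2,\\ \ln^3T/T,&d=2,\\ \ln^2T/\sqrt T,&d=1.\end{cases}$$ -/

import Mathlib

open MeasureTheory ProbabilityTheory Filter
open scoped ENNReal NNReal

namespace Smoluchowski

/-- Homogeneous Poisson point process of rate `lam` on `ℝᵈ`, given through its points `ξ j`:
the point measure `∑ j, dirac (ξ j)` has Poisson counts with mean `lam * vol A` on Borel sets `A`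
of finite volume, and independent counts on pairwise disjoint Borel sets. -/
structure IsPoissonProcess {d : ℕ} {Ω : Type*} [MeasurableSpace Ω] (lam : ℝ≥0)
    (ξ : ℤ → Ω → EuclideanSpace ℝ (Fin d)) (P : Measure Ω) : Prop where
  measurable : ∀ j, Measurable (ξ j)
  poisson_counts : ∀ A : Set (EuclideanSpace ℝ (Fin d)), MeasurableSet A → volume A ≠ ∞ →
    HasLaw (fun ω => Measure.sum (fun j => Measure.dirac (ξ j ω)) A)
      ((poissonMeasure (lam * (volume A).toNNReal)).map (fun n : ℕ => (n : ℝ≥0∞))) P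
  indep_counts : ∀ (n : ℕ) (A : Fin n → Set (EuclideanSpace ℝ (Fin d))),
    (∀ i, MeasurableSet (A i)) → Pairwise (fun i j => Disjoint (A i) (A j)) →
    iIndepFun (fun i ω => Measure.sum (fun j => Measure.dirac (ξ j ω)) (A i)) P

/-- Standard Brownian motion in `ℝᵈ`: the coordinates are independent standard real Brownian
motions (started at `0`, with almost surely continuous paths). -/
structure IsBrownian {d : ℕ} {Ω : Type*} [MeasurableSpace Ω]
    (W : ℝ≥0 → Ω → EuclideanSpace ℝ (Fin d)) (P : Measure Ω) : Prop where
  measurable : ∀ t, Measurable (W t)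
  coord : ∀ i, IsBrownianReal (fun t ω => W t ω i) P
  indep_coord : iIndepFun (fun (i : Fin d) (ω : Ω) (t : ℝ≥0) => W t ω i) P

/-- The random input of the Brownian displacement model: the initial positions `ξ j` form a
homogeneous Poisson process of rate `lam`, the `W j` are independent standard Brownian motions,
and the two families are independent. -/
structure IsBrownianSystem {d : ℕ} {Ω : Type*} [MeasurableSpace Ω] (lam : ℝ≥0)
    (ξ : ℤ → Ω → EuclideanSpace ℝ (Fin d)) (W : ℤ → ℝ≥0 → Ω → EuclideanSpace ℝ (Fin d))
    (P : Measure Ω) : Prop where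
  poisson : IsPoissonProcess lam ξ P
  brownian : ∀ j, IsBrownian (W j) P
  indep_brownian : iIndepFun (fun (j : ℤ) (ω : Ω) (t : ℝ≥0) => W j t ω) P
  indep : IndepFun (fun (ω : Ω) (j : ℤ) => ξ j ω)
    (fun (ω : Ω) (j : ℤ) (t : ℝ≥0) => W j t ω) P

noncomputable section

/-- The Smoluchowski process `N(t) = ∑ j, 1{ξ j + σ W j t ∈ B}`, `B` the closed ball of radius `r`
centred at the origin (`N(t)` is almost surely finite for every `t ≥ 0`). -/
def count {d : ℕ} {Ω : Type*} (ξ : ℤ → Ω → EuclideanSpace ℝ (Fin d))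
    (W : ℤ → ℝ≥0 → Ω → EuclideanSpace ℝ (Fin d)) (r σ : ℝ) (ω : Ω) (t : ℝ) : ℝ :=
  (∑' j : ℤ, (Metric.closedBall (0 : EuclideanSpace ℝ (Fin d)) r).indicator
    (fun _ => (1 : ℝ≥0∞)) (ξ j ω + σ • W j t.toNNReal ω)).toReal

/-- `ρ = lam * vol B`, the mean of `N(t)`. -/
def rho (d : ℕ) (lam : ℝ≥0) (r : ℝ) : ℝ :=
  lam * volume.real (Metric.closedBall (0 : EuclideanSpace ℝ (Fin d)) r)

/-- The empirical covariance function of an observed path `N`. -/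
def covEst (ρ T : ℝ) (N : ℝ → ℝ) (t : ℝ) : ℝ :=
  1 / (T - t) * ∫ s in (0 : ℝ)..(T - t), (N s - ρ) * (N (s + t) - ρ)

/-- The estimator of the correlation function, `{R̂(t)}₊ / ρ`. -/
def corrEst (ρ T : ℝ) (N : ℝ → ℝ) (t : ℝ) : ℝ :=
  1 / ρ * max (covEst ρ T N t) 0

/-- `Ψ̂_{α,b}`. -/
def psiEst (ρ T α b : ℝ) (N : ℝ → ℝ) : ℝ :=
  ∫ t in (0 : ℝ)..b, corrEst ρ T N t / t ^ (1 - α)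

/-- The lower incomplete Gamma function `γ(s; x)`. -/
def lowerGamma (s x : ℝ) : ℝ :=
  ∫ u in (0 : ℝ)..x, u ^ (s - 1) * Real.exp (-u)

/-- The function `J`, for which `J(σ² t)` is the correlation function of the process. -/
def J (d : ℕ) (r t : ℝ) : ℝ :=
  1 / (beta (((d : ℝ) + 1) / 2) (1 / 2) * Real.Gamma ((d : ℝ) / 2)) *
    ∫ y in (0 : ℝ)..1, lowerGamma ((d : ℝ) / 2) (2 * r ^ 2 * y / t) *
      (1 - y) ^ (((d : ℝ) - 1) / 2) * y ^ (-(1 / 2) : ℝ)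

/-- `J_α = ∫₀^∞ J(t) t^{α - 1} dt`. -/
def Jalpha (d : ℕ) (r α : ℝ) : ℝ :=
  ∫ t in Set.Ioi (0 : ℝ), J d r t / t ^ (1 - α)

/-- The estimator `(J_α / Ψ̂_{α,b})^{1/α}` of `σ²`. Where `Ψ̂_{α,b} = 0` it takes the value `0`;
its relative loss there is `1`, the same as for the value `+∞`. -/
def sigmaSqEst (d : ℕ) (r ρ T α b : ℝ) (N : ℝ → ℝ) : ℝ :=
  (Jalpha d r α / psiEst ρ T α b N) ^ (1 / α)

/-- `α_* = 1 / ln T`. -/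
def alphaStar (T : ℝ) : ℝ := 1 / Real.log T

/-- The truncation level `b_*`. -/
def bStar (d : ℕ) (T : ℝ) : ℝ :=
  if 2 < d then (T / Real.log T ^ 2) ^ (1 / (d : ℝ))
  else if d = 2 then (T / Real.log T ^ 3) ^ (1 / 2 : ℝ)
  else Real.sqrt T / Real.log T ^ 2

/-- The estimator `σ̂²_*`. -/
def sigmaSqStar (d : ℕ) (r ρ T : ℝ) (N : ℝ → ℝ) : ℝ :=
  sigmaSqEst d r ρ T (alphaStar T) (bStar d T) N

/-- The relative loss `Δ(x, y)`. -/
def relLoss (x y : ℝ) : ℝ := |x - y| / (x + y)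

/-- The rate `φ_T`. -/
def phi (d : ℕ) (T : ℝ) : ℝ :=
  if 2 < d then Real.log T ^ 2 / T
  else if d = 2 then Real.log T ^ 3 / T
  else Real.log T ^ 2 / Real.sqrt T

end

end Smoluchowski

open Smoluchowski

set_option linter.unusedSectionVars false

/-! The pairs (initial position, Brownian path) form a Poisson process on `ℝᵈ` × path space with
intensity `lam · vol ⊗ Q`, where `Q` is the law of one path, and `N(t)` counts the pairs in
`visitSet d r σ t`. Joint cumulants of such counts are the intensities of intersections of the sets
(`IsMarkedPoisson.integral_mul`, `IsMarkedPoisson.integral_prod_four`). For two times the intensity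
is the mean overlap of the ball with its Gaussian translate, so `Cov(N(s), N(t)) = ρ H(t - s)` with
`H(u) = J(σ²|u|)` for `u ≠ 0` (`integral_overlap_gaussE`, `intensity_visitSet_inter`). Write `Ψ =
∫₀^∞ H(t) t^(α-1) dt`. A change of variable gives `Ψ = σ^(-2α) J_α` (`psi_eq`), and the estimator of
`σ²` inverts this relation.

The loss is at most `(1/α) |Ψ̂ - Ψ| / Ψ` (`relLoss_le`). Since `H` is bounded below on `(0,
(r/σ)²]`, `Ψ ≥ c (r/σ)^(2α) / α` (`le_psi`). With `α = 1/ln T` and `σ² ≤ r² T` one has `(r/σ)^(2α) ≥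
T^(-α) = 1/e`, so the factors `1/α` cancel and the loss is at most a constant times `|Ψ̂ - Ψ|`.

The error of `Ψ̂` has two parts. Stochastic part: the fourth-moment formula bounds the mean square
error of `Ĥ(t)` by `(8/T)(1 + 1/ρ) ∫₀^T H`, uniformly in `t ≤ T/2`
(`IsBrownianSystem.covEst_error`), and Minkowski's inequality costs a factor `(b^α/α)² ≤ e² ln² T`.
As `H(u)` is at most `1` and decays like `(r/σ)^d u^(-d/2)`, `∫₀^T H` is of order at most `(r/σ)²`,
`(r/σ)² ln T` or `(r/σ) √T` for `d > 2`, `d = 2`, `d = 1`. Truncation part: the integral beyond `b`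
is of order at most `(r/σ)^d b^(-d/2)`, and `b_*` solves `b^(-d) = φ_T`. Together
(`IsBrownianSystem.psiEst_error`, `exists_risk_le`) this bounds the risk for every `T ≥ e⁴`, not
only in the limit. -/

namespace Smoluchowski

/-! ### Laplace functionals of Poisson and independently marked Poisson processes. -/

section

/-- The function `x ↦ exp (-x)` on `[0, ∞]`, with value `0` at `∞`. -/
noncomputable def expNeg (x : ℝ≥0∞) : ℝ := (EReal.exp (-(x : EReal))).toReal

lemma EReal_exp_neg_ne_top (x : ℝ≥0∞) : EReal.exp (-(x : EReal)) ≠ ∞ := by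
  rw [Ne, EReal.exp_eq_top_iff, EReal.neg_eq_top_iff]
  exact (EReal.bot_lt_zero.trans_le (EReal.coe_ennreal_nonneg x)).ne'

lemma EReal_exp_neg_le_one (x : ℝ≥0∞) : EReal.exp (-(x : EReal)) ≤ 1 := by
  rw [EReal.exp_le_one_iff]
  simpa using EReal.coe_ennreal_nonneg x

lemma expNeg_nonneg (x : ℝ≥0∞) : 0 ≤ expNeg x := ENNReal.toReal_nonneg

lemma expNeg_le_one (x : ℝ≥0∞) : expNeg x ≤ 1 :=
  ENNReal.toReal_mono ENNReal.one_ne_top (EReal_exp_neg_le_one x)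

lemma expNeg_of_ne_top {x : ℝ≥0∞} (hx : x ≠ ∞) : expNeg x = Real.exp (-x.toReal) := by
  lift x to ℝ≥0 using hx
  have : (-((x : ℝ≥0∞) : EReal)) = ((-(x : ℝ) : ℝ) : EReal) := by
    simp
    rfl
  rw [expNeg, this, EReal.exp_coe, ENNReal.toReal_ofReal (Real.exp_nonneg _)]
  rfl

lemma expNeg_zero : expNeg 0 = 1 := by simp [expNeg]

lemma expNeg_add (x y : ℝ≥0∞) : expNeg (x + y) = expNeg x * expNeg y := by
  rw [expNeg, expNeg, expNeg, ← ENNReal.toReal_mul, ← EReal.exp_add, EReal.coe_ennreal_add,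
    EReal.neg_add, sub_eq_add_neg]
  · left
    exact (EReal.bot_lt_zero.trans_le (EReal.coe_ennreal_nonneg x)).ne'
  · right
    exact (EReal.bot_lt_zero.trans_le (EReal.coe_ennreal_nonneg y)).ne'

lemma expNeg_sum {ι : Type*} (s : Finset ι) (f : ι → ℝ≥0∞) :
    expNeg (∑ i ∈ s, f i) = ∏ i ∈ s, expNeg (f i) := by
  classical
  induction s using Finset.induction_on with
  | empty => simp [expNeg_zero]
  | insert a s ha ih => rw [Finset.sum_insert ha, Finset.prod_insert ha, expNeg_add, ih]

/-- Continuity at `∞` is included, so Laplace transforms pass to limits before the sums are known to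
be finite. -/
lemma continuous_expNeg : Continuous expNeg := by
  rw [← continuousOn_univ]
  refine ENNReal.continuousOn_toReal.comp (t := {x | x ≠ ∞}) ?_
    fun x _ => EReal_exp_neg_ne_top x
  exact (ENNReal.continuous_exp.comp
    (continuous_neg.comp continuous_coe_ennreal_ereal)).continuousOn

lemma measurable_expNeg : Measurable expNeg := continuous_expNeg.measurable

lemma one_sub_expNeg_le {x : ℝ≥0∞} (hx : x ≠ ∞) : 1 - expNeg x ≤ x.toReal := by
  rw [expNeg_of_ne_top hx]
  linarith [Real.add_one_le_exp (-x.toReal)]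

lemma norm_expNeg_le_one (x : ℝ≥0∞) : ‖expNeg x‖ ≤ 1 := by
  rw [Real.norm_of_nonneg (expNeg_nonneg x)]
  exact expNeg_le_one x

/-- Laplace transform of a Poisson variable. -/
lemma integral_expNeg_mul_poisson (m : ℝ≥0) (c : ℝ≥0∞) :
    ∫ x, expNeg (c * x) ∂((poissonMeasure m).map (fun n : ℕ => (n : ℝ≥0∞)))
      = Real.exp (-(m * (1 - expNeg c))) := by
  have hmeas : Measurable (fun x : ℝ≥0∞ => expNeg (c * x)) :=
    measurable_expNeg.comp (measurable_const.mul measurable_id)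
  rw [integral_map (measurable_of_countable _).aemeasurable hmeas.aestronglyMeasurable,
    integral_poissonMeasure]
  have h : ∀ n : ℕ, expNeg (c * n) = expNeg c ^ n := by
    intro n
    induction n with
    | zero => simp [expNeg_zero]
    | succ n ih => rw [Nat.cast_succ, mul_add, expNeg_add, ih, mul_one, pow_succ]
  have h2 : ∀ n : ℕ, (Real.exp (-(m : ℝ)) * (m : ℝ) ^ n / n.factorial) • expNeg (c * n)
      = Real.exp (-(m : ℝ)) * ((m * expNeg c) ^ n / n.factorial) := by
    intro n
    rw [h, smul_eq_mul, mul_pow]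
    ring
  simp_rw [h2]
  rw [tsum_mul_left, (NormedSpace.expSeries_div_hasSum_exp (m * expNeg c : ℝ)).tsum_eq,
    ← Real.exp_eq_exp_ℝ, ← Real.exp_add]
  congr 1
  ring

variable {d : ℕ} {Ω : Type*} [MeasurableSpace Ω] {P : Measure Ω} {lam : ℝ≥0}
  {ξ : ℤ → Ω → EuclideanSpace ℝ (Fin d)}

/-- The sum is a linear combination of the counts in the level sets of `s`, which are independent
Poisson variables, so the Laplace transform factorises. -/
lemma IsPoissonProcess.integral_expNeg_simpleFunc [IsProbabilityMeasure P]
    (h : IsPoissonProcess lam ξ P) (s : SimpleFunc (EuclideanSpace ℝ (Fin d)) ℝ≥0∞)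
    (hfin : ∫⁻ x, s x ≠ ∞) :
    ∫ ω, expNeg (∑' j, s (ξ j ω)) ∂P = Real.exp (-(lam * ∫ x, (1 - expNeg (s x)))) := by
  classical
  -- The value `0` is dropped because its level set has infinite volume; all others have finite
  -- volume, `s` being integrable.
  set R := s.range.filter (· ≠ 0) with hR
  have hfs : s.FinMeasSupp volume :=
    SimpleFunc.FinMeasSupp.of_lintegral_ne_top (by rwa [← SimpleFunc.lintegral_eq_lintegral])
  have hvol : ∀ c : R, volume (s ⁻¹' {(c : ℝ≥0∞)}) ≠ ∞ := fun c =>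
    (SimpleFunc.finMeasSupp_iff.1 hfs c (Finset.mem_filter.1 c.2).2).ne
  let e := R.equivFin.symm
  set A : Fin R.card → Set (EuclideanSpace ℝ (Fin d)) := fun i => s ⁻¹' {(e i : ℝ≥0∞)} with hA
  have hAm : ∀ i, MeasurableSet (A i) := fun i => s.measurableSet_preimage _
  have hAd : Pairwise (fun i j => Disjoint (A i) (A j)) := by
    intro i j hij
    refine Disjoint.preimage _ (Set.disjoint_singleton.2 fun h' => hij ?_)
    exact e.injective (Subtype.ext h')
  have hind := h.indep_counts _ A hAm hAd
  have hlaw := fun i => h.poisson_counts (A i) (hAm i) (hvol (e i))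
  have hsum : ∀ ω, ∑' j, s (ξ j ω)
      = ∑ i, (e i : ℝ≥0∞) * Measure.sum (fun j => Measure.dirac (ξ j ω)) (A i) := by
    intro ω
    have h1 : ∑' j, s (ξ j ω) = ∫⁻ x, s x ∂(Measure.sum (fun j => Measure.dirac (ξ j ω))) := by
      rw [lintegral_sum_measure]
      simp
    rw [h1, SimpleFunc.lintegral_eq_lintegral, SimpleFunc.lintegral,
      ← Finset.sum_filter_of_ne (p := (· ≠ 0)) (fun x _ hx h0 => hx (by simp [h0])),
      ← hR, ← Finset.sum_coe_sort R (fun c => c * _), ← e.sum_comp]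
  have hcm : ∀ i, Measurable fun x : ℝ≥0∞ => expNeg ((e i : ℝ≥0∞) * x) := fun i =>
    measurable_expNeg.comp (measurable_const.mul measurable_id)
  simp_rw [hsum, expNeg_sum]
  rw [hind.integral_fun_prod_comp (fun i => (hlaw i).aemeasurable)
    (f := fun i x => expNeg ((e i : ℝ≥0∞) * x)) (fun i => (hcm i).aestronglyMeasurable)]
  have h3 : ∀ i, ∫ ω, expNeg ((e i : ℝ≥0∞) * Measure.sum (fun j => Measure.dirac (ξ j ω)) (A i)) ∂P
      = Real.exp (-(lam * (volume.real (A i) * (1 - expNeg (e i : ℝ≥0∞))))) := by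
    intro i
    have := (hlaw i).integral_comp (hcm i).aestronglyMeasurable
    rw [integral_expNeg_mul_poisson] at this
    rw [Function.comp_def] at this
    rw [this]
    push_cast
    rw [mul_assoc]
    rfl
  rw [Finset.prod_congr rfl fun i _ => h3 i, ← Real.exp_sum, Finset.sum_neg_distrib,
    ← Finset.mul_sum]
  have hg : ∫ x, (1 - expNeg (s x)) = ∑ i, volume.real (A i) * (1 - expNeg (e i : ℝ≥0∞)) := by
    have hpt : ∀ x, 1 - expNeg (s x) =
        ∑ i, (A i).indicator (fun _ => 1 - expNeg (e i : ℝ≥0∞)) x := by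
      intro x
      by_cases hx : s x = 0
      · rw [hx, expNeg_zero, sub_self]
        refine (Finset.sum_eq_zero fun i _ => Set.indicator_of_notMem (fun hi => ?_) _).symm
        exact (Finset.mem_filter.1 (e i).2).2 ((Set.mem_singleton_iff.1 hi).symm.trans hx)
      · have hm : s x ∈ R := Finset.mem_filter.2 ⟨s.mem_range_self x, hx⟩
        rw [Finset.sum_eq_single (e.symm ⟨s x, hm⟩)]
        · rw [Set.indicator_of_mem] <;> simp [hA]
        · intro i _ hi
          refine Set.indicator_of_notMem (fun hi' => hi ?_) _
          rw [e.eq_symm_apply]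
          exact Subtype.ext (Set.mem_singleton_iff.1 hi').symm
        · simp
    simp_rw [hpt]
    rw [integral_finsetSum]
    · refine Finset.sum_congr rfl fun i _ => ?_
      rw [integral_indicator_const _ (hAm i), smul_eq_mul]
    · intro i _
      exact (integrable_indicator_iff (hAm i)).2 (integrableOn_const (hvol (e i)))
  rw [hg]

/-- Laplace functional of a Poisson process. -/
theorem IsPoissonProcess.integral_expNeg [IsProbabilityMeasure P]
    (h : IsPoissonProcess lam ξ P) {f : EuclideanSpace ℝ (Fin d) → ℝ≥0∞} (hf : Measurable f)
    (hft : ∀ x, f x ≠ ∞) (hfin : ∫⁻ x, f x ≠ ∞) :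
    ∫ ω, expNeg (∑' j, f (ξ j ω)) ∂P = Real.exp (-(lam * ∫ x, (1 - expNeg (f x)))) := by
  set s := SimpleFunc.eapprox f with hs
  have hsle : ∀ n x, s n x ≤ f x := fun n x => by
    rw [← SimpleFunc.iSup_eapprox_apply hf x]
    exact le_iSup (fun n => SimpleFunc.eapprox f n x) n
  have hsf : ∀ n, ∫⁻ x, s n x ≠ ∞ := fun n =>
    ne_top_of_le_ne_top hfin (lintegral_mono (hsle n))
  have hmono : ∀ x, Monotone fun n => s n x := fun x m n hmn =>
    SimpleFunc.monotone_eapprox f hmn x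
  -- The sum is an integral against counting measure on `ℤ`, hence monotone convergence applies.
  have h1 : ∀ ω, Tendsto (fun n => ∑' j, s n (ξ j ω)) atTop (nhds (∑' j, f (ξ j ω))) := by
    intro ω
    have e1 : ∀ g : EuclideanSpace ℝ (Fin d) → ℝ≥0∞, ∑' j, g (ξ j ω)
        = ∫⁻ j, g (ξ j ω) ∂Measure.count := fun g => by
      rw [lintegral_count]
    simp_rw [e1 (s _), e1 f]
    exact lintegral_tendsto_of_tendsto_of_monotone
      (fun n => (measurable_of_countable _).aemeasurable)
      (ae_of_all _ fun j => hmono _) (ae_of_all _ fun j => SimpleFunc.tendsto_eapprox hf _)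
  have h2 : Tendsto (fun n => ∫ ω, expNeg (∑' j, s n (ξ j ω)) ∂P) atTop
      (nhds (∫ ω, expNeg (∑' j, f (ξ j ω)) ∂P)) := by
    refine tendsto_integral_of_dominated_convergence (fun _ => 1) (fun n => ?_)
      (integrable_const _) (fun n => ae_of_all _ fun ω => norm_expNeg_le_one _)
      (ae_of_all _ fun ω => (continuous_expNeg.tendsto _).comp (h1 ω))
    exact (measurable_expNeg.comp (Measurable.tsum fun j =>
      (s n).measurable.comp (h.measurable j))).aestronglyMeasurable
  have h3 : Tendsto (fun n => ∫ x, (1 - expNeg (s n x))) atTop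
      (nhds (∫ x, (1 - expNeg (f x)))) := by
    refine tendsto_integral_of_dominated_convergence (fun x => (f x).toReal) (fun n => ?_)
      (integrable_toReal_of_lintegral_ne_top hf.aemeasurable hfin)
      (fun n => ae_of_all _ fun x => ?_)
      (ae_of_all _ fun x => tendsto_const_nhds.sub
        ((continuous_expNeg.tendsto _).comp (SimpleFunc.tendsto_eapprox hf x)))
    · exact (measurable_const.sub (measurable_expNeg.comp (s n).measurable)).aestronglyMeasurable
    · rw [Real.norm_of_nonneg (sub_nonneg.2 (expNeg_le_one _))]
      exact (one_sub_expNeg_le (ne_top_of_le_ne_top (hft x) (hsle n x))).trans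
        (ENNReal.toReal_mono (hft x) (hsle n x))
  simp_rw [h.integral_expNeg_simpleFunc (s _) (hsf _)] at h2
  exact tendsto_nhds_unique h2 ((Real.continuous_exp.tendsto _).comp (h3.const_mul _).neg)

variable {M : Type*} [MeasurableSpace M] {Q : Measure M} {Y : ℤ → Ω → M}

/-- Independence gives the product formula for finite partial sums; boundedness of `expNeg` carries
it to the limit. -/
lemma integral_expNeg_tsum_of_iIndepFun [IsProbabilityMeasure P] [IsProbabilityMeasure Q]
    (hYm : ∀ j, HasLaw (Y j) Q P) (hYi : iIndepFun Y P) {g : ℤ → M → ℝ≥0∞}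
    (hg : ∀ j, Measurable (g j)) {f : ℤ → ℝ≥0∞}
    (hf : ∀ j, ∫ y, expNeg (g j y) ∂Q = expNeg (f j)) :
    ∫ ω, expNeg (∑' j, g j (Y j ω)) ∂P = expNeg (∑' j, f j) := by
  have hm : ∀ j, Measurable fun y => expNeg (g j y) := fun j => measurable_expNeg.comp (hg j)
  have hfin : ∀ s : Finset ℤ,
      ∫ ω, expNeg (∑ j ∈ s, g j (Y j ω)) ∂P = expNeg (∑ j ∈ s, f j) := by
    intro s
    have hYs : iIndepFun (fun j : s => Y j) P := hYi.precomp Subtype.val_injective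
    have h1 := iIndepFun.integral_fun_prod_comp (X := fun j : s => Y j) hYs
      (fun j => (hYm j).aemeasurable) (f := fun (j : s) (y : M) => expNeg (g j y))
      (fun j => (hm j).aestronglyMeasurable)
    have h2 : ∀ ω, expNeg (∑ j ∈ s, g j (Y j ω)) = ∏ j : s, expNeg (g j (Y j ω)) := fun ω => by
      rw [expNeg_sum, ← Finset.prod_coe_sort s fun j => expNeg (g j (Y j ω))]
    simp_rw [h2]
    rw [h1, expNeg_sum, ← Finset.prod_coe_sort s fun j => expNeg (f j)]
    refine Finset.prod_congr rfl fun j _ => ?_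
    rw [← hf]
    exact (hYm j).integral_comp (hm j).aestronglyMeasurable
  have h1 : Tendsto (fun s : Finset ℤ => ∫ ω, expNeg (∑ j ∈ s, g j (Y j ω)) ∂P) atTop
      (nhds (∫ ω, expNeg (∑' j, g j (Y j ω)) ∂P)) := by
    refine tendsto_integral_filter_of_dominated_convergence (fun _ => 1)
      (Eventually.of_forall fun s => ?_) (Eventually.of_forall fun s => ae_of_all _ fun ω =>
        norm_expNeg_le_one _) (integrable_const _)
      (ae_of_all _ fun ω => (continuous_expNeg.tendsto _).comp ENNReal.summable.hasSum)
    refine (measurable_expNeg.comp_aemeasurable (Finset.aemeasurable_fun_sum _ fun j _ =>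
      (hg j).comp_aemeasurable (hYm j).aemeasurable)).aestronglyMeasurable
  simp_rw [hfin] at h1
  exact tendsto_nhds_unique h1 ((continuous_expNeg.tendsto _).comp ENNReal.summable.hasSum)

/-- Laplace functional of an independently marked Poisson process. -/
theorem IsPoissonProcess.integral_expNeg_marked [IsProbabilityMeasure P] [IsProbabilityMeasure Q]
    (h : IsPoissonProcess lam ξ P) (hY : ∀ j, Measurable (Y j)) (hYm : ∀ j, HasLaw (Y j) Q P)
    (hYi : iIndepFun Y P)
    (hind : IndepFun (fun ω j => ξ j ω) (fun ω j => Y j ω) P)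
    {g : EuclideanSpace ℝ (Fin d) × M → ℝ≥0∞} (hg : Measurable g) {c : ℝ≥0}
    (hgc : ∀ z, g z ≤ c) (hfin : ∫⁻ z, g z ∂(volume.prod Q) ≠ ∞) :
    ∫ ω, expNeg (∑' j, g (ξ j ω, Y j ω)) ∂P
      = Real.exp (-(lam * ∫ z, (1 - expNeg (g z)) ∂(volume.prod Q))) := by
  have hgt : ∀ z, g z ≠ ∞ := fun z => ne_top_of_le_ne_top ENNReal.coe_ne_top (hgc z)
  have hem : Measurable fun z => expNeg (g z) := measurable_expNeg.comp hg
  have hei : Integrable (fun z => 1 - expNeg (g z)) (volume.prod Q) := by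
    refine (integrable_toReal_of_lintegral_ne_top hg.aemeasurable hfin).mono'
      (measurable_const.sub hem).aestronglyMeasurable (ae_of_all _ fun z => ?_)
    rw [Real.norm_of_nonneg (sub_nonneg.2 (expNeg_le_one _))]
    exact one_sub_expNeg_le (hgt z)
  have hib : ∀ x, Integrable (fun y => expNeg (g (x, y))) Q := fun x =>
    Integrable.of_bound (hem.comp measurable_prodMk_left).aestronglyMeasurable 1
      (ae_of_all _ fun y => norm_expNeg_le_one _)
  set G : EuclideanSpace ℝ (Fin d) → ℝ := fun x => ∫ y, expNeg (g (x, y)) ∂Q with hG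
  have hGm : Measurable G := (hem.stronglyMeasurable.integral_prod_right (ν := Q)).measurable
  have hG1 : ∀ x, G x ≤ 1 := fun x => by
    have := integral_mono (hib x) (integrable_const (1 : ℝ)) fun y => expNeg_le_one _
    simpa using this
  have hG0 : ∀ x, Real.exp (-(c : ℝ)) ≤ G x := fun x => by
    have h1 : ∀ y, Real.exp (-(c : ℝ)) ≤ expNeg (g (x, y)) := fun y => by
      rw [expNeg_of_ne_top (hgt _), Real.exp_le_exp, neg_le_neg_iff]
      exact ENNReal.toReal_mono ENNReal.coe_ne_top (hgc _)
    have := integral_mono (integrable_const (Real.exp (-(c : ℝ)))) (hib x) h1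
    simpa using this
  have hGpos : ∀ x, 0 < G x := fun x => (Real.exp_pos _).trans_le (hG0 x)
  -- Averaging over the marks replaces `expNeg (g (x, ·))` by `G x = expNeg (f x)`, which reduces
  -- the claim to the unmarked functional of `f`.
  set f : EuclideanSpace ℝ (Fin d) → ℝ≥0∞ := fun x => ENNReal.ofReal (-Real.log (G x)) with hf
  have hfm : Measurable f := (Real.measurable_log.comp hGm).neg.ennreal_ofReal
  have hfG : ∀ x, expNeg (f x) = G x := fun x => by
    rw [expNeg_of_ne_top ENNReal.ofReal_ne_top, ENNReal.toReal_ofReal, neg_neg,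
      Real.exp_log (hGpos x)]
    exact neg_nonneg.2 (Real.log_nonpos (hGpos x).le (hG1 x))
  have hGint : ∫ x, (1 - G x) = ∫ z, (1 - expNeg (g z)) ∂(volume.prod Q) := by
    rw [integral_prod _ hei]
    refine integral_congr_ae (ae_of_all _ fun x => ?_)
    simp only [hG]
    rw [integral_sub (integrable_const _) (hib x)]
    simp
  have hGi : Integrable (fun x => 1 - G x) := by
    refine hei.integral_prod_left.congr (ae_of_all _ fun x => ?_)
    simp only [hG]
    rw [integral_sub (integrable_const _) (hib x)]
    simp
  have hffin : ∫⁻ x, f x ≠ ∞ := by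
    -- The bound `g ≤ c` keeps `G` above `exp (-c)`, where `-log G` is comparable with the
    -- integrable `1 - G`.
    have hle : ∀ x, f x ≤ ENNReal.ofReal (Real.exp c * (1 - G x)) := fun x => by
      refine ENNReal.ofReal_le_ofReal ?_
      have h1 := Real.one_sub_inv_le_log_of_pos (hGpos x)
      have h2 : (G x)⁻¹ ≤ Real.exp c := by
        rw [inv_le_comm₀ (hGpos x) (Real.exp_pos _), ← Real.exp_neg]
        exact hG0 x
      have h3 : (G x)⁻¹ - 1 = (G x)⁻¹ * (1 - G x) := by
        rw [mul_sub, inv_mul_cancel₀ (hGpos x).ne', mul_one]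
      have h4 := mul_le_mul_of_nonneg_right h2 (sub_nonneg.2 (hG1 x))
      linarith
    exact ne_top_of_le_ne_top (hGi.const_mul _).lintegral_lt_top.ne (lintegral_mono hle)
  rw [← hGint]
  simp_rw [← hfG]
  rw [← h.integral_expNeg hfm (fun x => ENNReal.ofReal_ne_top) hffin]
  -- Points and marks are independent, so the expectation is an iterated integral, with the marks
  -- integrated first at frozen points.
  set F : (ℤ → EuclideanSpace ℝ (Fin d)) × (ℤ → M) → ℝ :=
    fun p => expNeg (∑' j, g (p.1 j, p.2 j)) with hF
  have hFm : Measurable F := measurable_expNeg.comp (Measurable.tsum fun j =>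
    hg.comp (((measurable_pi_apply j).comp measurable_fst).prodMk
      ((measurable_pi_apply j).comp measurable_snd)))
  have hξm : Measurable fun ω j => ξ j ω := measurable_pi_lambda _ h.measurable
  have hYm' : Measurable fun ω j => Y j ω := measurable_pi_lambda _ hY
  have hmap := (indepFun_iff_map_prod_eq_prod_map_map hξm.aemeasurable hYm'.aemeasurable).1 hind
  have e1 : ∫ ω, expNeg (∑' j, g (ξ j ω, Y j ω)) ∂P
      = ∫ p, F p ∂((P.map fun ω j => ξ j ω).prod (P.map fun ω j => Y j ω)) := by
    rw [← hmap, integral_map (hξm.prodMk hYm').aemeasurable hFm.aestronglyMeasurable]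
  have : IsProbabilityMeasure (P.map fun ω j => ξ j ω) :=
    Measure.isProbabilityMeasure_map hξm.aemeasurable
  have : IsProbabilityMeasure (P.map fun ω j => Y j ω) :=
    Measure.isProbabilityMeasure_map hYm'.aemeasurable
  rw [e1, integral_prod _ (Integrable.of_bound hFm.aestronglyMeasurable 1
    (ae_of_all _ fun y => norm_expNeg_le_one _))]
  have e2 : ∀ x : ℤ → EuclideanSpace ℝ (Fin d),
      ∫ y, F (x, y) ∂(P.map fun ω j => Y j ω) = expNeg (∑' j, f (x j)) := fun x => by
    have hFx : Measurable fun y => F (x, y) := hFm.comp measurable_prodMk_left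
    rw [integral_map hYm'.aemeasurable hFx.aestronglyMeasurable]
    exact integral_expNeg_tsum_of_iIndepFun hYm hYi (g := fun j y => g (x j, y))
      (fun j => hg.comp measurable_prodMk_left) (fun j => (hfG (x j)).symm)
  simp_rw [e2]
  rw [integral_map hξm.aemeasurable]
  exact (measurable_expNeg.comp (Measurable.tsum fun j =>
    hfm.comp (measurable_pi_apply j))).aestronglyMeasurable

end

/-! ### Moments from Laplace transforms, and compound Poisson sums. -/

section

section Moments

variable {Ω : Type*} [MeasurableSpace Ω] {P : Measure Ω}

/-- The `n`-th derivative of `u ↦ ∑ k < 5, m k * (exp (u * k) - 1)`, for `n ≥ 1`. -/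
noncomputable def expSum (m : ℕ → ℝ) (n : ℕ) (u : ℝ) : ℝ :=
  ∑ k ∈ Finset.range 5, m k * (k : ℝ) ^ n * Real.exp (u * k)

/-- The derivatives of order at most `4` of `exp (expSum m 0 - expSum m 0 0)`. -/
noncomputable def mgfDeriv (m : ℕ → ℝ) : ℕ → ℝ → ℝ
  | 0, u => Real.exp (expSum m 0 u - expSum m 0 0)
  | 1, u => expSum m 1 u * Real.exp (expSum m 0 u - expSum m 0 0)
  | 2, u => (expSum m 2 u + expSum m 1 u ^ 2) * Real.exp (expSum m 0 u - expSum m 0 0)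
  | 3, u => (expSum m 3 u + 3 * expSum m 1 u * expSum m 2 u + expSum m 1 u ^ 3) *
      Real.exp (expSum m 0 u - expSum m 0 0)
  | _, u => (expSum m 4 u + 4 * expSum m 1 u * expSum m 3 u + 3 * expSum m 2 u ^ 2 +
      6 * expSum m 1 u ^ 2 * expSum m 2 u + expSum m 1 u ^ 4) *
      Real.exp (expSum m 0 u - expSum m 0 0)

lemma hasDerivAt_expSum (m : ℕ → ℝ) (n : ℕ) (u : ℝ) :
    HasDerivAt (expSum m n) (expSum m (n + 1) u) u := by
  unfold expSum
  refine HasDerivAt.fun_sum fun k _ => ?_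
  have := (((hasDerivAt_id u).mul_const (k : ℝ)).exp).const_mul (m k * (k : ℝ) ^ n)
  refine (this.congr_deriv ?_)
  simp only [id]
  ring

lemma hasDerivAt_mgfDeriv (m : ℕ → ℝ) {n : ℕ} (hn : n < 4) (u : ℝ) :
    HasDerivAt (mgfDeriv m n) (mgfDeriv m (n + 1) u) u := by
  have h0 := ((hasDerivAt_expSum m 0 u).sub_const (expSum m 0 0)).exp
  have h1 := hasDerivAt_expSum m 1 u
  have h2 := hasDerivAt_expSum m 2 u
  have h3 := hasDerivAt_expSum m 3 u
  interval_cases n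
  · refine h0.congr_deriv ?_
    simp only [mgfDeriv]
    ring
  · refine (h1.mul h0).congr_deriv ?_
    simp only [mgfDeriv]
    ring
  · refine ((h2.add (h1.pow 2)).mul h0).congr_deriv ?_
    simp only [mgfDeriv, Pi.add_apply, Pi.pow_apply]
    push_cast
    ring
  · refine (((h3.add ((h1.const_mul 3).mul h2)).add (h1.pow 3)).mul h0).congr_deriv ?_
    simp only [mgfDeriv, Pi.add_apply, Pi.pow_apply, Pi.mul_apply]
    push_cast
    ring

lemma continuous_mgfDeriv_zero (m : ℕ → ℝ) {n : ℕ} (hn : n ≤ 4) :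
    ContinuousAt (mgfDeriv m n) 0 := by
  rcases hn.lt_or_eq with h | rfl
  · exact (hasDerivAt_mgfDeriv m h 0).continuousAt
  · have hc : ∀ n, Continuous (expSum m n) := fun n => by unfold expSum; fun_prop
    have h0 := hc 0
    have h1 := hc 1
    have h2 := hc 2
    have h3 := hc 3
    have h4 := hc 4
    unfold mgfDeriv
    fun_prop

/-- The first four moments of a nonnegative variable whose Laplace transform is that of
`∑ k * Z k`, with the `Z k` independent Poisson variables of parameters `m k`. -/
lemma moments_of_laplace [IsProbabilityMeasure P] {S : Ω → ℝ≥0∞} (hS : AEMeasurable S P)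
    {m : ℕ → ℝ} (hL : ∀ u : ℝ, 0 < u → ∫ ω, expNeg (ENNReal.ofReal u * S ω) ∂P
      = mgfDeriv m 0 (-u)) :
    (∀ᵐ ω ∂P, S ω ≠ ∞) ∧ ∀ n ≤ 4, Integrable (fun ω => (S ω).toReal ^ n) P ∧
      ∫ ω, (S ω).toReal ^ n ∂P = mgfDeriv m n 0 := by
  set v : ℕ → ℝ := fun k => -(1 / ((k : ℝ) + 1)) with hv
  have hv0 : ∀ k, v k < 0 := fun k => by simp only [hv]; rw [neg_lt_zero]; positivity
  have hvt : Tendsto v atTop (nhds 0) := by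
    simpa [hv] using (tendsto_one_div_add_atTop_nhds_zero_nat (𝕜 := ℝ)).neg
  have hφ : ∀ n ≤ 4, Tendsto (fun k => mgfDeriv m n (v k)) atTop (nhds (mgfDeriv m n 0)) :=
    fun n hn => (continuous_mgfDeriv_zero m hn).tendsto.comp hvt
  -- On `{S = ∞}` the Laplace variable vanishes for every `u > 0`, while its mean tends to `1` as
  -- `u` decreases to `0`.
  have hfinS : ∀ᵐ ω ∂P, S ω ≠ ∞ := by
    have hms : NullMeasurableSet {ω | S ω ≠ ∞} P :=
      (hS.nullMeasurable (measurableSet_singleton ∞)).compl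
    have hle : ∀ k, mgfDeriv m 0 (v k) ≤ P.real {ω | S ω ≠ ∞} := by
      intro k
      have := hL (-(v k)) (neg_pos.2 (hv0 k))
      rw [neg_neg] at this
      have hone : ∫ ω, {ω | S ω ≠ ∞}.indicator (fun _ => (1 : ℝ)) ω ∂P
          = P.real {ω | S ω ≠ ∞} := by
        rw [integral_indicator₀ hms]
        simp
      rw [← this, ← hone]
      refine integral_mono ?_ ((integrable_const (1 : ℝ)).indicator₀ hms) fun ω => ?_
      · exact Integrable.of_bound (measurable_expNeg.comp_aemeasurable
          (hS.const_mul _)).aestronglyMeasurable 1 (ae_of_all _ fun y => norm_expNeg_le_one _)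
      · by_cases h : S ω = ∞
        · have : ω ∉ {ω | S ω ≠ ∞} := by simpa using h
          rw [Set.indicator_of_notMem this, h, ENNReal.mul_top (ENNReal.ofReal_pos.2 (by positivity)).ne']
          simp [expNeg]
        · have : ω ∈ {ω | S ω ≠ ∞} := h
          rw [Set.indicator_of_mem this]
          exact expNeg_le_one _
    have h1 := le_of_tendsto' (hφ 0 (by norm_num)) hle
    have h2 : mgfDeriv m 0 0 = 1 := by simp [mgfDeriv]
    rw [h2] at h1
    have h3 : P.real {ω | S ω ≠ ∞} = 1 := le_antisymm measureReal_le_one h1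
    rw [measureReal_def, ENNReal.toReal_eq_one_iff] at h3
    exact (prob_compl_eq_zero_iff₀ hms).2 h3
  refine ⟨hfinS, ?_⟩
  set Z : Ω → ℝ := fun ω => (S ω).toReal with hZ
  have hZm : AEMeasurable Z P := hS.ennreal_toReal
  have hZ0 : ∀ ω, 0 ≤ Z ω := fun ω => ENNReal.toReal_nonneg
  have hset : Set.Iic 0 ⊆ integrableExpSet Z P := by
    intro u hu
    refine Integrable.of_bound (hZm.const_mul u).exp.aestronglyMeasurable 1
      (ae_of_all _ fun ω => ?_)
    rw [Real.norm_of_nonneg (Real.exp_nonneg _), Real.exp_le_one_iff]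
    exact mul_nonpos_of_nonpos_of_nonneg hu (hZ0 ω)
  have hint : ∀ u < 0, u ∈ interior (integrableExpSet Z P) := fun u hu =>
    interior_mono hset (by rwa [interior_Iic])
  -- Each `u < 0` is interior to the set where the exponential moment exists, so one may
  -- differentiate under the integral.
  have hψ : ∀ n ≤ 4, ∀ u < 0, ∫ ω, Z ω ^ n * Real.exp (u * Z ω) ∂P = mgfDeriv m n u := by
    intro n
    induction n with
    | zero =>
      intro _ u hu
      have := hL (-u) (neg_pos.2 hu)
      rw [neg_neg] at this
      rw [← this]
      refine integral_congr_ae ?_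
      filter_upwards [hfinS] with ω hω
      rw [expNeg_of_ne_top (ENNReal.mul_ne_top ENNReal.ofReal_ne_top hω), ENNReal.toReal_mul,
        ENNReal.toReal_ofReal (neg_nonneg.2 hu.le)]
      simp [hZ]
    | succ n ih =>
      intro hn u hu
      have h1 := hasDerivAt_integral_pow_mul_exp_real (hint u hu) n
      have h2 := hasDerivAt_mgfDeriv m (show n < 4 by omega) u
      refine h1.unique (h2.congr_of_eventuallyEq ?_)
      filter_upwards [Iio_mem_nhds hu] with w hw
      exact ih (by omega) w hw
  intro n hn
  have hpt : ∀ ω, Tendsto (fun k => ENNReal.ofReal (Z ω ^ n * Real.exp (v k * Z ω))) atTop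
      (nhds (ENNReal.ofReal (Z ω ^ n))) := by
    intro ω
    refine ENNReal.tendsto_ofReal ?_
    have : Tendsto (fun k => Z ω ^ n * Real.exp (v k * Z ω)) atTop
        (nhds (Z ω ^ n * Real.exp (0 * Z ω))) :=
      ((Real.continuous_exp.tendsto _).comp (hvt.mul_const _)).const_mul _
    simpa using this
  have hvm : Monotone v := by
    intro k l hkl
    simp only [hv]
    rw [neg_le_neg_iff]
    exact one_div_le_one_div_of_le (by positivity) (by gcongr)
  -- Monotone convergence along `v k ↑ 0` in `ℝ≥0∞` yields the moment and its finiteness at once.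
  have hlim := lintegral_tendsto_of_tendsto_of_monotone (μ := P)
    (f := fun k ω => ENNReal.ofReal (Z ω ^ n * Real.exp (v k * Z ω)))
    (F := fun ω => ENNReal.ofReal (Z ω ^ n))
    (fun k => ((hZm.pow_const n).mul (hZm.const_mul _).exp).ennreal_ofReal)
    (ae_of_all _ fun ω k l hkl => ENNReal.ofReal_le_ofReal (mul_le_mul_of_nonneg_left
      (Real.exp_le_exp.2 (mul_le_mul_of_nonneg_right (hvm hkl) (hZ0 ω))) (pow_nonneg (hZ0 ω) n)))
    (ae_of_all _ hpt)
  have hk : ∀ k, ∫⁻ ω, ENNReal.ofReal (Z ω ^ n * Real.exp (v k * Z ω)) ∂P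
      = ENNReal.ofReal (mgfDeriv m n (v k)) := by
    intro k
    rw [← hψ n hn _ (hv0 k), ofReal_integral_eq_lintegral_ofReal]
    · exact integrable_pow_mul_exp_of_mem_interior_integrableExpSet (hint _ (hv0 k)) n
    · exact ae_of_all _ fun ω => mul_nonneg (pow_nonneg (hZ0 ω) n) (Real.exp_nonneg _)
  simp_rw [hk] at hlim
  have heq : ∫⁻ ω, ENNReal.ofReal (Z ω ^ n) ∂P = ENNReal.ofReal (mgfDeriv m n 0) :=
    tendsto_nhds_unique hlim (ENNReal.tendsto_ofReal (hφ n hn))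
  have hpos : 0 ≤ mgfDeriv m n 0 := by
    refine ge_of_tendsto' (hφ n hn) fun k => ?_
    rw [← hψ n hn _ (hv0 k)]
    exact integral_nonneg fun ω => mul_nonneg (pow_nonneg (hZ0 ω) n) (Real.exp_nonneg _)
  refine ⟨⟨(hZm.pow_const n).aestronglyMeasurable, ?_⟩, ?_⟩
  · rw [hasFiniteIntegral_iff_ofReal (ae_of_all _ fun ω => pow_nonneg (hZ0 ω) n), heq]
    exact ENNReal.ofReal_lt_top
  · rw [integral_eq_lintegral_of_nonneg_ae (ae_of_all _ fun ω => pow_nonneg (hZ0 ω) n)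
      (hZm.pow_const n).aestronglyMeasurable, heq, ENNReal.toReal_ofReal hpos]

/-- The numbers `expSum m n 0` are the cumulants; centring removes the first, leaving `κ₂` and `κ₄ +
3 κ₂²`. -/
lemma central_moments_of_laplace [IsProbabilityMeasure P] {S : Ω → ℝ≥0∞} (hS : AEMeasurable S P)
    {m : ℕ → ℝ} (hL : ∀ u : ℝ, 0 < u → ∫ ω, expNeg (ENNReal.ofReal u * S ω) ∂P
      = mgfDeriv m 0 (-u)) :
    Integrable (fun ω => ((S ω).toReal - expSum m 1 0) ^ 2) P ∧
      Integrable (fun ω => ((S ω).toReal - expSum m 1 0) ^ 4) P ∧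
      ∫ ω, ((S ω).toReal - expSum m 1 0) ^ 2 ∂P = expSum m 2 0 ∧
      ∫ ω, ((S ω).toReal - expSum m 1 0) ^ 4 ∂P = expSum m 4 0 + 3 * expSum m 2 0 ^ 2 := by
  obtain ⟨-, h⟩ := moments_of_laplace hS hL
  obtain ⟨i1, e1⟩ := h 1 (by norm_num)
  obtain ⟨i2, e2⟩ := h 2 (by norm_num)
  obtain ⟨i3, e3⟩ := h 3 (by norm_num)
  obtain ⟨i4, e4⟩ := h 4 (by norm_num)
  simp only [mgfDeriv, sub_self, Real.exp_zero, mul_one] at e1 e2 e3 e4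
  simp only [pow_one] at i1 e1
  set k := expSum m 1 0
  have h2 : ∀ ω, ((S ω).toReal - k) ^ 2 = (S ω).toReal ^ 2 - 2 * k * (S ω).toReal + k ^ 2 :=
    fun ω => by ring
  have h4 : ∀ ω, ((S ω).toReal - k) ^ 4 = (S ω).toReal ^ 4 - 4 * k * (S ω).toReal ^ 3
      + 6 * k ^ 2 * (S ω).toReal ^ 2 - 4 * k ^ 3 * (S ω).toReal + k ^ 4 :=
    fun ω => by ring
  simp_rw [h2, h4]
  have j1 : Integrable (fun ω => (S ω).toReal ^ 2 - 2 * k * (S ω).toReal) P :=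
    i2.sub (i1.const_mul _)
  have j2 : Integrable (fun ω => (S ω).toReal ^ 4 - 4 * k * (S ω).toReal ^ 3) P :=
    i4.sub (i3.const_mul (4 * k))
  have j3 : Integrable (fun ω => (S ω).toReal ^ 4 - 4 * k * (S ω).toReal ^ 3
      + 6 * k ^ 2 * (S ω).toReal ^ 2) P := j2.add (i2.const_mul (6 * k ^ 2))
  have j4 : Integrable (fun ω => (S ω).toReal ^ 4 - 4 * k * (S ω).toReal ^ 3
      + 6 * k ^ 2 * (S ω).toReal ^ 2 - 4 * k ^ 3 * (S ω).toReal) P :=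
    j3.sub (i1.const_mul (4 * k ^ 3))
  refine ⟨j1.add (integrable_const _), j4.add (integrable_const _), ?_, ?_⟩
  · rw [integral_add j1 (integrable_const _), integral_sub i2 (i1.const_mul _),
      integral_const_mul, e1, e2]
    simp
    ring
  · rw [integral_add j4 (integrable_const _), integral_sub j3 (i1.const_mul _),
      integral_add j2 (i2.const_mul _), integral_sub i4 (i3.const_mul _), integral_const_mul,
      integral_const_mul, integral_const_mul, e1, e2, e3, e4]
    simp
    ring

end Moments

/-- The bound `5` suits sums of four indicators; `F 0 = 0` discards the level set that may have
infinite measure. -/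
lemma integral_comp_nat {Z : Type*} [MeasurableSpace Z] {ν : Measure Z} {h : Z → ℕ}
    (hh : Measurable h) (h5 : ∀ z, h z < 5) (hfin : ν {z | h z ≠ 0} ≠ ∞) {F : ℕ → ℝ}
    (hF : F 0 = 0) :
    Integrable (fun z => F (h z)) ν ∧
      ∫ z, F (h z) ∂ν = ∑ k ∈ Finset.range 5, ν.real (h ⁻¹' {k}) * F k := by
  have hpt : ∀ z, F (h z) = ∑ k ∈ Finset.range 5, (h ⁻¹' {k}).indicator (fun _ => F k) z := by
    intro z
    refine ((Finset.sum_eq_single (h z) (fun k _ hk => ?_) fun h' => ?_).trans ?_).symm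
    · refine Set.indicator_of_notMem (M := ℝ) (fun h' => hk ?_) _
      exact (Set.mem_singleton_iff.1 h').symm
    · exact absurd (Finset.mem_range.2 (h5 z)) h'
    · exact Set.indicator_of_mem (Set.mem_singleton _) _
  have hm : ∀ k, MeasurableSet (h ⁻¹' {k}) := fun k => hh (measurableSet_singleton k)
  have hi : ∀ k ∈ Finset.range 5, Integrable ((h ⁻¹' {k}).indicator fun _ => F k) ν := by
    intro k _
    by_cases hk : k = 0
    · simp [hk, hF]
    · refine (integrable_indicator_iff (hm k)).2 (integrableOn_const
        (ne_top_of_le_ne_top hfin (measure_mono fun z hz => ?_)))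
      change h z ≠ 0
      rwa [Set.mem_singleton_iff.1 hz]
  simp_rw [hpt]
  refine ⟨integrable_finsetSum _ hi, ?_⟩
  rw [integral_finsetSum _ hi]
  refine Finset.sum_congr rfl fun k _ => ?_
  rw [integral_indicator_const _ (hm k), smul_eq_mul]

section Marked

variable {d : ℕ} {Ω : Type*} [MeasurableSpace Ω] {P : Measure Ω} {lam : ℝ≥0}
  {ξ : ℤ → Ω → EuclideanSpace ℝ (Fin d)} {M : Type*} [MeasurableSpace M] {Q : Measure M}
  {Y : ℤ → Ω → M}

/-- A Poisson process whose points carry independent marks of law `Q`. -/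
structure IsMarkedPoisson (lam : ℝ≥0) (ξ : ℤ → Ω → EuclideanSpace ℝ (Fin d)) (Y : ℤ → Ω → M)
    (Q : Measure M) (P : Measure Ω) : Prop where
  poisson : IsPoissonProcess lam ξ P
  measurable : ∀ j, Measurable (Y j)
  law : ∀ j, HasLaw (Y j) Q P
  iIndep : iIndepFun Y P
  indep : IndepFun (fun ω j => ξ j ω) (fun ω j => Y j ω) P

/-- The parameters of the Poisson variables of which the sum of `h` over the points is made. -/
noncomputable def levelMass (lam : ℝ≥0) (Q : Measure M) (h : EuclideanSpace ℝ (Fin d) × M → ℕ)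
    (k : ℕ) : ℝ :=
  lam * ((volume : Measure (EuclideanSpace ℝ (Fin d))).prod Q).real (h ⁻¹' {k})

/-- This is Campbell's formula for cumulants of order `n ≥ 1`. -/
lemma expSum_levelMass {h : EuclideanSpace ℝ (Fin d) × M → ℕ}
    (hh : Measurable h) (h5 : ∀ z, h z < 5) (hfin : (volume.prod Q) {z | h z ≠ 0} ≠ ∞)
    {n : ℕ} (hn : n ≠ 0) :
    expSum (levelMass lam Q h) n 0 = lam * ∫ z, (h z : ℝ) ^ n ∂(volume.prod Q) := by
  rw [(integral_comp_nat hh h5 hfin (F := fun k => (k : ℝ) ^ n) (by simp [hn])).2, expSum,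
    Finset.mul_sum]
  refine Finset.sum_congr rfl fun k _ => ?_
  simp [levelMass]
  ring

/-- Splitting the integral of `1 - exp (-u h)` over the level sets of `h` shows that the sum has the
Laplace transform of `∑ k Z_k` with independent Poisson `Z_k`. -/
lemma IsMarkedPoisson.laplace [IsProbabilityMeasure P] [IsProbabilityMeasure Q]
    (H : IsMarkedPoisson lam ξ Y Q P) {h : EuclideanSpace ℝ (Fin d) × M → ℕ}
    (hh : Measurable h) (h5 : ∀ z, h z < 5) (hfin : (volume.prod Q) {z | h z ≠ 0} ≠ ∞)
    {u : ℝ} (hu : 0 < u) :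
    ∫ ω, expNeg (ENNReal.ofReal u * ∑' j, (h (ξ j ω, Y j ω) : ℝ≥0∞)) ∂P
      = mgfDeriv (levelMass lam Q h) 0 (-u) := by
  simp_rw [← ENNReal.tsum_mul_left]
  have hnat : Measurable fun z => (h z : ℝ≥0∞) := (measurable_of_countable _).comp hh
  have hint : ∫⁻ z, ENNReal.ofReal u * (h z : ℝ≥0∞) ∂(volume.prod Q) ≠ ∞ := by
    have := (integral_comp_nat hh h5 hfin (F := fun k => u * (k : ℝ)) (by simp)).1
    have h2 := this.lintegral_lt_top.ne
    simpa only [ENNReal.ofReal_mul hu.le, ENNReal.ofReal_natCast] using h2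
  rw [H.poisson.integral_expNeg_marked H.measurable H.law H.iIndep H.indep
    (g := fun z => ENNReal.ofReal u * (h z : ℝ≥0∞)) (measurable_const.mul hnat)
    (c := u.toNNReal * 5) (fun z => ?_) hint]
  · have h3 : ∀ z, 1 - expNeg (ENNReal.ofReal u * (h z : ℝ≥0∞))
        = (fun k : ℕ => 1 - Real.exp (-u * k)) (h z) := by
      intro z
      rw [expNeg_of_ne_top (by finiteness), ENNReal.toReal_mul, ENNReal.toReal_ofReal hu.le]
      simp
    simp_rw [h3]
    rw [(integral_comp_nat hh h5 hfin (F := fun k : ℕ => 1 - Real.exp (-u * k)) (by simp)).2]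
    simp only [mgfDeriv, expSum]
    congr 1
    rw [← Finset.sum_sub_distrib, Finset.mul_sum, ← Finset.sum_neg_distrib]
    refine Finset.sum_congr rfl fun k _ => ?_
    simp [levelMass]
    ring
  · push_cast
    refine mul_le_mul' le_rfl ?_
    exact_mod_cast (h5 z).le

end Marked

end

/-! ### Polarization and mixed moments of counts in up to four sets. -/

section

lemma univ_fin_four : (Finset.univ : Finset (Fin 4)) = {0, 1, 2, 3} := rfl

lemma sum_powerset_fin_four (f : Finset (Fin 4) → ℝ) :
    ∑ I : Finset (Fin 4), f I = f ∅ + f {3} + (f {2} + f {2, 3}) + (f {1} + f {1, 3} +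
      (f {1, 2} + f {1, 2, 3})) + (f {0} + f {0, 3} + (f {0, 2} + f {0, 2, 3}) +
      (f {0, 1} + f {0, 1, 3} + (f {0, 1, 2} + f {0, 1, 2, 3}))) := by
  rw [← Finset.powerset_univ, univ_fin_four]
  repeat rw [Finset.sum_powerset_insert (by decide)]
  have h3 : ({3} : Finset (Fin 4)) = insert 3 ∅ := rfl
  rw [h3]
  repeat rw [Finset.sum_powerset_insert (by decide)]
  simp only [Finset.powerset_empty, Finset.sum_singleton]
  rfl

/-- Polarization of a quartic form. -/
lemma polarization_pow_four (x : Fin 4 → ℝ) :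
    ∑ I : Finset (Fin 4), (-1 : ℝ) ^ I.card * (∑ i ∈ I, x i) ^ 4 = 24 * ∏ i, x i := by
  rw [sum_powerset_fin_four]
  simp [Fin.prod_univ_four, Finset.sum_insert, Finset.card_insert_of_notMem]
  ring

/-- Polarization of the square of a quadratic form. -/
lemma polarization_sq (c : Fin 4 → Fin 4 → ℝ) (hc : ∀ i j, c i j = c j i) :
    ∑ I : Finset (Fin 4), (-1 : ℝ) ^ I.card * (∑ i ∈ I, ∑ j ∈ I, c i j) ^ 2
      = 8 * (c 0 1 * c 2 3 + c 0 2 * c 1 3 + c 0 3 * c 1 2) := by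
  rw [sum_powerset_fin_four]
  simp [Finset.sum_insert, Finset.card_insert_of_notMem]
  rw [hc 1 0, hc 2 0, hc 3 0, hc 2 1, hc 3 1, hc 3 2]
  ring

section Marked

variable {d : ℕ} {Ω : Type*} [MeasurableSpace Ω] {P : Measure Ω} {lam : ℝ≥0}
  {ξ : ℤ → Ω → EuclideanSpace ℝ (Fin d)} {M : Type*} [MeasurableSpace M] {Q : Measure M}
  {Y : ℤ → Ω → M}

/-- The number of marked points in a set. -/
noncomputable def pointCount (ξ : ℤ → Ω → EuclideanSpace ℝ (Fin d)) (Y : ℤ → Ω → M)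
    (D : Set (EuclideanSpace ℝ (Fin d) × M)) (ω : Ω) : ℝ≥0∞ :=
  ∑' j, D.indicator (fun _ => (1 : ℝ≥0∞)) (ξ j ω, Y j ω)

/-- The intensity of a marked Poisson process. -/
noncomputable def intensity (lam : ℝ≥0) (Q : Measure M)
    (D : Set (EuclideanSpace ℝ (Fin d) × M)) : ℝ :=
  lam * (volume.prod Q).real D

lemma measurable_pointCount (hξ : ∀ j, Measurable (ξ j)) (hY : ∀ j, Measurable (Y j))
    {D : Set (EuclideanSpace ℝ (Fin d) × M)} (hD : MeasurableSet D) :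
    Measurable (pointCount ξ Y D) :=
  Measurable.tsum fun j => (measurable_const.indicator hD).comp ((hξ j).prodMk (hY j))

/-- The number of those sets `D i`, `i ∈ I`, that contain a point. -/
noncomputable def multiplicity (D : Fin 4 → Set (EuclideanSpace ℝ (Fin d) × M))
    (I : Finset (Fin 4)) (z : EuclideanSpace ℝ (Fin d) × M) : ℕ :=
  ∑ i ∈ I, (D i).indicator (fun _ => (1 : ℕ)) z

section
variable {D : Fin 4 → Set (EuclideanSpace ℝ (Fin d) × M)}

lemma measurable_multiplicity (hD : ∀ i, MeasurableSet (D i)) (I : Finset (Fin 4)) :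
    Measurable (multiplicity D I) :=
  Finset.measurable_fun_sum _ fun i _ => measurable_const.indicator (hD i)

lemma multiplicity_lt (I : Finset (Fin 4)) (z : EuclideanSpace ℝ (Fin d) × M) :
    multiplicity D I z < 5 := by
  have h1 : multiplicity D I z ≤ ∑ i ∈ I, 1 :=
    Finset.sum_le_sum fun i _ => Set.indicator_le_self' (fun _ _ => Nat.zero_le _) z
  have h2 : I.card ≤ 4 := by simpa using I.card_le_univ
  simp at h1
  omega

lemma measure_multiplicity_ne_top (hfin : ∀ i, (volume.prod Q) (D i) ≠ ∞)
    (I : Finset (Fin 4)) : (volume.prod Q) {z | multiplicity D I z ≠ 0} ≠ ∞ := by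
  have hsub : {z | multiplicity D I z ≠ 0} ⊆ ⋃ i, D i := by
    intro z hz
    by_contra h
    simp only [Set.mem_iUnion, not_exists] at h
    exact hz (Finset.sum_eq_zero fun i _ => Set.indicator_of_notMem (h i) _)
  refine ne_top_of_le_ne_top ?_ ((measure_mono hsub).trans (measure_iUnion_le _))
  rw [tsum_fintype]
  exact (ENNReal.sum_lt_top.2 fun i _ => (hfin i).lt_top).ne

lemma multiplicity_cast (I : Finset (Fin 4)) (z : EuclideanSpace ℝ (Fin d) × M) :
    (multiplicity D I z : ℝ) = ∑ i ∈ I, (D i).indicator (fun _ => (1 : ℝ)) z := by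
  classical
  rw [multiplicity, Nat.cast_sum]
  refine Finset.sum_congr rfl fun i _ => ?_
  simp only [Set.indicator_apply]
  split_ifs <;> simp

lemma tsum_multiplicity (I : Finset (Fin 4)) (ω : Ω) :
    ∑' j, (multiplicity D I (ξ j ω, Y j ω) : ℝ≥0∞) = ∑ i ∈ I, pointCount ξ Y (D i) ω := by
  classical
  simp only [pointCount]
  rw [← Summable.tsum_finsetSum fun _ _ => ENNReal.summable]
  refine tsum_congr fun j => ?_
  rw [multiplicity, Nat.cast_sum]
  refine Finset.sum_congr rfl fun i _ => ?_
  simp only [Set.indicator_apply]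
  split_ifs <;> simp

lemma integrable_indicator_prod (hD : ∀ i, MeasurableSet (D i))
    (hfin : ∀ i, (volume.prod Q) (D i) ≠ ∞) (i : Fin 4) :
    Integrable ((D i).indicator fun _ => (1 : ℝ)) (volume.prod Q) :=
  (integrable_indicator_iff (hD i)).2 (integrableOn_const (hfin i))

variable [IsProbabilityMeasure Q]

lemma expSum_one_multiplicity (hD : ∀ i, MeasurableSet (D i))
    (hfin : ∀ i, (volume.prod Q) (D i) ≠ ∞) (I : Finset (Fin 4)) :
    expSum (levelMass lam Q (multiplicity D I)) 1 0 = ∑ i ∈ I, intensity lam Q (D i) := by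
  rw [expSum_levelMass (measurable_multiplicity hD I) (multiplicity_lt I)
    (measure_multiplicity_ne_top hfin I) one_ne_zero]
  simp_rw [pow_one, multiplicity_cast]
  rw [integral_finsetSum _ fun i _ => integrable_indicator_prod hD hfin i, Finset.mul_sum]
  refine Finset.sum_congr rfl fun i _ => ?_
  rw [integral_indicator_const _ (hD i), smul_eq_mul, mul_one, intensity]

lemma expSum_two_multiplicity (hD : ∀ i, MeasurableSet (D i))
    (hfin : ∀ i, (volume.prod Q) (D i) ≠ ∞) (I : Finset (Fin 4)) :
    expSum (levelMass lam Q (multiplicity D I)) 2 0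
      = ∑ i ∈ I, ∑ j ∈ I, intensity lam Q (D i ∩ D j) := by
  rw [expSum_levelMass (measurable_multiplicity hD I) (multiplicity_lt I)
    (measure_multiplicity_ne_top hfin I) two_ne_zero]
  have h : ∀ z, (multiplicity D I z : ℝ) ^ 2
      = ∑ i ∈ I, ∑ j ∈ I, (D i ∩ D j).indicator (fun _ => (1 : ℝ)) z := by
    intro z
    rw [multiplicity_cast, sq, Finset.sum_mul_sum]
    refine Finset.sum_congr rfl fun i _ => Finset.sum_congr rfl fun j _ => ?_
    by_cases h1 : z ∈ D i <;> by_cases h2 : z ∈ D j <;> simp [h1, h2]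
  have hi : ∀ i j, Integrable ((D i ∩ D j).indicator fun _ => (1 : ℝ)) (volume.prod Q) :=
    fun i j => (integrable_indicator_iff ((hD i).inter (hD j))).2 (integrableOn_const
      (ne_top_of_le_ne_top (hfin i) (measure_mono Set.inter_subset_left)))
  simp_rw [h]
  rw [integral_finsetSum _ fun i _ => integrable_finsetSum _ fun j _ => hi i j, Finset.mul_sum]
  refine Finset.sum_congr rfl fun i _ => ?_
  rw [integral_finsetSum _ fun j _ => hi i j, Finset.mul_sum]
  refine Finset.sum_congr rfl fun j _ => ?_
  rw [integral_indicator_const _ ((hD i).inter (hD j)), smul_eq_mul, mul_one, intensity]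

/-- The fourth cumulant is `lam` times the integral of `multiplicity ^ 4`; polarization under the
integral leaves `24` times the product of the four indicators. -/
lemma sum_expSum_four_multiplicity (hD : ∀ i, MeasurableSet (D i))
    (hfin : ∀ i, (volume.prod Q) (D i) ≠ ∞) :
    ∑ I : Finset (Fin 4), (-1 : ℝ) ^ I.card * expSum (levelMass lam Q (multiplicity D I)) 4 0
      = 24 * intensity lam Q (⋂ i, D i) := by
  have hi : ∀ I, Integrable (fun z => (multiplicity D I z : ℝ) ^ 4) (volume.prod Q) := fun I =>
    (integral_comp_nat (measurable_multiplicity hD I) (multiplicity_lt I)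
      (measure_multiplicity_ne_top hfin I) (F := fun k => (k : ℝ) ^ 4) (by simp)).1
  have h1 : ∀ I, expSum (levelMass lam Q (multiplicity D I)) 4 0
      = lam * ∫ z, (multiplicity D I z : ℝ) ^ 4 ∂(volume.prod Q) := fun I =>
    expSum_levelMass (measurable_multiplicity hD I) (multiplicity_lt I)
      (measure_multiplicity_ne_top hfin I) four_ne_zero
  have h2 : ∫ z, ∑ I : Finset (Fin 4), (-1 : ℝ) ^ I.card * (multiplicity D I z : ℝ) ^ 4
      ∂(volume.prod Q) = 24 * (volume.prod Q).real (⋂ i, D i) := by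
    have h3 : ∀ z, ∑ I : Finset (Fin 4), (-1 : ℝ) ^ I.card * (multiplicity D I z : ℝ) ^ 4
        = (⋂ i, D i).indicator (fun _ => (24 : ℝ)) z := by
      intro z
      classical
      simp_rw [multiplicity_cast]
      rw [polarization_pow_four]
      by_cases hz : z ∈ ⋂ i, D i
      · rw [Set.indicator_of_mem hz, Finset.prod_eq_one, mul_one]
        exact fun i _ => Set.indicator_of_mem (Set.mem_iInter.1 hz i) _
      · rw [Set.indicator_of_notMem hz]
        simp only [Set.mem_iInter, not_forall] at hz
        obtain ⟨i, hi⟩ := hz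
        rw [Finset.prod_eq_zero (Finset.mem_univ i) (Set.indicator_of_notMem hi _), mul_zero]
    simp_rw [h3]
    rw [integral_indicator_const _ (MeasurableSet.iInter hD), smul_eq_mul, mul_comm]
  rw [integral_finsetSum _ fun I _ => (hi I).const_mul _] at h2
  simp_rw [integral_const_mul] at h2
  rw [intensity, mul_left_comm, ← h2, Finset.mul_sum]
  refine Finset.sum_congr rfl fun I _ => ?_
  rw [h1]
  ring

variable [IsProbabilityMeasure P]

lemma IsMarkedPoisson.laplace_multiplicity (H : IsMarkedPoisson lam ξ Y Q P)
    (hD : ∀ i, MeasurableSet (D i)) (hfin : ∀ i, (volume.prod Q) (D i) ≠ ∞)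
    (I : Finset (Fin 4)) {u : ℝ} (hu : 0 < u) :
    ∫ ω, expNeg (ENNReal.ofReal u * ∑ i ∈ I, pointCount ξ Y (D i) ω) ∂P
      = mgfDeriv (levelMass lam Q (multiplicity D I)) 0 (-u) := by
  simp_rw [← tsum_multiplicity]
  exact H.laplace (measurable_multiplicity hD I) (multiplicity_lt I)
    (measure_multiplicity_ne_top hfin I) hu

lemma IsMarkedPoisson.ae_pointCount_ne_top (H : IsMarkedPoisson lam ξ Y Q P)
    {D : Set (EuclideanSpace ℝ (Fin d) × M)}
    (hD : MeasurableSet D) (hfin : (volume.prod Q) D ≠ ∞) :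
    ∀ᵐ ω ∂P, pointCount ξ Y D ω ≠ ∞ := by
  -- A constant family with the index set `{0}` specialises the four-set statement to a single set.
  have h := fun u hu => H.laplace_multiplicity (D := fun _ => D) (fun _ => hD) (fun _ => hfin)
    {0} (u := u) hu
  simp only [Finset.sum_singleton] at h
  exact (moments_of_laplace (measurable_pointCount H.poisson.measurable H.measurable
    hD).aemeasurable h).1

/-- The centred number of points in a set. -/
noncomputable def centredCount (lam : ℝ≥0) (ξ : ℤ → Ω → EuclideanSpace ℝ (Fin d))
    (Y : ℤ → Ω → M) (Q : Measure M) (D : Set (EuclideanSpace ℝ (Fin d) × M)) (ω : Ω) : ℝ :=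
  (pointCount ξ Y D ω).toReal - intensity lam Q D

/-- Moments of all subset sums are the input from which polarization recovers mixed moments. -/
lemma IsMarkedPoisson.moments_sum (H : IsMarkedPoisson lam ξ Y Q P)
    (hD : ∀ i, MeasurableSet (D i)) (hfin : ∀ i, (volume.prod Q) (D i) ≠ ∞)
    (I : Finset (Fin 4)) :
    Integrable (fun ω => (∑ i ∈ I, centredCount lam ξ Y Q (D i) ω) ^ 2) P ∧
    Integrable (fun ω => (∑ i ∈ I, centredCount lam ξ Y Q (D i) ω) ^ 4) P ∧
    ∫ ω, (∑ i ∈ I, centredCount lam ξ Y Q (D i) ω) ^ 2 ∂P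
      = ∑ i ∈ I, ∑ j ∈ I, intensity lam Q (D i ∩ D j) ∧
    ∫ ω, (∑ i ∈ I, centredCount lam ξ Y Q (D i) ω) ^ 4 ∂P
      = expSum (levelMass lam Q (multiplicity D I)) 4 0 +
        3 * (∑ i ∈ I, ∑ j ∈ I, intensity lam Q (D i ∩ D j)) ^ 2 := by
  have hm : AEMeasurable (fun ω => ∑ i ∈ I, pointCount ξ Y (D i) ω) P :=
    (Finset.measurable_fun_sum _ fun i _ =>
      measurable_pointCount H.poisson.measurable H.measurable (hD i)).aemeasurable
  have h := central_moments_of_laplace hm fun u hu => H.laplace_multiplicity hD hfin I hu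
  rw [expSum_one_multiplicity hD hfin, expSum_two_multiplicity hD hfin] at h
  have hae : ∀ᵐ ω ∂P, (∑ i ∈ I, pointCount ξ Y (D i) ω).toReal - ∑ i ∈ I, intensity lam Q (D i)
      = ∑ i ∈ I, centredCount lam ξ Y Q (D i) ω := by
    have : ∀ᵐ ω ∂P, ∀ i, pointCount ξ Y (D i) ω ≠ ∞ :=
      ae_all_iff.2 fun i => H.ae_pointCount_ne_top (hD i) (hfin i)
    filter_upwards [this] with ω hω
    rw [ENNReal.toReal_sum fun i _ => hω i]
    simp only [centredCount, Finset.sum_sub_distrib]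
  have h2 := hae.mono fun ω hω => congrArg (· ^ 2) hω
  have h4 := hae.mono fun ω hω => congrArg (· ^ 4) hω
  obtain ⟨a, b, c, e⟩ := h
  exact ⟨a.congr h2, b.congr h4, (integral_congr_ae h2).symm.trans c,
    (integral_congr_ae h4).symm.trans e⟩

/-- Covariance of the numbers of points in two sets. -/
theorem IsMarkedPoisson.integral_mul (H : IsMarkedPoisson lam ξ Y Q P)
    {A B : Set (EuclideanSpace ℝ (Fin d) × M)} (hA : MeasurableSet A) (hB : MeasurableSet B)
    (hfA : (volume.prod Q) A ≠ ∞) (hfB : (volume.prod Q) B ≠ ∞) :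
    Integrable (fun ω => centredCount lam ξ Y Q A ω * centredCount lam ξ Y Q B ω) P ∧
    ∫ ω, centredCount lam ξ Y Q A ω * centredCount lam ξ Y Q B ω ∂P
      = intensity lam Q (A ∩ B) := by
  -- The last two entries only pad the family to length four; the index sets used are `{0}`, `{1}`
  -- and `{0, 1}`.
  have h := fun I => H.moments_sum (D := ![A, B, A, A])
    (fun i => by fin_cases i <;> simpa) (fun i => by fin_cases i <;> simpa) I
  obtain ⟨a1, -, a2, -⟩ := h {0}
  obtain ⟨b1, -, b2, -⟩ := h {1}
  obtain ⟨c1, -, c2, -⟩ := h {0, 1}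
  simp at a1 a2 b1 b2 c1 c2
  have hp : ∀ ω, centredCount lam ξ Y Q A ω * centredCount lam ξ Y Q B ω
      = 2⁻¹ * (((centredCount lam ξ Y Q A ω + centredCount lam ξ Y Q B ω) ^ 2
        - centredCount lam ξ Y Q A ω ^ 2) - centredCount lam ξ Y Q B ω ^ 2) := fun ω => by ring
  simp_rw [hp]
  have c3 : Integrable (fun ω => (centredCount lam ξ Y Q A ω + centredCount lam ξ Y Q B ω) ^ 2
        - centredCount lam ξ Y Q A ω ^ 2) P := c1.sub a1
  refine ⟨(c3.sub b1).const_mul _, ?_⟩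
  rw [integral_const_mul, integral_sub c3 b1, integral_sub c1 a1, a2, b2, c2, Set.inter_comm B A]
  ring

/-- Fourth mixed moment of the numbers of points in four sets. -/
theorem IsMarkedPoisson.integral_prod_four (H : IsMarkedPoisson lam ξ Y Q P)
    (hD : ∀ i, MeasurableSet (D i)) (hfin : ∀ i, (volume.prod Q) (D i) ≠ ∞) :
    Integrable (fun ω => ∏ i, centredCount lam ξ Y Q (D i) ω) P ∧
    ∫ ω, ∏ i, centredCount lam ξ Y Q (D i) ω ∂P
      = intensity lam Q (⋂ i, D i)
        + (intensity lam Q (D 0 ∩ D 1) * intensity lam Q (D 2 ∩ D 3)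
          + intensity lam Q (D 0 ∩ D 2) * intensity lam Q (D 1 ∩ D 3)
          + intensity lam Q (D 0 ∩ D 3) * intensity lam Q (D 1 ∩ D 2)) := by
  have hp : ∀ ω, ∏ i, centredCount lam ξ Y Q (D i) ω
      = 24⁻¹ * ∑ I : Finset (Fin 4), (-1 : ℝ) ^ I.card *
        (∑ i ∈ I, centredCount lam ξ Y Q (D i) ω) ^ 4 := fun ω => by
    rw [polarization_pow_four, inv_mul_cancel_left₀ (by norm_num)]
  have hi := fun (I : Finset (Fin 4)) (_ : I ∈ Finset.univ) =>
    (H.moments_sum hD hfin I).2.1.const_mul ((-1 : ℝ) ^ I.card)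
  simp_rw [hp]
  refine ⟨(integrable_finsetSum _ hi).const_mul _, ?_⟩
  rw [integral_const_mul, integral_finsetSum _ hi]
  -- The alternating sum of `κ₄` is `24` times the fourfold intensity, and that of `3 κ₂²` is `3 ·
  -- 8` times the three pairings; the prefactor `1/24` normalises both.
  simp_rw [integral_const_mul, (H.moments_sum hD hfin _).2.2.2, mul_add]
  rw [Finset.sum_add_distrib, sum_expSum_four_multiplicity hD hfin]
  simp_rw [mul_left_comm _ (3 : ℝ)]
  rw [← Finset.mul_sum, polarization_sq (fun i j => intensity lam Q (D i ∩ D j))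
    (fun i j => by rw [Set.inter_comm])]
  ring

end
end Marked

end

/-! ### The volume of the intersection of two equal balls as an incomplete beta integral. -/

section

/-- The weight `(1 - y) ^ ((d - 1) / 2) * y ^ (-1/2)` in the definition of `J`. -/
noncomputable def betaWeight (d : ℕ) (y : ℝ) : ℝ :=
  (1 - y) ^ (((d : ℝ) - 1) / 2) * y ^ (-(1 / 2) : ℝ)

lemma betaWeight_nonneg (d : ℕ) {y : ℝ} (h : y ∈ Set.Ioo (0 : ℝ) 1) : 0 ≤ betaWeight d y :=
  mul_nonneg (Real.rpow_nonneg (by linarith [h.2]) _) (Real.rpow_nonneg h.1.le _)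

lemma measurable_betaWeight (d : ℕ) : Measurable (betaWeight d) := by
  unfold betaWeight
  fun_prop

lemma beta_symm (a b : ℝ) : beta a b = beta b a := by
  simp only [beta, mul_comm (Real.Gamma a), add_comm a]

lemma beta_pos_dim (d : ℕ) : 0 < beta (((d : ℝ) + 1) / 2) (1 / 2) :=
  beta_pos (by positivity) (by norm_num)

lemma lintegral_betaWeight (d : ℕ) :
    ∫⁻ y in Set.Ioo (0 : ℝ) 1, ENNReal.ofReal (betaWeight d y)
      = ENNReal.ofReal (beta (((d : ℝ) + 1) / 2) (1 / 2)) := by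
  have h := lintegral_betaPDF_eq_one (α := 1 / 2) (β := ((d : ℝ) + 1) / 2) (by norm_num)
    (by positivity)
  rw [lintegral_betaPDF, beta_symm] at h
  have hb := beta_pos_dim d
  have h2 : ∀ y ∈ Set.Ioo (0 : ℝ) 1,
      ENNReal.ofReal (1 / beta (((d : ℝ) + 1) / 2) (1 / 2) * y ^ ((1 / 2 : ℝ) - 1) *
        (1 - y) ^ (((d : ℝ) + 1) / 2 - 1))
      = ENNReal.ofReal (beta (((d : ℝ) + 1) / 2) (1 / 2))⁻¹ * ENNReal.ofReal (betaWeight d y) := by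
    intro y _
    rw [← ENNReal.ofReal_mul (inv_nonneg.2 hb.le), betaWeight]
    congr 1
    rw [show (1 / 2 : ℝ) - 1 = -(1 / 2) by norm_num,
      show ((d : ℝ) + 1) / 2 - 1 = ((d : ℝ) - 1) / 2 by ring]
    ring
  rw [setLIntegral_congr_fun measurableSet_Ioo h2, lintegral_const_mul _
    (measurable_betaWeight d).ennreal_ofReal, ENNReal.ofReal_inv_of_pos hb] at h
  have h3 := congrArg (ENNReal.ofReal (beta (((d : ℝ) + 1) / 2) (1 / 2)) * ·) h
  simp only [mul_one] at h3
  rwa [← mul_assoc, ENNReal.mul_inv_cancel (by simpa using hb) ENNReal.ofReal_ne_top,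
    one_mul] at h3

lemma integrableOn_betaWeight (d : ℕ) : IntegrableOn (betaWeight d) (Set.Ioo 0 1) := by
  refine ⟨(measurable_betaWeight d).aestronglyMeasurable, ?_⟩
  rw [hasFiniteIntegral_iff_ofReal, lintegral_betaWeight]
  · exact ENNReal.ofReal_lt_top
  · exact (ae_restrict_mem measurableSet_Ioo).mono fun y hy => betaWeight_nonneg d hy

lemma integral_betaWeight (d : ℕ) :
    ∫ y in Set.Ioo (0 : ℝ) 1, betaWeight d y = beta (((d : ℝ) + 1) / 2) (1 / 2) := by
  rw [integral_eq_lintegral_of_nonneg_ae ((ae_restrict_mem measurableSet_Ioo).mono fun y hy =>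
    betaWeight_nonneg d hy) (measurable_betaWeight d).aestronglyMeasurable, lintegral_betaWeight,
    ENNReal.toReal_ofReal (beta_pos_dim d).le]

/-- The volume of the intersection of two balls of radius `r`, as a function of the vector between
the centres. -/
noncomputable def overlap {d : ℕ} (r : ℝ) (v : EuclideanSpace ℝ (Fin d)) : ℝ :=
  volume.real {y : EuclideanSpace ℝ (Fin d) | ‖y‖ ≤ r ∧ ‖y + v‖ ≤ r}

lemma overlap_zero {d : ℕ} (r : ℝ) : overlap r (0 : EuclideanSpace ℝ (Fin d))
    = volume.real (Metric.closedBall (0 : EuclideanSpace ℝ (Fin d)) r) := by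
  unfold overlap
  congr 1
  ext y
  simp

lemma measurableSet_overlap {d : ℕ} (r : ℝ) (v : EuclideanSpace ℝ (Fin d)) :
    MeasurableSet {y : EuclideanSpace ℝ (Fin d) | ‖y‖ ≤ r ∧ ‖y + v‖ ≤ r} :=
  (measurableSet_le (f := fun y => ‖y‖) (g := fun _ => r) (by fun_prop) (by fun_prop)).inter
    (measurableSet_le (f := fun y => ‖y + v‖) (g := fun _ => r) (by fun_prop) (by fun_prop))

/-- The reflection in the hyperplane orthogonal to `v - w` is a volume-preserving isometry that
takes `v` to `w`. -/
lemma overlap_eq_of_norm_eq {d : ℕ} (r : ℝ) {v w : EuclideanSpace ℝ (Fin d)} (h : ‖v‖ = ‖w‖) :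
    overlap r v = overlap r w := by
  let f := (Submodule.span ℝ {v - w})ᗮ.reflection
  have hf : f v = w := Submodule.reflection_sub h
  have hm : MeasurePreserving f volume volume := f.measurePreserving
  have h1 := hm.measure_preimage (measurableSet_overlap r w).nullMeasurableSet
  have h2 : f ⁻¹' {y | ‖y‖ ≤ r ∧ ‖y + w‖ ≤ r} = {y | ‖y‖ ≤ r ∧ ‖y + v‖ ≤ r} := by
    ext y
    change ‖f y‖ ≤ r ∧ ‖f y + w‖ ≤ r ↔ ‖y‖ ≤ r ∧ ‖y + v‖ ≤ r
    rw [← hf, ← map_add, f.norm_map, f.norm_map]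
  rw [h2] at h1
  rw [overlap, overlap, measureReal_def, measureReal_def, h1]

/-- The volume of a ball of radius `√(r² - x²)`. -/
noncomputable def sliceVolume (n : ℕ) (r x : ℝ) : ℝ :=
  if x ^ 2 ≤ r ^ 2 then
    √(r ^ 2 - x ^ 2) ^ n * volume.real (Metric.ball (0 : EuclideanSpace ℝ (Fin n)) 1)
  else 0

/-- The larger of `|t|` and `|t + a|` is `|t + a / 2| + a / 2`, so the two constraints on `z` reduce
to one. -/
lemma volume_real_slice (n : ℕ) (r a t : ℝ) (ha : 0 ≤ a) :
    volume.real {z : EuclideanSpace ℝ (Fin n) |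
      t ^ 2 + ‖z‖ ^ 2 ≤ r ^ 2 ∧ (t + a) ^ 2 + ‖z‖ ^ 2 ≤ r ^ 2}
      = sliceVolume n r (|t + a / 2| + a / 2) := by
  have hq : (|t + a / 2| + a / 2) ^ 2 = max (t ^ 2) ((t + a) ^ 2) := by
    rcases le_total 0 (t + a / 2) with h | h
    · rw [abs_of_nonneg h, max_eq_right]
      · ring
      · nlinarith
    · rw [abs_of_nonpos h, max_eq_left]
      · ring
      · nlinarith
  rw [sliceVolume, hq]
  split_ifs with h
  · have hset : {z : EuclideanSpace ℝ (Fin n) |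
      t ^ 2 + ‖z‖ ^ 2 ≤ r ^ 2 ∧ (t + a) ^ 2 + ‖z‖ ^ 2 ≤ r ^ 2}
        = Metric.closedBall 0 √(r ^ 2 - max (t ^ 2) ((t + a) ^ 2)) := by
      ext z
      rw [mem_closedBall_zero_iff, Real.le_sqrt (norm_nonneg _), le_sub_comm, max_le_iff,
        le_sub_iff_add_le, le_sub_iff_add_le]
      · rfl
      · exact sub_nonneg.2 h
    rw [hset, measureReal_def, Measure.addHaar_closedBall _ _ (Real.sqrt_nonneg _),
      ENNReal.toReal_mul, ENNReal.toReal_ofReal (by positivity), finrank_euclideanSpace_fin]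
    rfl
  · have hset : {z : EuclideanSpace ℝ (Fin n) |
      t ^ 2 + ‖z‖ ^ 2 ≤ r ^ 2 ∧ (t + a) ^ 2 + ‖z‖ ^ 2 ≤ r ^ 2} = ∅ := by
      refine Set.eq_empty_of_forall_notMem fun z hz => h (max_le ?_ ?_)
      · exact (le_add_of_nonneg_right (sq_nonneg _)).trans hz.1
      · exact (le_add_of_nonneg_right (sq_nonneg _)).trans hz.2
    rw [hset]
    simp

/-- Fubini along the first coordinate axis, in the direction of the translation. -/
lemma overlap_single_eq_integral (n : ℕ) {r a : ℝ} (hr : 0 ≤ r) (ha : 0 ≤ a) :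
    overlap r (EuclideanSpace.single (0 : Fin (n + 1)) a)
      = ∫ t : ℝ, sliceVolume n r (|t + a / 2| + a / 2) := by
  let Φ : EuclideanSpace ℝ (Fin (n + 1)) → ℝ × EuclideanSpace ℝ (Fin n) := fun y =>
    Prod.map id (WithLp.toLp 2) (MeasurableEquiv.piFinSuccAbove (fun _ => ℝ) 0 (WithLp.ofLp y))
  have hΦ : MeasurePreserving Φ volume volume :=
    ((MeasurePreserving.id volume).prod (PiLp.volume_preserving_toLp (Fin n))).comp
      ((volume_preserving_piFinSuccAbove (fun _ => ℝ) 0).comp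
        (PiLp.volume_preserving_ofLp (Fin (n + 1))))
  have hn : ∀ y, ‖y‖ ^ 2 = (Φ y).1 ^ 2 + ‖(Φ y).2‖ ^ 2 := fun y => by
    rw [EuclideanSpace.norm_sq_eq, EuclideanSpace.norm_sq_eq, Fin.sum_univ_succ]
    simp [Φ, MeasurableEquiv.piFinSuccAbove, Fin.tail]
  have hadd : ∀ y, Φ (y + EuclideanSpace.single 0 a) = ((Φ y).1 + a, (Φ y).2) := fun y => by
    refine Prod.ext ?_ ?_
    · simp [Φ, MeasurableEquiv.piFinSuccAbove]
    · ext i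
      simp [Φ, MeasurableEquiv.piFinSuccAbove, Fin.tail]
  let S : Set (ℝ × EuclideanSpace ℝ (Fin n)) :=
    {p | p.1 ^ 2 + ‖p.2‖ ^ 2 ≤ r ^ 2 ∧ (p.1 + a) ^ 2 + ‖p.2‖ ^ 2 ≤ r ^ 2}
  have hS : MeasurableSet S :=
    (measurableSet_le (f := fun p : ℝ × EuclideanSpace ℝ (Fin n) => p.1 ^ 2 + ‖p.2‖ ^ 2)
      (g := fun _ => r ^ 2) (by fun_prop) (by fun_prop)).inter
    (measurableSet_le (f := fun p : ℝ × EuclideanSpace ℝ (Fin n) => (p.1 + a) ^ 2 + ‖p.2‖ ^ 2)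
      (g := fun _ => r ^ 2) (by fun_prop) (by fun_prop))
  have hpre : Φ ⁻¹' S = {y | ‖y‖ ≤ r ∧ ‖y + EuclideanSpace.single 0 a‖ ≤ r} := by
    ext y
    change ((Φ y).1 ^ 2 + ‖(Φ y).2‖ ^ 2 ≤ r ^ 2 ∧ ((Φ y).1 + a) ^ 2 + ‖(Φ y).2‖ ^ 2 ≤ r ^ 2) ↔
      ‖y‖ ≤ r ∧ ‖y + EuclideanSpace.single 0 a‖ ≤ r
    have h1 := hn (y + EuclideanSpace.single 0 a)
    rw [hadd] at h1
    rw [← hn, ← h1, sq_le_sq₀ (norm_nonneg _) hr, sq_le_sq₀ (norm_nonneg _) hr]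
  have hvol := hΦ.measure_preimage hS.nullMeasurableSet
  rw [hpre, Measure.volume_eq_prod, Measure.prod_apply hS] at hvol
  rw [overlap, measureReal_def, hvol, ← integral_toReal]
  · refine integral_congr_ae (ae_of_all _ fun t => ?_)
    exact volume_real_slice n r a t ha
  · exact (measurable_measure_prodMk_left hS).aemeasurable
  · refine ae_of_all _ fun t => ?_
    refine (measure_mono (t := Metric.closedBall 0 r) fun z hz => ?_).trans_lt
      measure_closedBall_lt_top
    rw [mem_closedBall_zero_iff, ← sq_le_sq₀ (norm_nonneg _) hr]
    have := hz.1
    simp only at this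
    nlinarith [sq_nonneg t]

/-- By symmetry about `-a / 2` the integral is twice that of the slice volume over `x > a / 2`. With
`x = r √y`, `(r² - x²)^(n/2) dx` becomes `r^(n+1) (1 - y)^(n/2) y^(-1/2) dy / 2`, and the constraint
becomes `y > a² / (4 r²)`. -/
lemma overlap_single_eq (n : ℕ) {r a : ℝ} (hr : 0 < r) (ha : 0 ≤ a) :
    overlap r (EuclideanSpace.single (0 : Fin (n + 1)) a)
      = r ^ (n + 1) * volume.real (Metric.ball (0 : EuclideanSpace ℝ (Fin n)) 1) *
        ∫ y in Set.Ioo (0 : ℝ) 1,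
          (Set.Ioi (a ^ 2 / (4 * r ^ 2))).indicator (betaWeight (n + 1)) y := by
  set ω := volume.real (Metric.ball (0 : EuclideanSpace ℝ (Fin n)) 1)
  set g : ℝ → ℝ := (Set.Ioi (a / 2)).indicator (sliceVolume n r) with hg
  have h1 : overlap r (EuclideanSpace.single (0 : Fin (n + 1)) a)
      = 2 * ∫ x in Set.Ioi (0 : ℝ), g x := by
    have h2 : ∫ x in Set.Ioi (0 : ℝ), g x
        = ∫ x in Set.Ioi (0 : ℝ), sliceVolume n r (x + a / 2) := by
      rw [← integral_indicator measurableSet_Ioi, ← integral_indicator measurableSet_Ioi,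
        ← integral_add_right_eq_self ((Set.Ioi 0).indicator g) (a / 2)]
      refine integral_congr_ae (ae_of_all _ fun t => ?_)
      simp only [hg, Set.indicator_apply, Set.mem_Ioi]
      by_cases ht : 0 < t
      · rw [if_pos ht, if_pos (by linarith), if_pos (by linarith)]
      · rw [if_neg ht, if_neg (by linarith : ¬a / 2 < t + a / 2), ite_self]
    rw [h2, overlap_single_eq_integral n hr.le ha,
      integral_add_right_eq_self (fun t : ℝ => sliceVolume n r (|t| + a / 2)) (a / 2),
      integral_comp_abs (f := fun t => sliceVolume n r (t + a / 2))]
  have hr2 : (0 : ℝ) < r ^ 2 := by positivity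
  rw [h1, ← integral_comp_rpow_Ioi g (p := 1 / 2) (by norm_num)]
  have h2 := integral_comp_mul_left_Ioi
    (fun x : ℝ => (|(1 / 2 : ℝ)| * x ^ ((1 / 2 : ℝ) - 1)) • g (x ^ (1 / 2 : ℝ))) 0 hr2
  rw [mul_zero, smul_eq_mul] at h2
  have h3 : ∫ x in Set.Ioi (0 : ℝ),
      (|(1 / 2 : ℝ)| * x ^ ((1 / 2 : ℝ) - 1)) • g (x ^ (1 / 2 : ℝ))
      = r ^ 2 * ∫ x in Set.Ioi (0 : ℝ),
        (|(1 / 2 : ℝ)| * (r ^ 2 * x) ^ ((1 / 2 : ℝ) - 1)) • g ((r ^ 2 * x) ^ (1 / 2 : ℝ)) := by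
    rw [h2, mul_inv_cancel_left₀ hr2.ne']
  rw [h3]
  have h4 : ∀ x ∈ Set.Ioi (0 : ℝ),
      (|(1 / 2 : ℝ)| * (r ^ 2 * x) ^ ((1 / 2 : ℝ) - 1)) • g ((r ^ 2 * x) ^ (1 / 2 : ℝ))
      = (1 / 2 * r⁻¹ * r ^ n * ω) * (Set.Ioc 0 1).indicator
        ((Set.Ioi (a ^ 2 / (4 * r ^ 2))).indicator (betaWeight (n + 1))) x := by
    intro x hx
    have hx' : 0 < x := hx
    have hs : (r ^ 2 * x) ^ (1 / 2 : ℝ) = r * √x := by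
      rw [← Real.sqrt_eq_rpow, Real.sqrt_mul hr2.le, Real.sqrt_sq hr.le]
    have hs2 : (r ^ 2 * x) ^ ((1 / 2 : ℝ) - 1) = r⁻¹ * x ^ (-(1 / 2) : ℝ) := by
      rw [show (1 / 2 : ℝ) - 1 = -(1 / 2) by norm_num, Real.mul_rpow hr2.le hx'.le,
        Real.rpow_neg hr2.le, ← Real.sqrt_eq_rpow, Real.sqrt_sq hr.le]
    have hcond : a / 2 < r * √x ↔ a ^ 2 / (4 * r ^ 2) < x := by
      have h5 : (r * √x) ^ 2 = r ^ 2 * x := by rw [mul_pow, Real.sq_sqrt hx'.le]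
      rw [← sq_lt_sq₀ (by positivity : (0 : ℝ) ≤ a / 2) (by positivity), h5,
        div_lt_iff₀ (by positivity)]
      constructor <;> intro h <;> nlinarith
    rw [hs, hs2, hg]
    simp only [Set.indicator_apply, Set.mem_Ioi, hcond, Set.mem_Ioc, sliceVolume, smul_eq_mul]
    rw [mul_pow, Real.sq_sqrt hx'.le]
    by_cases hc : a ^ 2 / (4 * r ^ 2) < x
    · by_cases hx1 : x ≤ 1
      · have hle : r ^ 2 * x ≤ r ^ 2 := by nlinarith
        simp only [hc, hle, hx', hx1, and_self, if_true]
        have he : √(r ^ 2 - r ^ 2 * x) = r * √(1 - x) := by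
          rw [show r ^ 2 - r ^ 2 * x = r ^ 2 * (1 - x) by ring, Real.sqrt_mul hr2.le,
            Real.sqrt_sq hr.le]
        have he2 : √(1 - x) ^ n = (1 - x) ^ ((((n + 1 : ℕ) : ℝ) - 1) / 2) := by
          rw [Real.sqrt_eq_rpow, ← Real.rpow_natCast, ← Real.rpow_mul (by linarith)]
          congr 1
          push_cast
          ring
        rw [he, mul_pow, he2, betaWeight, abs_of_pos (by norm_num : (0 : ℝ) < 1 / 2)]
        ring
      · have hle : ¬r ^ 2 * x ≤ r ^ 2 := by
          push Not at hx1 ⊢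
          nlinarith
        simp [hx1, hle]
    · rw [if_neg hc]
      simp [hc]
  rw [setIntegral_congr_fun measurableSet_Ioi h4, integral_const_mul,
    setIntegral_indicator measurableSet_Ioc, Set.inter_eq_right.2 Set.Ioc_subset_Ioi_self,
    integral_Ioc_eq_integral_Ioo]
  field_simp
  rw [pow_succ]
  ring

/-- The volume of the intersection of two balls of equal radius. -/
theorem overlap_eq {d : ℕ} (hd : 1 ≤ d) {r : ℝ} (hr : 0 < r) (v : EuclideanSpace ℝ (Fin d)) :
    overlap r v = volume.real (Metric.closedBall (0 : EuclideanSpace ℝ (Fin d)) r) /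
      beta (((d : ℝ) + 1) / 2) (1 / 2) *
        ∫ y in Set.Ioo (0 : ℝ) 1, (Set.Ioi (‖v‖ ^ 2 / (4 * r ^ 2))).indicator (betaWeight d) y := by
  obtain ⟨n, rfl⟩ : ∃ n, d = n + 1 := ⟨d - 1, by omega⟩
  have h1 := fun {a : ℝ} => overlap_single_eq n (a := a) hr
  -- The case `a = 0` expresses the volume of the ball, which eliminates the `n`-dimensional
  -- unit-ball constant without evaluating it.
  have h0 := h1 le_rfl
  have hz : EuclideanSpace.single (0 : Fin (n + 1)) (0 : ℝ) = 0 := by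
    ext i
    simp
  rw [hz, overlap_zero] at h0
  have h2 : ∫ y in Set.Ioo (0 : ℝ) 1,
      (Set.Ioi ((0 : ℝ) ^ 2 / (4 * r ^ 2))).indicator (betaWeight (n + 1)) y
        = beta ((((n + 1 : ℕ) : ℝ) + 1) / 2) (1 / 2) := by
    rw [← integral_betaWeight]
    refine setIntegral_congr_fun measurableSet_Ioo fun y hy => ?_
    rw [Set.indicator_of_mem]
    simpa using hy.1
  have hb := beta_pos_dim (n + 1)
  rw [h2] at h0
  have hnorm : ‖v‖ = ‖EuclideanSpace.single (0 : Fin (n + 1)) ‖v‖‖ := by simp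
  rw [overlap_eq_of_norm_eq r hnorm, h1 (norm_nonneg v), h0,
    mul_div_cancel_right₀ _ hb.ne']

end

/-! ### The radial law of the isotropic Gaussian. -/

section

/-- The centred Gaussian law on `ℝᵈ` with covariance `v` times the identity. -/
noncomputable def gaussE (d : ℕ) (v : ℝ≥0) : Measure (EuclideanSpace ℝ (Fin d)) :=
  (Measure.pi fun _ : Fin d => gaussianReal 0 v).map (WithLp.toLp 2)

instance (d : ℕ) (v : ℝ≥0) : IsProbabilityMeasure (gaussE d v) :=
  Measure.isProbabilityMeasure_map (PiLp.volume_preserving_toLp (Fin d)).measurable.aemeasurable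

/-- The density of `gaussE d v`, as a function of the squared norm. -/
noncomputable def gaussDensity (d : ℕ) (v : ℝ≥0) (x : ℝ) : ℝ :=
  (√(2 * Real.pi * v))⁻¹ ^ d * Real.exp (-x / (2 * v))

lemma gaussDensity_nonneg (d : ℕ) (v : ℝ≥0) (x : ℝ) : 0 ≤ gaussDensity d v x := by
  unfold gaussDensity
  positivity

lemma measurable_gaussDensity (d : ℕ) (v : ℝ≥0) : Measurable (gaussDensity d v) := by
  unfold gaussDensity
  fun_prop

lemma pi_gaussianReal (d : ℕ) {v : ℝ≥0} (hv : v ≠ 0) :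
    (Measure.pi fun _ : Fin d => gaussianReal 0 v)
      = volume.withDensity fun x => ENNReal.ofReal (∏ i, gaussianPDFReal 0 v (x i)) := by
  refine Measure.pi_eq fun s hs => ?_
  have hp : Integrable (fun x : Fin d → ℝ => ∏ i, gaussianPDFReal 0 v (x i)) :=
    Integrable.fintype_prod fun i => integrable_gaussianPDFReal 0 v
  rw [withDensity_apply _ (MeasurableSet.univ_pi hs), ← ofReal_integral_eq_lintegral_ofReal
    hp.integrableOn (ae_of_all _ fun x => Finset.prod_nonneg fun i _ =>
      gaussianPDFReal_nonneg _ _ _), ← integral_indicator (MeasurableSet.univ_pi hs)]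
  have h1 : ∀ x : Fin d → ℝ, (Set.univ.pi s).indicator
      (fun x => ∏ i, gaussianPDFReal 0 v (x i)) x
      = ∏ i, (s i).indicator (gaussianPDFReal 0 v) (x i) := by
    intro x
    by_cases hx : x ∈ Set.univ.pi s
    · rw [Set.indicator_of_mem hx]
      exact Finset.prod_congr rfl fun i _ =>
        (Set.indicator_of_mem (hx i (Set.mem_univ i)) _).symm
    · rw [Set.indicator_of_notMem hx]
      simp only [Set.mem_pi, Set.mem_univ, true_implies, not_forall] at hx
      obtain ⟨i, hi⟩ := hx
      exact (Finset.prod_eq_zero (Finset.mem_univ i) (Set.indicator_of_notMem hi _)).symm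
  simp_rw [h1]
  rw [integral_fintype_prod_volume_eq_prod (fun i => (s i).indicator (gaussianPDFReal 0 v)),
    ENNReal.ofReal_prod_of_nonneg]
  · refine Finset.prod_congr rfl fun i _ => ?_
    rw [gaussianReal_apply_eq_integral _ hv, integral_indicator (hs i)]
  · intro i _
    exact integral_nonneg fun x => Set.indicator_nonneg (fun _ _ => gaussianPDFReal_nonneg _ _ _) x

lemma gaussE_eq_withDensity (d : ℕ) {v : ℝ≥0} (hv : v ≠ 0) :
    gaussE d v = volume.withDensity fun z => ENNReal.ofReal (gaussDensity d v (‖z‖ ^ 2)) := by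
  have hm := PiLp.volume_preserving_toLp (Fin d)
  have hd : Measurable fun z : EuclideanSpace ℝ (Fin d) =>
      ENNReal.ofReal (gaussDensity d v (‖z‖ ^ 2)) :=
    ((measurable_gaussDensity d v).comp (by fun_prop)).ennreal_ofReal
  ext A hA
  rw [gaussE, Measure.map_apply hm.measurable hA, pi_gaussianReal d hv,
    withDensity_apply _ (hm.measurable hA), withDensity_apply _ hA,
    ← hm.setLIntegral_comp_preimage hA hd]
  refine setLIntegral_congr_fun (hm.measurable hA) fun x _ => ?_
  congr 1
  simp only [gaussianPDFReal, gaussDensity]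
  rw [Finset.prod_mul_distrib, Finset.prod_const, ← Real.exp_sum, EuclideanSpace.norm_sq_eq]
  simp [Finset.sum_div, Finset.sum_neg_distrib, neg_div]

/-- Polar coordinates followed by `‖z‖² = 2 v u`. The prefactor needs no simplification, because `s
= univ` determines it. -/
lemma gaussE_real_radial {d : ℕ} (hd : 1 ≤ d) {v : ℝ≥0} (hv : v ≠ 0) {s : Set ℝ}
    (hs : MeasurableSet s) :
    (gaussE d v).real {z | ‖z‖ ^ 2 ∈ s} =
      (d * volume.real (Metric.ball (0 : EuclideanSpace ℝ (Fin d)) 1) *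
        (√(2 * Real.pi * v))⁻¹ ^ d * (√(2 * v)) ^ d / 2) *
      ∫ u in Set.Ioi (0 : ℝ), ((2 * (v : ℝ) * ·) ⁻¹' s).indicator
        (fun u => Real.exp (-u) * u ^ ((d : ℝ) / 2 - 1)) u := by
  classical
  have hv' : (0 : ℝ) < 2 * v := by positivity
  have : Nontrivial (EuclideanSpace ℝ (Fin d)) := by
    have : Nonempty (Fin d) := ⟨⟨0, hd⟩⟩
    infer_instance
  have hms : MeasurableSet {z : EuclideanSpace ℝ (Fin d) | ‖z‖ ^ 2 ∈ s} :=
    (show Measurable fun z : EuclideanSpace ℝ (Fin d) => ‖z‖ ^ 2 by fun_prop) hs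
  have h1 : (gaussE d v).real {z | ‖z‖ ^ 2 ∈ s}
      = ∫ z : EuclideanSpace ℝ (Fin d), s.indicator (gaussDensity d v) (‖z‖ ^ 2) := by
    rw [measureReal_def, gaussE_eq_withDensity d hv, withDensity_apply _ hms,
      ← lintegral_indicator hms, integral_eq_lintegral_of_nonneg_ae]
    · congr 1
      refine lintegral_congr fun z => ?_
      simp only [Set.indicator_apply]
      change (if ‖z‖ ^ 2 ∈ s then _ else _) = _
      split_ifs <;> simp
    · exact ae_of_all _ fun z => Set.indicator_nonneg (fun _ _ => gaussDensity_nonneg _ _ _) _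
    · exact (((measurable_gaussDensity d v).indicator hs).comp (by fun_prop)).aestronglyMeasurable
  rw [h1, integral_fun_norm_addHaar volume (fun y => s.indicator (gaussDensity d v) (y ^ 2)),
    finrank_euclideanSpace_fin,
    ← integral_comp_rpow_Ioi (fun y : ℝ => y ^ (d - 1) • s.indicator (gaussDensity d v) (y ^ 2))
      (p := 1 / 2) (by norm_num)]
  have h2 := integral_comp_mul_left_Ioi
    (fun x : ℝ => (|(1 / 2 : ℝ)| * x ^ ((1 / 2 : ℝ) - 1)) • ((x ^ (1 / 2 : ℝ)) ^ (d - 1) •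
      s.indicator (gaussDensity d v) ((x ^ (1 / 2 : ℝ)) ^ 2))) 0 hv'
  rw [mul_zero, smul_eq_mul, eq_inv_mul_iff_mul_eq₀ hv'.ne'] at h2
  rw [← h2]
  have h4 : ∀ u ∈ Set.Ioi (0 : ℝ),
      (|(1 / 2 : ℝ)| * (2 * v * u) ^ ((1 / 2 : ℝ) - 1)) • (((2 * v * u) ^ (1 / 2 : ℝ)) ^ (d - 1) •
      s.indicator (gaussDensity d v) (((2 * v * u) ^ (1 / 2 : ℝ)) ^ 2))
      = ((√(2 * Real.pi * v))⁻¹ ^ d * (√(2 * v)) ^ d / 2 * (2 * (v : ℝ))⁻¹) *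
        ((2 * (v : ℝ) * ·) ⁻¹' s).indicator
        (fun u => Real.exp (-u) * u ^ ((d : ℝ) / 2 - 1)) u := by
    intro u hu
    have hu' : 0 < u := hu
    have hpos : 0 < 2 * (v : ℝ) * u := by positivity
    have e1 : ((2 * (v : ℝ) * u) ^ (1 / 2 : ℝ)) ^ 2 = 2 * v * u := by
      rw [← Real.sqrt_eq_rpow, Real.sq_sqrt hpos.le]
    have e2 : (2 * (v : ℝ) * u) ^ ((1 / 2 : ℝ) - 1) * ((2 * (v : ℝ) * u) ^ (1 / 2 : ℝ)) ^ (d - 1)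
        = √(2 * v) ^ d * (2 * (v : ℝ))⁻¹ * u ^ ((d : ℝ) / 2 - 1) := by
      have e3 : (2 * (v : ℝ) * u) ^ ((1 / 2 : ℝ) - 1) *
          ((2 * (v : ℝ) * u) ^ (1 / 2 : ℝ)) ^ (d - 1) = (2 * v * u) ^ ((d : ℝ) / 2 - 1) := by
        rw [← Real.rpow_natCast, ← Real.rpow_mul hpos.le, ← Real.rpow_add hpos, Nat.cast_sub hd]
        congr 1
        push_cast
        ring
      have e4 : √(2 * (v : ℝ)) ^ d * (2 * (v : ℝ))⁻¹ = (2 * (v : ℝ)) ^ ((d : ℝ) / 2 - 1) := by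
        rw [Real.sqrt_eq_rpow, ← Real.rpow_natCast, ← Real.rpow_mul hv'.le,
          ← Real.rpow_neg_one (2 * (v : ℝ)), ← Real.rpow_add hv']
        congr 1
        ring
      rw [e3, e4, Real.mul_rpow hv'.le hu'.le]
    rw [e1]
    simp only [Set.indicator_apply, Set.mem_preimage, smul_eq_mul]
    split_ifs
    · have e3 : gaussDensity d v (2 * v * u) = (√(2 * Real.pi * v))⁻¹ ^ d * Real.exp (-u) := by
        rw [gaussDensity, neg_div, mul_div_cancel_left₀ _ hv'.ne']
      rw [e3, abs_of_pos (by norm_num : (0 : ℝ) < 1 / 2)]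
      linear_combination (1 / 2 * ((√(2 * Real.pi * v))⁻¹ ^ d * Real.exp (-u))) * e2
    · simp
  rw [setIntegral_congr_fun measurableSet_Ioi h4, integral_const_mul]
  simp only [nsmul_eq_mul, smul_eq_mul]
  field_simp

/-- Total mass one says that the radial constant times `Γ(d/2)` is `1`; this is divided out of the
formula for the ball. -/
lemma gaussE_real_norm_sq_lt {d : ℕ} (hd : 1 ≤ d) {v : ℝ≥0} (hv : v ≠ 0) {q : ℝ} (hq : 0 ≤ q) :
    (gaussE d v).real {z | ‖z‖ ^ 2 < q} =
      lowerGamma ((d : ℝ) / 2) (q / (2 * v)) / Real.Gamma ((d : ℝ) / 2) := by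
  have hv' : (0 : ℝ) < 2 * v := by positivity
  have hd' : (0 : ℝ) < d / 2 := by positivity
  have h1 := gaussE_real_radial hd hv MeasurableSet.univ
  have h2 := gaussE_real_radial hd hv (measurableSet_Iio (a := q))
  simp only [Set.mem_univ, Set.preimage_univ, Set.indicator_univ, ← Real.Gamma_eq_integral hd'] at h1
  have h3 : (gaussE d v).real {z | True} = 1 := by
    rw [measureReal_def, show {z : EuclideanSpace ℝ (Fin d) | True} = Set.univ from Set.ofPred_true,
      measure_univ, ENNReal.toReal_one]
  rw [h3] at h1
  have hG := Real.Gamma_pos_of_pos hd'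
  rw [eq_div_iff hG.ne']
  have h4 : ∫ u in Set.Ioi (0 : ℝ), ((2 * (v : ℝ) * ·) ⁻¹' Set.Iio q).indicator
        (fun u => Real.exp (-u) * u ^ ((d : ℝ) / 2 - 1)) u
      = lowerGamma ((d : ℝ) / 2) (q / (2 * v)) := by
    have hpre : ((2 * (v : ℝ) * ·) ⁻¹' Set.Iio q) = Set.Iio (q / (2 * v)) := by
      ext u
      simp only [Set.mem_preimage, Set.mem_Iio]
      rw [lt_div_iff₀ hv', mul_comm]
    rw [hpre, setIntegral_indicator measurableSet_Iio, Set.Ioi_inter_Iio, lowerGamma,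
      intervalIntegral.integral_of_le (by positivity), integral_Ioc_eq_integral_Ioo]
    simp_rw [mul_comm]
  change (gaussE d v).real {z | ‖z‖ ^ 2 ∈ Set.Iio q} * _ = _
  rw [h2, h4]
  linear_combination -(lowerGamma ((d : ℝ) / 2) (q / (2 * v))) * h1

end

/-! ### Brownian increments and the covariance structure of the counts. -/

section

lemma measurable_overlap {d : ℕ} (r : ℝ) :
    Measurable (overlap r : EuclideanSpace ℝ (Fin d) → ℝ) := by
  have hS : MeasurableSet {p : EuclideanSpace ℝ (Fin d) × EuclideanSpace ℝ (Fin d) |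
      ‖p.2‖ ≤ r ∧ ‖p.2 + p.1‖ ≤ r} :=
    (measurableSet_le (f := fun p : EuclideanSpace ℝ (Fin d) × EuclideanSpace ℝ (Fin d) => ‖p.2‖)
      (g := fun _ => r) (by fun_prop) (by fun_prop)).inter
    (measurableSet_le
      (f := fun p : EuclideanSpace ℝ (Fin d) × EuclideanSpace ℝ (Fin d) => ‖p.2 + p.1‖)
      (g := fun _ => r) (by fun_prop) (by fun_prop))
  exact (measurable_measure_prodMk_left (ν := volume) hS).ennreal_toReal

/-- The mean overlap of a ball with its Gaussian translate. -/
theorem integral_overlap_gaussE {d : ℕ} (hd : 1 ≤ d) {r σ : ℝ} (hr : 0 < r) (hσ : 0 < σ)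
    {v : ℝ≥0} (hv : v ≠ 0) :
    ∫ z, overlap r (σ • z) ∂(gaussE d v)
      = volume.real (Metric.closedBall (0 : EuclideanSpace ℝ (Fin d)) r) * J d r (σ ^ 2 * v) := by
  have hv' : (0 : ℝ) < v := by positivity
  have hd' : (0 : ℝ) < d / 2 := by positivity
  have hG := Real.Gamma_pos_of_pos hd'
  have hb := beta_pos_dim d
  simp_rw [overlap_eq hd hr]
  rw [integral_const_mul]
  -- After exchanging the integrals, for fixed `y` the Gaussian integral is the probability of `‖z‖²
  -- < 4 r² y / σ²`, an incomplete Gamma ratio.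
  set S : Set (EuclideanSpace ℝ (Fin d) × ℝ) := {p | ‖σ • p.1‖ ^ 2 / (4 * r ^ 2) < p.2} with hS
  have hSm : MeasurableSet S := measurableSet_lt (by fun_prop) (by fun_prop)
  have hint : Integrable (S.indicator fun p => betaWeight d p.2)
      ((gaussE d v).prod (volume.restrict (Set.Ioo 0 1))) :=
    (Integrable.comp_snd (integrableOn_betaWeight d) (gaussE d v)).indicator hSm
  have h1 : ∫ z, (∫ y in Set.Ioo (0 : ℝ) 1,
      (Set.Ioi (‖σ • z‖ ^ 2 / (4 * r ^ 2))).indicator (betaWeight d) y) ∂(gaussE d v)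
      = ∫ y in Set.Ioo (0 : ℝ) 1, (∫ z, S.indicator (fun p => betaWeight d p.2) (z, y)
        ∂(gaussE d v)) := by
    rw [← integral_integral_swap (f := fun z y => S.indicator (fun p => betaWeight d p.2) (z, y))
      hint]
    rfl
  have h2 : ∀ y ∈ Set.Ioo (0 : ℝ) 1, ∫ z, S.indicator (fun p => betaWeight d p.2) (z, y)
        ∂(gaussE d v) = (Real.Gamma ((d : ℝ) / 2))⁻¹ *
        (lowerGamma ((d : ℝ) / 2) (2 * r ^ 2 * y / (σ ^ 2 * v)) *
      (1 - y) ^ (((d : ℝ) - 1) / 2) * y ^ (-(1 / 2) : ℝ)) := by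
    intro y hy
    have hq : (0 : ℝ) ≤ 4 * r ^ 2 * y / σ ^ 2 := by have := hy.1.le; positivity
    have hset : (fun z => (z, y)) ⁻¹' S = {z | ‖z‖ ^ 2 < 4 * r ^ 2 * y / σ ^ 2} := by
      ext z
      change ‖σ • z‖ ^ 2 / (4 * r ^ 2) < y ↔ ‖z‖ ^ 2 < 4 * r ^ 2 * y / σ ^ 2
      rw [norm_smul, mul_pow, Real.norm_eq_abs, sq_abs, div_lt_iff₀ (by positivity),
        lt_div_iff₀ (by positivity), mul_comm (σ ^ 2), mul_comm y]
    have hind : ∀ z, S.indicator (fun p => betaWeight d p.2) (z, y)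
        = ((fun z => (z, y)) ⁻¹' S).indicator (fun _ => betaWeight d y) z := fun z => rfl
    simp_rw [hind]
    rw [integral_indicator_const _ (measurable_prodMk_right hSm), hset,
      gaussE_real_norm_sq_lt hd hv hq, smul_eq_mul, betaWeight]
    have : 4 * r ^ 2 * y / σ ^ 2 / (2 * v) = 2 * r ^ 2 * y / (σ ^ 2 * v) := by
      field_simp
      ring
    rw [this]
    ring
  rw [h1, setIntegral_congr_fun measurableSet_Ioo h2, integral_const_mul, J,
    intervalIntegral.integral_of_le zero_le_one, integral_Ioc_eq_integral_Ioo]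
  field_simp

section Brownian

variable {d : ℕ} {Ω : Type*} [MeasurableSpace Ω] {P : Measure Ω} [IsProbabilityMeasure P]

lemma IsBrownian.measurable_path {W : ℝ≥0 → Ω → EuclideanSpace ℝ (Fin d)}
    (h : IsBrownian W P) : Measurable fun ω t => W t ω :=
  measurable_pi_lambda _ h.measurable

lemma IsBrownian.measurable_coord {W : ℝ≥0 → Ω → EuclideanSpace ℝ (Fin d)}
    (h : IsBrownian W P) (t : ℝ≥0) (i : Fin d) : Measurable fun ω => W t ω i := by
  have := h.measurable t
  fun_prop

/-- All Brownian motions have the same law. -/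
lemma IsBrownian.map_eq {W W' : ℝ≥0 → Ω → EuclideanSpace ℝ (Fin d)} (h : IsBrownian W P)
    (h' : IsBrownian W' P) : P.map (fun ω t => W t ω) = P.map (fun ω t => W' t ω) := by
  -- Each coordinate law is the projective limit of one fixed family, hence unique; independence of
  -- the coordinates then fixes the joint law.
  have key : ∀ {V : ℝ≥0 → Ω → EuclideanSpace ℝ (Fin d)}, IsBrownian V P → ∀ i,
      IsProjectiveLimit (P.map fun ω t => V t ω i) BrownianReal.projectiveFamily := by
    intro V hV i I
    have hm : Measurable fun ω t => V t ω i := measurable_pi_lambda _ fun t => hV.measurable_coord t i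
    rw [Measure.map_map (Finset.measurable_restrict I) hm]
    exact ((hV.coord i).hasLaw I).map_eq
  have hpi : ∀ {V : ℝ≥0 → Ω → EuclideanSpace ℝ (Fin d)}, IsBrownian V P →
      P.map (fun ω t => V t ω) = (Measure.pi fun i => P.map fun ω t => V t ω i).map
        (fun x t => WithLp.toLp 2 fun i => x i t) := by
    intro V hV
    have hm : ∀ i, Measurable fun ω t => V t ω i := fun i =>
      measurable_pi_lambda _ fun t => hV.measurable_coord t i
    rw [← (iIndepFun_iff_map_fun_eq_pi_map fun i => (hm i).aemeasurable).1 hV.indep_coord,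
      Measure.map_map]
    · rfl
    · fun_prop
    · exact measurable_pi_lambda _ hm
  rw [hpi h, hpi h']
  congr 2
  ext1 i
  exact (key h i).unique (key h' i)

/-- The increments of a Brownian motion are Gaussian. -/
lemma IsBrownian.map_sub {W : ℝ≥0 → Ω → EuclideanSpace ℝ (Fin d)} (h : IsBrownian W P)
    (s t : ℝ≥0) : P.map (fun ω => W t ω - W s ω) = gaussE d (nndist (t : ℝ) s) := by
  have hind : iIndepFun (fun i ω => W t ω i - W s ω i) P :=
    h.indep_coord.comp (fun _ x => x t - x s) fun _ => by fun_prop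
  have hm : ∀ i, Measurable fun ω => W t ω i - W s ω i := fun i =>
    (h.measurable_coord t i).sub (h.measurable_coord s i)
  have h1 := (iIndepFun_iff_map_fun_eq_pi_map fun i => (hm i).aemeasurable).1 hind
  have h2 : ∀ i, P.map (fun ω => W t ω i - W s ω i) = gaussianReal 0 (nndist (t : ℝ) s) :=
    fun i => ((h.coord i).hasLaw_sub t s).map_eq
  simp_rw [h2] at h1
  rw [gaussE, ← h1, Measure.map_map]
  · rfl
  · exact (PiLp.volume_preserving_toLp (Fin d)).measurable
  · exact measurable_pi_lambda _ hm

end Brownian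

section Model

variable {d : ℕ}

/-- The marked points that are in the ball at time `t`. -/
def visitSet (d : ℕ) (r σ : ℝ) (t : ℝ≥0) :
    Set (EuclideanSpace ℝ (Fin d) × (ℝ≥0 → EuclideanSpace ℝ (Fin d))) :=
  {p | p.1 + σ • p.2 t ∈ Metric.closedBall 0 r}

lemma measurableSet_visitSet (r σ : ℝ) (t : ℝ≥0) : MeasurableSet (visitSet d r σ t) := by
  have : Measurable fun p : EuclideanSpace ℝ (Fin d) × (ℝ≥0 → EuclideanSpace ℝ (Fin d)) =>
      p.1 + σ • p.2 t := by fun_prop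
  exact this measurableSet_closedBall

/-- The correlation function of the process. -/
noncomputable def corr (d : ℕ) (r σ u : ℝ) : ℝ := if u = 0 then 1 else J d r (σ ^ 2 * |u|)

lemma rho_pos {lam : ℝ≥0} (hlam : 0 < lam) {r : ℝ} (hr : 0 < r) : 0 < rho d lam r :=
  mul_pos hlam (ENNReal.toReal_pos (Metric.measure_closedBall_pos volume _ hr).ne'
    measure_closedBall_lt_top.ne)

variable {Q : Measure (ℝ≥0 → EuclideanSpace ℝ (Fin d))} [IsProbabilityMeasure Q]

/-- Translation invariance of Lebesgue measure absorbs the position at time `s`, so that only the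
increment matters. -/
lemma visitSet_inter_slice (r σ : ℝ) (s t : ℝ≥0) (w : ℝ≥0 → EuclideanSpace ℝ (Fin d)) :
    volume ((fun x => (x, w)) ⁻¹' (visitSet d r σ s ∩ visitSet d r σ t))
      = volume {y : EuclideanSpace ℝ (Fin d) | ‖y‖ ≤ r ∧ ‖y + σ • (w t - w s)‖ ≤ r} := by
  rw [← measure_preimage_add_right volume (σ • w s) {y : EuclideanSpace ℝ (Fin d) |
    ‖y‖ ≤ r ∧ ‖y + σ • (w t - w s)‖ ≤ r}]
  congr 1
  ext x
  change (x + σ • w s ∈ Metric.closedBall 0 r ∧ x + σ • w t ∈ Metric.closedBall 0 r) ↔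
    ‖x + σ • w s‖ ≤ r ∧ ‖x + σ • w s + σ • (w t - w s)‖ ≤ r
  rw [mem_closedBall_zero_iff, mem_closedBall_zero_iff, smul_sub, add_assoc,
    add_sub_cancel]

lemma prod_visitSet_inter (r σ : ℝ) (s t : ℝ≥0) :
    (volume.prod Q) (visitSet d r σ s ∩ visitSet d r σ t) ≠ ∞ ∧
    (volume.prod Q).real (visitSet d r σ s ∩ visitSet d r σ t)
      = ∫ w, overlap r (σ • (w t - w s)) ∂Q := by
  have hm : MeasurableSet (visitSet d r σ s ∩ visitSet d r σ t) :=
    (measurableSet_visitSet r σ s).inter (measurableSet_visitSet r σ t)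
  have h1 : (volume.prod Q) (visitSet d r σ s ∩ visitSet d r σ t)
      = ∫⁻ w, volume {y : EuclideanSpace ℝ (Fin d) | ‖y‖ ≤ r ∧ ‖y + σ • (w t - w s)‖ ≤ r} ∂Q := by
    rw [Measure.prod_apply_symm hm]
    simp_rw [visitSet_inter_slice]
  have hle : ∀ w : ℝ≥0 → EuclideanSpace ℝ (Fin d),
      volume {y : EuclideanSpace ℝ (Fin d) | ‖y‖ ≤ r ∧ ‖y + σ • (w t - w s)‖ ≤ r}
      ≤ volume (Metric.closedBall (0 : EuclideanSpace ℝ (Fin d)) r) := fun w =>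
    measure_mono fun y hy => mem_closedBall_zero_iff.2 hy.1
  have hmeas : Measurable fun w : ℝ≥0 → EuclideanSpace ℝ (Fin d) =>
      volume {y : EuclideanSpace ℝ (Fin d) | ‖y‖ ≤ r ∧ ‖y + σ • (w t - w s)‖ ≤ r} := by
    simp_rw [← visitSet_inter_slice]
    exact measurable_measure_prodMk_right hm
  constructor
  · rw [h1]
    refine ne_top_of_le_ne_top ?_ (lintegral_mono hle)
    rw [lintegral_const, measure_univ, mul_one]
    exact measure_closedBall_lt_top.ne
  · rw [measureReal_def, h1, ← integral_toReal hmeas.aemeasurable]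
    · rfl
    · exact ae_of_all _ fun w => (hle w).trans_lt measure_closedBall_lt_top

lemma prod_visitSet_ne_top (r σ : ℝ) (s : ℝ≥0) : (volume.prod Q) (visitSet d r σ s) ≠ ∞ := by
  simpa using (prod_visitSet_inter (Q := Q) r σ s s).1

lemma intensity_visitSet (lam : ℝ≥0) (r σ : ℝ) (s : ℝ≥0) :
    intensity lam Q (visitSet d r σ s) = rho d lam r := by
  have := (prod_visitSet_inter (Q := Q) r σ s s).2
  rw [Set.inter_self] at this
  rw [intensity, this]
  simp [overlap_zero, rho]

variable {Ω : Type*} [MeasurableSpace Ω] {P : Measure Ω} [IsProbabilityMeasure P]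

/-- The increment of the path is Gaussian with variance `|t - s|`, so the intensity is `lam` times
the mean overlap computed above. -/
lemma intensity_visitSet_inter (hd : 1 ≤ d) {W : ℝ≥0 → Ω → EuclideanSpace ℝ (Fin d)}
    (h : IsBrownian W P) (lam : ℝ≥0) {r σ : ℝ} (hr : 0 < r) (hσ : 0 < σ) (s t : ℝ≥0) :
    intensity lam (P.map fun ω t => W t ω) (visitSet d r σ s ∩ visitSet d r σ t)
      = rho d lam r * corr d r σ (t - s) := by
  have : IsProbabilityMeasure (P.map fun ω t => W t ω) :=
    Measure.isProbabilityMeasure_map h.measurable_path.aemeasurable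
  -- Equal times are separate: the Gaussian degenerates, and `J d r 0` is `0` by division by zero,
  -- whence the value `1` built into `corr`.
  by_cases hst : s = t
  · rw [hst, Set.inter_self, intensity_visitSet]
    simp [corr]
  have hm : Measurable fun z : EuclideanSpace ℝ (Fin d) => overlap r (σ • z) :=
    (measurable_overlap r).comp (by fun_prop)
  have hne : nndist (t : ℝ) s ≠ 0 := by
    rw [Ne, nndist_eq_zero]
    exact fun h => hst (NNReal.coe_injective h.symm)
  rw [intensity, (prod_visitSet_inter r σ s t).2, integral_map h.measurable_path.aemeasurable]
  · have := integral_map (μ := P) ((h.measurable t).sub (h.measurable s)).aemeasurable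
      hm.aestronglyMeasurable
    rw [Pi.sub_def] at this
    rw [← this, h.map_sub, integral_overlap_gaussE hd hr hσ hne, corr,
      if_neg (sub_ne_zero.2 fun h => hst (NNReal.coe_injective h.symm)), rho, mul_assoc]
    rfl
  · exact (hm.comp (by fun_prop)).aestronglyMeasurable

lemma IsBrownianSystem.isMarkedPoisson {lam : ℝ≥0} {ξ : ℤ → Ω → EuclideanSpace ℝ (Fin d)}
    {W : ℤ → ℝ≥0 → Ω → EuclideanSpace ℝ (Fin d)} (h : IsBrownianSystem lam ξ W P) :
    IsMarkedPoisson lam ξ (fun j ω t => W j t ω) (P.map fun ω t => W 0 t ω) P where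
  poisson := h.poisson
  measurable j := (h.brownian j).measurable_path
  law j := ⟨(h.brownian j).measurable_path.aemeasurable, (h.brownian j).map_eq (h.brownian 0)⟩
  iIndep := h.indep_brownian
  indep := h.indep

end Model

end

/-! ### Bounds for the incomplete Gamma function, `J` and the correlation function. -/

section

section LowerGamma

variable {s : ℝ}

lemma intervalIntegrable_lowerGamma (hs : 0 < s) (a b : ℝ) :
    IntervalIntegrable (fun u : ℝ => u ^ (s - 1) * Real.exp (-u)) volume a b :=
  (intervalIntegral.intervalIntegrable_rpow' (by linarith)).mul_continuousOn (by fun_prop)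

lemma continuous_lowerGamma (hs : 0 < s) : Continuous (lowerGamma s) :=
  intervalIntegral.continuous_primitive (fun a b => intervalIntegrable_lowerGamma hs a b) 0

lemma lowerGamma_mono (hs : 0 < s) {x y : ℝ} (hx : 0 ≤ x) (hxy : x ≤ y) :
    lowerGamma s x ≤ lowerGamma s y := by
  refine intervalIntegral.integral_mono_interval le_rfl hx hxy ?_
    (intervalIntegrable_lowerGamma hs 0 y)
  filter_upwards [ae_restrict_mem measurableSet_Ioc] with u hu
  exact mul_nonneg (Real.rpow_nonneg hu.1.le _) (Real.exp_pos _).le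

lemma lowerGamma_nonneg (hs : 0 < s) {x : ℝ} (hx : 0 ≤ x) : 0 ≤ lowerGamma s x := by
  simpa [lowerGamma] using lowerGamma_mono hs le_rfl hx

lemma lowerGamma_pos (hs : 0 < s) {x : ℝ} (hx : 0 < x) : 0 < lowerGamma s x :=
  intervalIntegral.intervalIntegral_pos_of_pos_on (intervalIntegrable_lowerGamma hs 0 x)
    (fun _ hu => mul_pos (Real.rpow_pos_of_pos hu.1 _) (Real.exp_pos _)) hx

lemma lowerGamma_le_rpow (hs : 0 < s) {x : ℝ} (hx : 0 ≤ x) : lowerGamma s x ≤ x ^ s / s := by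
  have h : ∫ u in (0 : ℝ)..x, u ^ (s - 1) = x ^ s / s := by
    rw [integral_rpow (Or.inl (by linarith)), sub_add_cancel, Real.zero_rpow hs.ne', sub_zero]
  rw [← h]
  refine intervalIntegral.integral_mono_on hx (intervalIntegrable_lowerGamma hs 0 x)
    (intervalIntegral.intervalIntegrable_rpow' (by linarith)) fun u hu => ?_
  exact mul_le_of_le_one_right (Real.rpow_nonneg hu.1 _) (Real.exp_le_one_iff.2 (by linarith [hu.1]))

lemma lowerGamma_le_Gamma (hs : 0 < s) {x : ℝ} (hx : 0 ≤ x) : lowerGamma s x ≤ Real.Gamma s := by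
  rw [lowerGamma, intervalIntegral.integral_of_le hx, Real.Gamma_eq_integral hs]
  simp_rw [mul_comm (_ ^ (s - 1))]
  refine setIntegral_mono_set (Real.GammaIntegral_convergent hs) ?_
    Set.Ioc_subset_Ioi_self.eventuallyLE
  filter_upwards [ae_restrict_mem measurableSet_Ioi] with u hu
  exact mul_nonneg (Real.exp_pos _).le (Real.rpow_nonneg (le_of_lt hu) _)

end LowerGamma

section JFunction

variable {d : ℕ}

lemma half_dim_pos (hd : 1 ≤ d) : (0 : ℝ) < d / 2 := by positivity

lemma J_eq (d : ℕ) (r t : ℝ) :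
    J d r t = (beta (((d : ℝ) + 1) / 2) (1 / 2) * Real.Gamma ((d : ℝ) / 2))⁻¹ *
      ∫ y in Set.Ioo (0 : ℝ) 1, lowerGamma ((d : ℝ) / 2) (2 * r ^ 2 * y / t) * betaWeight d y := by
  rw [J, intervalIntegral.integral_of_le zero_le_one, integral_Ioc_eq_integral_Ioo, one_div]
  simp_rw [mul_assoc, betaWeight]

lemma J_const_pos (hd : 1 ≤ d) :
    0 < (beta (((d : ℝ) + 1) / 2) (1 / 2) * Real.Gamma ((d : ℝ) / 2))⁻¹ :=
  inv_pos.2 (mul_pos (beta_pos_dim d) (Real.Gamma_pos_of_pos (half_dim_pos hd)))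

lemma integrableOn_J (hd : 1 ≤ d) (r : ℝ) {t : ℝ} (ht : 0 ≤ t) :
    IntegrableOn (fun y => lowerGamma ((d : ℝ) / 2) (2 * r ^ 2 * y / t) * betaWeight d y)
      (Set.Ioo 0 1) := by
  refine (integrableOn_betaWeight d).bdd_mul (c := Real.Gamma ((d : ℝ) / 2)) ?_ ?_
  · exact ((continuous_lowerGamma (half_dim_pos hd)).comp (by fun_prop)).aestronglyMeasurable
  · filter_upwards [ae_restrict_mem measurableSet_Ioo] with y hy
    have h0 : 0 ≤ 2 * r ^ 2 * y / t := by have := hy.1.le; positivity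
    rw [Real.norm_eq_abs, abs_of_nonneg (lowerGamma_nonneg (half_dim_pos hd) h0)]
    exact lowerGamma_le_Gamma (half_dim_pos hd) h0

lemma J_nonneg (hd : 1 ≤ d) (r : ℝ) {t : ℝ} (ht : 0 ≤ t) : 0 ≤ J d r t := by
  rw [J_eq]
  refine mul_nonneg (J_const_pos hd).le (setIntegral_nonneg measurableSet_Ioo fun y hy => ?_)
  have h0 : 0 ≤ 2 * r ^ 2 * y / t := by have := hy.1.le; positivity
  exact mul_nonneg (lowerGamma_nonneg (half_dim_pos hd) h0) (betaWeight_nonneg d hy)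

lemma J_le_one (hd : 1 ≤ d) (r : ℝ) {t : ℝ} (ht : 0 ≤ t) : J d r t ≤ 1 := by
  rw [J_eq]
  have h : ∫ y in Set.Ioo (0 : ℝ) 1, lowerGamma ((d : ℝ) / 2) (2 * r ^ 2 * y / t) * betaWeight d y
      ≤ Real.Gamma ((d : ℝ) / 2) * beta (((d : ℝ) + 1) / 2) (1 / 2) := by
    rw [← integral_betaWeight, ← integral_const_mul]
    refine setIntegral_mono_on (integrableOn_J hd r ht)
      ((integrableOn_betaWeight d).const_mul _) measurableSet_Ioo fun y hy => ?_
    have h0 : 0 ≤ 2 * r ^ 2 * y / t := by have := hy.1.le; positivity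
    exact mul_le_mul_of_nonneg_right (lowerGamma_le_Gamma (half_dim_pos hd) h0)
      (betaWeight_nonneg d hy)
  have hb := beta_pos_dim d
  have hG := Real.Gamma_pos_of_pos (half_dim_pos hd)
  refine (mul_le_mul_of_nonneg_left h (J_const_pos hd).le).trans_eq ?_
  field_simp

/-- The constant in the upper bound for `J`. -/
noncomputable def decayConst (d : ℕ) : ℝ :=
  2 ^ ((d : ℝ) / 2) / ((d : ℝ) / 2 * Real.Gamma ((d : ℝ) / 2))

lemma decayConst_pos (hd : 1 ≤ d) : 0 < decayConst d :=
  div_pos (by positivity) (mul_pos (half_dim_pos hd) (Real.Gamma_pos_of_pos (half_dim_pos hd)))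

/-- From `γ(s; x) ≤ x^s / s` and `y ≤ 1`. The decay exponent `d / 2` is the source of the three
regimes of the rate. -/
lemma J_le_rpow (hd : 1 ≤ d) (r : ℝ) {t : ℝ} (ht : 0 < t) :
    J d r t ≤ decayConst d * (r ^ 2 / t) ^ ((d : ℝ) / 2) := by
  rw [J_eq]
  have hs := half_dim_pos hd
  have h : ∫ y in Set.Ioo (0 : ℝ) 1, lowerGamma ((d : ℝ) / 2) (2 * r ^ 2 * y / t) * betaWeight d y
      ≤ ((2 * (r ^ 2 / t)) ^ ((d : ℝ) / 2) / ((d : ℝ) / 2)) *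
        beta (((d : ℝ) + 1) / 2) (1 / 2) := by
    rw [← integral_betaWeight, ← integral_const_mul]
    refine setIntegral_mono_on (integrableOn_J hd r ht.le)
      ((integrableOn_betaWeight d).const_mul _) measurableSet_Ioo fun y hy => ?_
    have h0 : 0 ≤ 2 * r ^ 2 * y / t := by have := hy.1.le; positivity
    have h1 : 2 * r ^ 2 * y / t ≤ 2 * (r ^ 2 / t) := by
      rw [mul_div_assoc', div_le_div_iff_of_pos_right ht]
      exact mul_le_of_le_one_right (by positivity) hy.2.le
    refine mul_le_mul_of_nonneg_right ((lowerGamma_le_rpow hs h0).trans ?_) (betaWeight_nonneg d hy)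
    gcongr
  have hb := beta_pos_dim d
  have hG := Real.Gamma_pos_of_pos hs
  refine (mul_le_mul_of_nonneg_left h (J_const_pos hd).le).trans_eq ?_
  rw [Real.mul_rpow (by norm_num) (by positivity), decayConst]
  field_simp

lemma J_one_pos (hd : 1 ≤ d) : 0 < J d 1 1 := by
  rw [J_eq]
  refine mul_pos (J_const_pos hd) ?_
  rw [setIntegral_pos_iff_support_of_nonneg_ae]
  · have : Set.Ioo (0 : ℝ) 1 ⊆ Function.support (fun y : ℝ =>
        lowerGamma ((d : ℝ) / 2) (2 * 1 ^ 2 * y / 1) * betaWeight d y) ∩ Set.Ioo (0 : ℝ) 1 := by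
      refine fun y hy => ⟨(mul_pos (lowerGamma_pos (half_dim_pos hd) ?_) ?_).ne', hy⟩
      · simpa using hy.1
      · exact mul_pos (Real.rpow_pos_of_pos (by linarith [hy.2]) _) (Real.rpow_pos_of_pos hy.1 _)
    refine lt_of_lt_of_le ?_ (measure_mono this)
    simp
  · filter_upwards [ae_restrict_mem measurableSet_Ioo] with y hy
    exact mul_nonneg (lowerGamma_nonneg (half_dim_pos hd) (by have := hy.1.le; positivity))
      (betaWeight_nonneg d hy)
  · exact integrableOn_J hd 1 zero_le_one

/-- `J` is increasing in `r² / t`, and `J d 1 1` is its value at ratio `1`; this gives a lower bound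
depending on `d` alone. -/
lemma J_one_le (hd : 1 ≤ d) {r t : ℝ} (ht : 0 < t) (htr : t ≤ r ^ 2) : J d 1 1 ≤ J d r t := by
  rw [J_eq, J_eq]
  refine mul_le_mul_of_nonneg_left (setIntegral_mono_on (integrableOn_J hd 1 zero_le_one)
    (integrableOn_J hd r ht.le) measurableSet_Ioo fun y hy => ?_) (J_const_pos hd).le
  have := hy.1.le
  refine mul_le_mul_of_nonneg_right (lowerGamma_mono (half_dim_pos hd) (by positivity) ?_)
    (betaWeight_nonneg d hy)
  rw [div_one, le_div_iff₀ ht]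
  nlinarith

lemma measurable_J (hd : 1 ≤ d) (r : ℝ) : Measurable (J d r) := by
  have h : Measurable fun p : ℝ × ℝ =>
      lowerGamma ((d : ℝ) / 2) (2 * r ^ 2 * p.2 / p.1) * betaWeight d p.2 :=
    ((continuous_lowerGamma (half_dim_pos hd)).measurable.comp (by fun_prop)).mul
      ((measurable_betaWeight d).comp measurable_snd)
  have h2 := (h.stronglyMeasurable.integral_prod_right' (ν := volume.restrict (Set.Ioo 0 1))).measurable
  have h3 := h2.const_mul
    (beta (((d : ℝ) + 1) / 2) (1 / 2) * Real.Gamma ((d : ℝ) / 2))⁻¹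
  convert h3 using 1
  ext t
  rw [J_eq]

end JFunction

section Corr

variable {d : ℕ}

lemma corr_nonneg (hd : 1 ≤ d) (r σ u : ℝ) : 0 ≤ corr d r σ u := by
  unfold corr
  split_ifs
  · exact zero_le_one
  · exact J_nonneg hd r (by positivity)

lemma corr_le_one (hd : 1 ≤ d) (r σ u : ℝ) : corr d r σ u ≤ 1 := by
  unfold corr
  split_ifs
  · exact le_rfl
  · exact J_le_one hd r (by positivity)

lemma corr_neg (d : ℕ) (r σ u : ℝ) : corr d r σ (-u) = corr d r σ u := by
  simp [corr]

lemma corr_of_pos (d : ℕ) (r σ : ℝ) {u : ℝ} (hu : 0 < u) : corr d r σ u = J d r (σ ^ 2 * u) := by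
  rw [corr, if_neg hu.ne', abs_of_pos hu]

lemma measurable_corr (hd : 1 ≤ d) (r σ : ℝ) : Measurable (corr d r σ) := by
  unfold corr
  exact Measurable.ite (measurableSet_singleton 0) measurable_const
    ((measurable_J hd r).comp (by fun_prop))

lemma integrableOn_corr (hd : 1 ≤ d) (r σ : ℝ) {s : Set ℝ} (hs : volume s ≠ ∞) :
    IntegrableOn (corr d r σ) s :=
  Measure.integrableOn_of_bounded hs (measurable_corr hd r σ).aestronglyMeasurable (M := 1)
    (ae_of_all _ fun u => by
      rw [Real.norm_eq_abs, abs_of_nonneg (corr_nonneg hd r σ u)]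
      exact corr_le_one hd r σ u)

lemma corr_le_rpow (hd : 1 ≤ d) (r : ℝ) {σ u : ℝ} (hσ : 0 < σ) (hu : 0 < u) :
    corr d r σ u ≤ decayConst d * ((r / σ) ^ 2) ^ ((d : ℝ) / 2) * u ^ (-((d : ℝ) / 2)) := by
  rw [corr_of_pos d r σ hu, Real.rpow_neg hu.le, mul_assoc, ← div_eq_mul_inv,
    ← Real.div_rpow (by positivity) hu.le, div_pow, div_div]
  exact J_le_rpow hd r (by positivity)

end Corr

end

/-! ### The target functional `psi` and the integrated correlation. -/

section

variable {d : ℕ}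

lemma div_rpow_one_sub (x : ℝ) {t : ℝ} (ht : 0 < t) (α : ℝ) :
    x / t ^ (1 - α) = x * t ^ (α - 1) := by
  rw [div_eq_mul_inv, ← Real.rpow_neg ht.le, neg_sub]

lemma integrableOn_rpow_Ioc {α b : ℝ} (hα : 0 < α) (hb : 0 ≤ b) :
    IntegrableOn (fun t : ℝ => t ^ (α - 1)) (Set.Ioc 0 b) :=
  (intervalIntegrable_iff_integrableOn_Ioc_of_le hb).1
    (intervalIntegral.intervalIntegrable_rpow' (by linarith))

lemma setIntegral_rpow_Ioc {α b : ℝ} (hα : 0 < α) (hb : 0 ≤ b) :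
    ∫ t in Set.Ioc 0 b, t ^ (α - 1) = b ^ α / α := by
  rw [← intervalIntegral.integral_of_le hb, integral_rpow (Or.inl (by linarith)), sub_add_cancel,
    Real.zero_rpow hα.ne', sub_zero]

lemma measurable_corr_div (hd : 1 ≤ d) (r σ α : ℝ) :
    Measurable fun t : ℝ => corr d r σ t / t ^ (1 - α) :=
  (measurable_corr hd r σ).div (by fun_prop)

lemma corr_div_nonneg (hd : 1 ≤ d) (r σ α : ℝ) {t : ℝ} (ht : 0 ≤ t) :
    0 ≤ corr d r σ t / t ^ (1 - α) :=
  div_nonneg (corr_nonneg hd r σ t) (Real.rpow_nonneg ht _)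

lemma integrableOn_corr_div_Ioc (hd : 1 ≤ d) (r σ : ℝ) {α b : ℝ} (hα : 0 < α) (hb : 0 ≤ b) :
    IntegrableOn (fun t : ℝ => corr d r σ t / t ^ (1 - α)) (Set.Ioc 0 b) := by
  refine (integrableOn_rpow_Ioc hα hb).mono' (measurable_corr_div hd r σ α).aestronglyMeasurable ?_
  filter_upwards [ae_restrict_mem measurableSet_Ioc] with t ht
  rw [Real.norm_eq_abs, abs_of_nonneg (corr_div_nonneg hd r σ α ht.1.le), div_rpow_one_sub _ ht.1]
  exact mul_le_of_le_one_left (Real.rpow_nonneg ht.1.le _) (corr_le_one hd r σ t)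

lemma corr_div_le (hd : 1 ≤ d) (r : ℝ) {σ : ℝ} (hσ : 0 < σ) (α : ℝ) {t : ℝ} (ht : 0 < t) :
    corr d r σ t / t ^ (1 - α)
      ≤ decayConst d * ((r / σ) ^ 2) ^ ((d : ℝ) / 2) * t ^ (α - 1 - (d : ℝ) / 2) := by
  rw [div_rpow_one_sub _ ht, sub_eq_add_neg (α - 1), add_comm (α - 1), Real.rpow_add ht,
    ← mul_assoc]
  exact mul_le_mul_of_nonneg_right (corr_le_rpow hd r hσ ht) (Real.rpow_nonneg ht.le _)

lemma integrableOn_corr_div_Ioi (hd : 1 ≤ d) (r : ℝ) {σ α b : ℝ} (hσ : 0 < σ)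
    (hα : α < (d : ℝ) / 2) (hb : 0 < b) :
    IntegrableOn (fun t : ℝ => corr d r σ t / t ^ (1 - α)) (Set.Ioi b) := by
  refine ((integrableOn_Ioi_rpow_of_lt (show α - 1 - (d : ℝ) / 2 < -1 by linarith) hb).const_mul
    (decayConst d * ((r / σ) ^ 2) ^ ((d : ℝ) / 2))).mono'
    (measurable_corr_div hd r σ α).aestronglyMeasurable ?_
  filter_upwards [ae_restrict_mem measurableSet_Ioi] with t ht
  have ht' : 0 < t := hb.trans ht
  rw [Real.norm_eq_abs, abs_of_nonneg (corr_div_nonneg hd r σ α ht'.le)]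
  exact corr_div_le hd r hσ α ht'

lemma integral_corr_div_Ioi_le (hd : 1 ≤ d) (r : ℝ) {σ α b : ℝ} (hσ : 0 < σ)
    (hα : α < (d : ℝ) / 2) (hb : 0 < b) :
    ∫ t in Set.Ioi b, corr d r σ t / t ^ (1 - α)
      ≤ decayConst d * ((r / σ) ^ 2) ^ ((d : ℝ) / 2) *
        (b ^ (α - (d : ℝ) / 2) / ((d : ℝ) / 2 - α)) := by
  have hlt : α - 1 - (d : ℝ) / 2 < -1 := by linarith
  have h : ∫ t in Set.Ioi b, t ^ (α - 1 - (d : ℝ) / 2)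
      = b ^ (α - (d : ℝ) / 2) / ((d : ℝ) / 2 - α) := by
    rw [integral_Ioi_rpow_of_lt hlt hb, show α - 1 - (d : ℝ) / 2 + 1 = α - (d : ℝ) / 2 by ring,
      neg_div, ← div_neg, neg_sub]
  rw [← h, ← integral_const_mul]
  refine setIntegral_mono_on (integrableOn_corr_div_Ioi hd r hσ hα hb)
    ((integrableOn_Ioi_rpow_of_lt hlt hb).const_mul _) measurableSet_Ioi fun t ht => ?_
  exact corr_div_le hd r hσ α (hb.trans ht)

/-- Convergence at `0` comes from `α > 0` and boundedness, at infinity from `α < d / 2` and the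
decay of the correlation. -/
lemma integrableOn_corr_div (hd : 1 ≤ d) (r : ℝ) {σ α : ℝ} (hσ : 0 < σ) (hα0 : 0 < α)
    (hα : α < (d : ℝ) / 2) :
    IntegrableOn (fun t : ℝ => corr d r σ t / t ^ (1 - α)) (Set.Ioi 0) := by
  rw [← Set.Ioc_union_Ioi_eq_Ioi zero_le_one]
  exact (integrableOn_corr_div_Ioc hd r σ hα0 zero_le_one).union
    (integrableOn_corr_div_Ioi hd r hσ hα one_pos)

/-- The quantity estimated by `psiEst`. -/
noncomputable def psi (d : ℕ) (r σ α : ℝ) : ℝ :=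
  ∫ t in Set.Ioi (0 : ℝ), corr d r σ t / t ^ (1 - α)

/-- The substitution `t ↦ σ² t`. Solving for `σ²` gives the form of the estimator. -/
lemma psi_eq (d : ℕ) (r : ℝ) {σ : ℝ} (hσ : 0 < σ) (α : ℝ) :
    psi d r σ α = (σ ^ 2) ^ (-α) * Jalpha d r α := by
  have hs : 0 < σ ^ 2 := by positivity
  have h := integral_comp_mul_left_Ioi (fun t => J d r t / t ^ (1 - α)) 0 hs
  rw [mul_zero, smul_eq_mul] at h
  have h1 : psi d r σ α
      = ∫ t in Set.Ioi (0 : ℝ), (σ ^ 2) ^ (1 - α) * (J d r (σ ^ 2 * t) / (σ ^ 2 * t) ^ (1 - α)) := by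
    refine setIntegral_congr_fun measurableSet_Ioi fun t ht => ?_
    have ht' : (0 : ℝ) < t := ht
    rw [corr_of_pos d r σ ht', Real.mul_rpow hs.le ht'.le]
    have := Real.rpow_pos_of_pos hs (1 - α)
    have := Real.rpow_pos_of_pos ht' (1 - α)
    field_simp
  rw [h1, integral_const_mul, h, ← mul_assoc, Jalpha, ← Real.rpow_neg_one, ← Real.rpow_add hs]
  congr 2
  ring

/-- Only `t ≤ (r/σ)²` is kept, where `σ² t ≤ r²` and the correlation is at least `J d 1 1`. The
factor `1/α` is what later cancels the one in the loss bound. -/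
lemma le_psi (hd : 1 ≤ d) {r σ α : ℝ} (hr : 0 < r) (hσ : 0 < σ) (hα0 : 0 < α)
    (hα : α < (d : ℝ) / 2) : J d 1 1 * (((r / σ) ^ 2) ^ α / α) ≤ psi d r σ α := by
  have ha : 0 ≤ (r / σ) ^ 2 := by positivity
  rw [← setIntegral_rpow_Ioc hα0 ha, ← integral_const_mul, psi]
  calc ∫ t in Set.Ioc 0 ((r / σ) ^ 2), J d 1 1 * t ^ (α - 1)
      ≤ ∫ t in Set.Ioc 0 ((r / σ) ^ 2), corr d r σ t / t ^ (1 - α) := by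
        refine setIntegral_mono_on ((integrableOn_rpow_Ioc hα0 ha).const_mul _)
          (integrableOn_corr_div_Ioc hd r σ hα0 ha) measurableSet_Ioc fun t ht => ?_
        rw [div_rpow_one_sub _ ht.1, corr_of_pos d r σ ht.1]
        refine mul_le_mul_of_nonneg_right (J_one_le hd (mul_pos (by positivity) ht.1) ?_)
          (Real.rpow_nonneg ht.1.le _)
        have := ht.2
        rwa [div_pow, le_div_iff₀ (by positivity), mul_comm] at this
    _ ≤ _ := by
        refine setIntegral_mono_set (integrableOn_corr_div hd r hσ hα0 hα) ?_
          Set.Ioc_subset_Ioi_self.eventuallyLE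
        filter_upwards [ae_restrict_mem measurableSet_Ioi] with t ht
        exact corr_div_nonneg hd r σ α (le_of_lt ht)

lemma psi_eq_add (hd : 1 ≤ d) (r : ℝ) {σ α b : ℝ} (hσ : 0 < σ) (hα0 : 0 < α)
    (hα : α < (d : ℝ) / 2) (hb : 0 < b) :
    psi d r σ α = (∫ t in Set.Ioc 0 b, corr d r σ t / t ^ (1 - α)) +
      ∫ t in Set.Ioi b, corr d r σ t / t ^ (1 - α) := by
  rw [psi, ← Set.Ioc_union_Ioi_eq_Ioi hb.le]
  exact setIntegral_union (Set.Ioc_disjoint_Ioi le_rfl) measurableSet_Ioi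
    (integrableOn_corr_div_Ioc hd r σ hα0 hb.le) (integrableOn_corr_div_Ioi hd r hσ hα hb)

/-- The rate of the stochastic error, `phi d T` without its factor `ln² T`. -/
noncomputable def stochRate (d : ℕ) (T : ℝ) : ℝ :=
  if 2 < d then 1 / T else if d = 2 then Real.log T / T else 1 / √T

lemma log_sq_mul_stochRate (d : ℕ) (T : ℝ) : Real.log T ^ 2 * stochRate d T = phi d T := by
  unfold stochRate phi
  split_ifs <;> ring

/-- For `d / 2 > 1` the decay is integrable at infinity; the bound splits at `(r/σ)²`, using `1`
below and the decay above. -/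
lemma integral_corr_le_of_two_lt (hd : 2 < d) {r σ : ℝ} (hr : 0 < r) (hσ : 0 < σ) (T : ℝ) :
    ∫ u in Set.Ioc 0 T, corr d r σ u
      ≤ (1 + decayConst d / ((d : ℝ) / 2 - 1)) * (r / σ) ^ 2 := by
  have hd1 : 1 ≤ d := by omega
  have hd2 : (1 : ℝ) < d / 2 := by
    have : (2 : ℝ) < d := by exact_mod_cast hd
    linarith
  have ha : 0 < (r / σ) ^ 2 := by positivity
  -- The weighted estimates are used at `α = 1`, where the weight is identically `1`.
  have h1 := integrableOn_corr_div_Ioc hd1 r σ one_pos ha.le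
  have h2 := integrableOn_corr_div_Ioi hd1 r hσ hd2 ha
  have h3 := integral_corr_div_Ioi_le hd1 r hσ hd2 ha
  have h4 := psi_eq_add hd1 r hσ one_pos hd2 ha
  have h5 := integrableOn_corr_div hd1 r hσ one_pos hd2
  rw [psi] at h4
  simp only [sub_self, Real.rpow_zero, div_one] at h1 h2 h3 h4 h5
  have h6 : ∫ u in Set.Ioc 0 ((r / σ) ^ 2), corr d r σ u ≤ (r / σ) ^ 2 := by
    have := setIntegral_mono_on h1 (integrableOn_const (C := (1 : ℝ)) measure_Ioc_lt_top.ne)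
      measurableSet_Ioc fun u _ => corr_le_one hd1 r σ u
    simpa [ha.le] using this
  have h7 : ∫ u in Set.Ioc 0 T, corr d r σ u ≤ ∫ u in Set.Ioi 0, corr d r σ u :=
    setIntegral_mono_set h5 (ae_of_all _ fun u => corr_nonneg hd1 r σ u)
      Set.Ioc_subset_Ioi_self.eventuallyLE
  have h8 : ((r / σ) ^ 2) ^ ((d : ℝ) / 2) * ((r / σ) ^ 2) ^ (1 - (d : ℝ) / 2) = (r / σ) ^ 2 := by
    rw [← Real.rpow_add ha, add_sub_cancel, Real.rpow_one]
  calc _ ≤ _ := h7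
    _ = _ := h4
    _ ≤ _ := add_le_add h6 h3
    _ = (r / σ) ^ 2 + decayConst d / ((d : ℝ) / 2 - 1) *
        (((r / σ) ^ 2) ^ ((d : ℝ) / 2) * ((r / σ) ^ 2) ^ (1 - (d : ℝ) / 2)) := by ring
    _ = _ := by rw [h8]; ring

/-- The decay `1/u` integrates to `2 ln T` over `(1/T, T]`; the piece below `1/T` is absorbed
because `σ² ≤ r² T` means `1/T ≤ (r/σ)²`. -/
lemma integral_corr_two_le {r σ T : ℝ} (hr : 0 < r) (hσ : 0 < σ) (hT : Real.exp 2 < T)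
    (hσT : σ ^ 2 ≤ r ^ 2 * T) :
    ∫ u in Set.Ioc 0 T, corr 2 r σ u
      ≤ (1 + 2 * decayConst 2) * (r / σ) ^ 2 * Real.log T := by
  have hd1 : 1 ≤ 2 := by omega
  have hT0 : 0 < T := (Real.exp_pos 2).trans hT
  have hT1 : 1 < T := (Real.one_lt_exp_iff.2 two_pos).trans hT
  have hlog : 2 < Real.log T := (Real.lt_log_iff_exp_lt hT0).2 hT
  have hTi : T⁻¹ ≤ T := (inv_le_one_of_one_le₀ hT1.le).trans hT1.le
  have ha : T⁻¹ ≤ (r / σ) ^ 2 := by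
    rw [div_pow, le_div_iff₀ (by positivity), inv_mul_le_iff₀ hT0]
    linarith
  have h1 : ∫ u in Set.Ioc 0 T⁻¹, corr 2 r σ u ≤ T⁻¹ := by
    have := setIntegral_mono_on (integrableOn_corr hd1 r σ measure_Ioc_lt_top.ne)
      (integrableOn_const (C := (1 : ℝ)) measure_Ioc_lt_top.ne)
      (measurableSet_Ioc (a := 0) (b := T⁻¹)) fun u _ => corr_le_one hd1 r σ u
    simpa [hT0.le] using this
  have hTi0 : 0 < T⁻¹ := inv_pos.2 hT0
  have h2 : ∫ u in Set.Ioc T⁻¹ T, corr 2 r σ u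
      ≤ decayConst 2 * (r / σ) ^ 2 * (2 * Real.log T) := by
    have hI : ∫ u in Set.Ioc T⁻¹ T, u⁻¹ = 2 * Real.log T := by
      rw [← intervalIntegral.integral_of_le hTi, integral_inv_of_pos hTi0 hT0, div_inv_eq_mul,
        Real.log_mul hT0.ne' hT0.ne']
      ring
    have hint : IntegrableOn (fun u : ℝ => u⁻¹) (Set.Ioc T⁻¹ T) := by
      refine (intervalIntegrable_iff_integrableOn_Ioc_of_le hTi).1
        (intervalIntegral.intervalIntegrable_inv (fun u hu => ?_) (by fun_prop))
      rw [Set.uIcc_of_le hTi] at hu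
      exact (hTi0.trans_le hu.1).ne'
    rw [← hI, ← integral_const_mul]
    refine setIntegral_mono_on (integrableOn_corr hd1 r σ measure_Ioc_lt_top.ne)
      (hint.const_mul _) measurableSet_Ioc fun u hu => ?_
    have := corr_le_rpow hd1 r hσ (hTi0.trans hu.1)
    simpa [Real.rpow_neg_one] using this
  rw [← Set.Ioc_union_Ioc_eq_Ioc hTi0.le hTi, setIntegral_union
    (Set.Ioc_disjoint_Ioc_of_le le_rfl) measurableSet_Ioc
    (integrableOn_corr hd1 r σ measure_Ioc_lt_top.ne)
    (integrableOn_corr hd1 r σ measure_Ioc_lt_top.ne)]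
  have h3 : T⁻¹ ≤ (r / σ) ^ 2 * Real.log T :=
    ha.trans (le_mul_of_one_le_right (by positivity) (by linarith))
  linarith

/-- No splitting is needed: `u^(-1/2)` is integrable at `0`. -/
lemma integral_corr_one_le {r σ T : ℝ} (hr : 0 < r) (hσ : 0 < σ) (hT : 0 < T) :
    ∫ u in Set.Ioc 0 T, corr 1 r σ u ≤ 2 * decayConst 1 * (r / σ) * √T := by
  have hI := setIntegral_rpow_Ioc (α := 1 / 2) (by norm_num) hT.le
  have hint := integrableOn_rpow_Ioc (α := 1 / 2) (by norm_num) hT.le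
  rw [← Real.sqrt_eq_rpow] at hI
  have h : 2 * decayConst 1 * (r / σ) * √T
      = ∫ u in Set.Ioc 0 T, decayConst 1 * (r / σ) * u ^ ((1 : ℝ) / 2 - 1) := by
    rw [integral_const_mul, hI]
    ring
  rw [h]
  refine setIntegral_mono_on (integrableOn_corr le_rfl r σ measure_Ioc_lt_top.ne)
    (hint.const_mul _) measurableSet_Ioc fun u hu => ?_
  have := corr_le_rpow le_rfl r hσ hu.1
  rw [Nat.cast_one, ← Real.sqrt_eq_rpow, Real.sqrt_sq (by positivity)] at this
  rwa [show (1 : ℝ) / 2 - 1 = -(1 / 2) by norm_num]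

/-- The integrated correlation function, with a constant that depends only on the dimension. -/
lemma exists_integral_corr_le (hd : 1 ≤ d) : ∃ C : ℝ, 0 < C ∧ ∀ r σ T : ℝ, 0 < r → 0 < σ →
    Real.exp 2 < T → σ ^ 2 ≤ r ^ 2 * T →
    1 / T * ∫ u in Set.Ioc 0 T, corr d r σ u ≤ C * (r / σ) ^ min d 2 * stochRate d T := by
  have hD := decayConst_pos hd
  rcases lt_trichotomy d 2 with h | h | h
  · obtain rfl : d = 1 := by omega
    refine ⟨2 * decayConst 1, by positivity, fun r σ T hr hσ hT _ => ?_⟩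
    have hT0 : 0 < T := (Real.exp_pos 2).trans hT
    have hs : 1 / √T = 1 / T * √T := by
      rw [one_div, one_div, ← Real.sqrt_div_self, div_eq_inv_mul]
    refine (mul_le_mul_of_nonneg_left (integral_corr_one_le hr hσ hT0) (by positivity)).trans_eq ?_
    simp only [stochRate, hs]
    norm_num
    ring
  · subst h
    refine ⟨1 + 2 * decayConst 2, by positivity, fun r σ T hr hσ hT hσT => ?_⟩
    have hT0 : 0 < T := (Real.exp_pos 2).trans hT
    refine (mul_le_mul_of_nonneg_left (integral_corr_two_le hr hσ hT hσT)
      (by positivity)).trans_eq ?_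
    simp only [stochRate]
    norm_num
    ring
  · have hd2 : (1 : ℝ) < d / 2 := by
      have : (2 : ℝ) < d := by exact_mod_cast h
      linarith
    have : 0 < (d : ℝ) / 2 - 1 := by linarith
    refine ⟨1 + decayConst d / ((d : ℝ) / 2 - 1), by positivity, fun r σ T hr hσ hT _ => ?_⟩
    have hT0 : 0 < T := (Real.exp_pos 2).trans hT
    refine (mul_le_mul_of_nonneg_left (integral_corr_le_of_two_lt h hr hσ T)
      (by positivity)).trans_eq ?_
    rw [stochRate, if_pos h, min_eq_right h.le]
    ring

end

/-! ### Measurability of the estimators and of the observed path. -/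

section

lemma measurable_intervalIntegral_prod {X : Type*} [MeasurableSpace X] {f : X → ℝ → ℝ}
    (hf : Measurable (Function.uncurry f)) {b : X → ℝ} (hb : Measurable b) :
    Measurable fun x => ∫ s in (0 : ℝ)..b x, f x s := by
  have h1 : MeasurableSet {p : X × ℝ | 0 < p.2 ∧ p.2 ≤ b p.1} :=
    (measurableSet_lt measurable_const measurable_snd).inter
      (measurableSet_le measurable_snd (hb.comp measurable_fst))
  have h2 : MeasurableSet {p : X × ℝ | b p.1 < p.2 ∧ p.2 ≤ 0} :=
    (measurableSet_lt (hb.comp measurable_fst) measurable_snd).inter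
      (measurableSet_le measurable_snd measurable_const)
  have h3 := ((hf.indicator h1).stronglyMeasurable.integral_prod_right' (ν := volume)).measurable
  have h4 := ((hf.indicator h2).stronglyMeasurable.integral_prod_right' (ν := volume)).measurable
  convert h3.sub h4 using 1
  ext x
  rw [intervalIntegral, ← integral_indicator measurableSet_Ioc,
    ← integral_indicator measurableSet_Ioc]
  rfl

section Estimators

variable {Ω : Type*} [MeasurableSpace Ω] {N : Ω → ℝ → ℝ}

lemma measurable_covEst (hN : Measurable (Function.uncurry N)) (ρ T : ℝ) :
    Measurable fun p : Ω × ℝ => covEst ρ T (N p.1) p.2 := by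
  unfold covEst
  refine Measurable.mul (by fun_prop) (measurable_intervalIntegral_prod ?_ (by fun_prop))
  have h1 : Measurable fun q : (Ω × ℝ) × ℝ => N q.1.1 q.2 :=
    hN.comp (by fun_prop : Measurable fun q : (Ω × ℝ) × ℝ => (q.1.1, q.2))
  have h2 : Measurable fun q : (Ω × ℝ) × ℝ => N q.1.1 (q.2 + q.1.2) :=
    hN.comp (by fun_prop : Measurable fun q : (Ω × ℝ) × ℝ => (q.1.1, q.2 + q.1.2))
  exact (h1.sub_const ρ).mul (h2.sub_const ρ)

lemma measurable_corrEst (hN : Measurable (Function.uncurry N)) (ρ T : ℝ) :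
    Measurable fun p : Ω × ℝ => corrEst ρ T (N p.1) p.2 :=
  ((measurable_covEst hN ρ T).max measurable_const).const_mul _

lemma measurable_psiEst (hN : Measurable (Function.uncurry N)) (ρ T α b : ℝ) :
    Measurable fun ω => psiEst ρ T α b (N ω) := by
  refine measurable_intervalIntegral_prod (b := fun _ => b) ?_ measurable_const
  exact (measurable_corrEst hN ρ T).div (by fun_prop)

lemma measurable_sigmaSqStar (hN : Measurable (Function.uncurry N)) (d : ℕ) (r ρ T : ℝ) :
    Measurable fun ω => sigmaSqStar d r ρ T (N ω) :=
  (measurable_const.div (measurable_psiEst hN ρ T _ _)).pow_const _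

end Estimators

section Version

variable {d : ℕ} {Ω : Type*} [MeasurableSpace Ω] {P : Measure Ω} [IsProbabilityMeasure P]

lemma IsBrownian.ae_continuous {W : ℝ≥0 → Ω → EuclideanSpace ℝ (Fin d)} (h : IsBrownian W P) :
    ∀ᵐ ω ∂P, Continuous fun t => W t ω := by
  filter_upwards [ae_all_iff.2 fun i => (h.coord i).cont] with ω hω
  exact (PiLp.continuous_toLp 2 _).comp (continuous_pi hω)

/-- The observed path has a jointly measurable version. -/
theorem IsBrownianSystem.exists_measurable_count {lam : ℝ≥0}
    {ξ : ℤ → Ω → EuclideanSpace ℝ (Fin d)} {W : ℤ → ℝ≥0 → Ω → EuclideanSpace ℝ (Fin d)}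
    (h : IsBrownianSystem lam ξ W P) (r σ : ℝ) :
    ∃ N : Ω → ℝ → ℝ, Measurable (Function.uncurry N) ∧
      ∀ᵐ ω ∂P, count ξ W r σ ω = N ω := by
  have hc : ∀ᵐ ω ∂P, ∀ j, Continuous fun t => W j t ω :=
    ae_all_iff.2 fun j => (h.brownian j).ae_continuous
  obtain ⟨S, hS, hSm, hS0⟩ := exists_measurable_superset_of_null hc
  -- Paths are set to zero on a measurable null set containing all discontinuous ones; continuity in
  -- `t` then gives joint measurability.
  let V : ℤ → ℝ≥0 → Ω → EuclideanSpace ℝ (Fin d) := fun j t => Sᶜ.indicator (W j t)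
  have hVm : ∀ j, Measurable fun p : ℝ≥0 × Ω => V j p.1 p.2 := fun j => by
    refine measurable_uncurry_of_continuous_of_measurable (u := V j) (fun ω => ?_)
      fun t => ((h.brownian j).measurable t).indicator hSm.compl
    by_cases hω : ω ∈ S
    · have : (fun t => V j t ω) = fun _ => 0 := by
        ext1 t
        exact Set.indicator_of_notMem (by simpa using hω) _
      rw [this]
      exact continuous_const
    · have : (fun t => V j t ω) = fun t => W j t ω := by
        ext1 t
        exact Set.indicator_of_mem (by simpa using hω) _
      rw [this]
      by_contra hcon
      exact hω (hS fun hall => hcon (hall j))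
  refine ⟨fun ω t => count ξ V r σ ω t, ?_, ?_⟩
  · refine (Measurable.tsum fun j => ?_).ennreal_toReal
    have hp : Measurable fun p : Ω × ℝ => ξ j p.1 + σ • V j p.2.toNNReal p.1 :=
      ((h.poisson.measurable j).comp measurable_fst).add
        (((hVm j).comp (by fun_prop : Measurable fun p : Ω × ℝ => (p.2.toNNReal, p.1))).const_smul σ)
    exact (measurable_const.indicator measurableSet_closedBall).comp hp
  · filter_upwards [measure_eq_zero_iff_ae_notMem.1 hS0] with ω hω
    ext t
    simp only [count, V, Set.indicator_of_mem (show ω ∈ Sᶜ from hω)]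

end Version

end

/-! ### Second moments of integrated processes, and covariances of lagged products. -/

section

section SecondMoment

variable {Ω S : Type*} [MeasurableSpace Ω] [MeasurableSpace S] {P : Measure Ω} {ν : Measure S}
  [IsProbabilityMeasure P] [IsFiniteMeasure ν]

lemma integrable_mul_of_sq {f g : Ω → ℝ} (hf : AEStronglyMeasurable f P)
    (hg : AEStronglyMeasurable g P) (hf2 : Integrable (fun ω => f ω ^ 2) P)
    (hg2 : Integrable (fun ω => g ω ^ 2) P) :
    Integrable (fun ω => f ω * g ω) P ∧
      ∫ ω, ‖f ω * g ω‖ ∂P ≤ (∫ ω, f ω ^ 2 ∂P + ∫ ω, g ω ^ 2 ∂P) / 2 := by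
  have hle : ∀ ω, ‖f ω * g ω‖ ≤ (f ω ^ 2 + g ω ^ 2) / 2 := fun ω => by
    rw [norm_mul, Real.norm_eq_abs, Real.norm_eq_abs, ← sq_abs (f ω), ← sq_abs (g ω)]
    nlinarith [sq_nonneg (|f ω| - |g ω|)]
  have hint : Integrable (fun ω => (f ω ^ 2 + g ω ^ 2) / 2) P := (hf2.add hg2).div_const 2
  have h1 : Integrable (fun ω => f ω * g ω) P := hint.mono' (hf.mul hg) (ae_of_all _ hle)
  refine ⟨h1, (integral_mono h1.norm hint hle).trans_eq ?_⟩
  rw [integral_div, integral_add hf2 hg2]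

variable {Y : Ω → S → ℝ} {K : ℝ}

/-- Since `|y| ≤ 1 + y²` and both measures are finite, `Y` is integrable on the product space. -/
lemma integrable_section_of_sq (hY : Measurable (Function.uncurry Y))
    (hK : ∀ᵐ s ∂ν, Integrable (fun ω => Y ω s ^ 2) P ∧ ∫ ω, Y ω s ^ 2 ∂P ≤ K) :
    ∀ᵐ ω ∂P, Integrable (Y ω) ν := by
  have hsq : Integrable (fun p : Ω × S => Y p.1 p.2 ^ 2) (P.prod ν) := by
    have hm : Measurable fun p : Ω × S => Y p.1 p.2 ^ 2 := Measurable.pow_const hY 2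
    refine (integrable_prod_iff' hm.aestronglyMeasurable).2 ⟨hK.mono fun s hs => hs.1,
      Integrable.of_bound (C := K) ?_ (hK.mono fun s hs => ?_)⟩
    · exact (hm.norm.comp measurable_swap).stronglyMeasurable.integral_prod_right'.aestronglyMeasurable
    · simp only [norm_pow, Real.norm_eq_abs, sq_abs]
      rw [abs_of_nonneg (integral_nonneg fun ω => sq_nonneg _)]
      exact hs.2
  have h1 : Integrable (fun p : Ω × S => Y p.1 p.2) (P.prod ν) := by
    refine ((integrable_const (1 : ℝ)).add hsq).mono' hY.aestronglyMeasurable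
      (ae_of_all _ fun p => ?_)
    rw [Real.norm_eq_abs, Pi.add_apply]
    nlinarith [sq_nonneg (|Y p.1 p.2| - 1), sq_abs (Y p.1 p.2), abs_nonneg (Y p.1 p.2)]
  exact h1.prod_right_ae

/-- By `|ab| ≤ (a² + b²) / 2` the mean of each product is at most `K`, which justifies Fubini for
the squared integral. -/
lemma integrable_mul_sections (hY : Measurable (Function.uncurry Y))
    (hK : ∀ᵐ s ∂ν, Integrable (fun ω => Y ω s ^ 2) P ∧ ∫ ω, Y ω s ^ 2 ∂P ≤ K) :
    Integrable (fun p : Ω × S × S => Y p.1 p.2.1 * Y p.1 p.2.2) (P.prod (ν.prod ν)) := by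
  have hm1 : Measurable fun p : Ω × S × S => Y p.1 p.2.1 :=
    hY.comp (by fun_prop : Measurable fun p : Ω × S × S => (p.1, p.2.1))
  have hm2 : Measurable fun p : Ω × S × S => Y p.1 p.2.2 :=
    hY.comp (by fun_prop : Measurable fun p : Ω × S × S => (p.1, p.2.2))
  have hm := hm1.mul hm2
  have hs : ∀ s, AEStronglyMeasurable (fun ω => Y ω s) P := fun s =>
    (hY.comp measurable_prodMk_right).aestronglyMeasurable
  have key : ∀ᵐ q ∂ν.prod ν, Integrable (fun ω => Y ω q.1 * Y ω q.2) P ∧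
      ∫ ω, ‖Y ω q.1 * Y ω q.2‖ ∂P ≤ K := by
    filter_upwards [Measure.quasiMeasurePreserving_fst.ae hK,
      Measure.quasiMeasurePreserving_snd.ae hK] with q h1 h2
    have h3 := integrable_mul_of_sq (hs q.1) (hs q.2) h1.1 h2.1
    exact ⟨h3.1, h3.2.trans (by linarith [h1.2, h2.2])⟩
  refine (integrable_prod_iff' hm.aestronglyMeasurable).2 ⟨key.mono fun q hq => hq.1,
    Integrable.of_bound (C := K) ?_ (key.mono fun q hq => ?_)⟩
  · exact (hm.norm.comp measurable_swap).stronglyMeasurable.integral_prod_right'.aestronglyMeasurable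
  · rw [Real.norm_eq_abs, abs_of_nonneg (integral_nonneg fun ω => norm_nonneg _)]
    exact hq.2

/-- The second moment of an integrated random function. -/
theorem integral_sq_integral (hY : Measurable (Function.uncurry Y))
    (hK : ∀ᵐ s ∂ν, Integrable (fun ω => Y ω s ^ 2) P ∧ ∫ ω, Y ω s ^ 2 ∂P ≤ K) :
    Integrable (fun ω => (∫ s, Y ω s ∂ν) ^ 2) P ∧
    ∫ ω, (∫ s, Y ω s ∂ν) ^ 2 ∂P = ∫ q, (∫ ω, Y ω q.1 * Y ω q.2 ∂P) ∂(ν.prod ν) := by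
  have h := integrable_mul_sections hY hK
  have h1 : ∀ ω, (∫ s, Y ω s ∂ν) ^ 2 = ∫ q, Y ω q.1 * Y ω q.2 ∂(ν.prod ν) := fun ω => by
    rw [sq, ← integral_prod_mul]
  simp_rw [h1]
  exact ⟨h.integral_prod_left,
    integral_integral_swap (f := fun ω (q : S × S) => Y ω q.1 * Y ω q.2) h⟩

/-- A form of Minkowski's inequality for second moments. -/
theorem integral_sq_integral_le (hY : Measurable (Function.uncurry Y))
    (hK : ∀ᵐ s ∂ν, Integrable (fun ω => Y ω s ^ 2) P ∧ ∫ ω, Y ω s ^ 2 ∂P ≤ K) :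
    ∫ ω, (∫ s, Y ω s ∂ν) ^ 2 ∂P ≤ K * ν.real Set.univ ^ 2 := by
  rw [(integral_sq_integral hY hK).2]
  have hs : ∀ s, AEStronglyMeasurable (fun ω => Y ω s) P := fun s =>
    (hY.comp measurable_prodMk_right).aestronglyMeasurable
  have key : ∀ᵐ q ∂ν.prod ν, ∫ ω, Y ω q.1 * Y ω q.2 ∂P ≤ K := by
    filter_upwards [Measure.quasiMeasurePreserving_fst.ae hK,
      Measure.quasiMeasurePreserving_snd.ae hK] with q h1 h2
    have h3 := integrable_mul_of_sq (hs q.1) (hs q.2) h1.1 h2.1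
    refine (integral_mono h3.1 h3.1.norm fun ω => Real.le_norm_self _).trans (h3.2.trans ?_)
    linarith [h1.2, h2.2]
  refine (integral_mono_ae (integrable_mul_sections hY hK).integral_prod_right
    (integrable_const K) key).trans_eq ?_
  rw [integral_const, smul_eq_mul, measureReal_def, ← Set.univ_prod_univ, Measure.prod_prod,
    ENNReal.toReal_mul, measureReal_def]
  ring

end SecondMoment

section Moments

variable {d : ℕ} {Ω : Type*} [MeasurableSpace Ω] {P : Measure Ω} [IsProbabilityMeasure P]
  {lam : ℝ≥0} {ξ : ℤ → Ω → EuclideanSpace ℝ (Fin d)}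
  {W : ℤ → ℝ≥0 → Ω → EuclideanSpace ℝ (Fin d)} {r σ : ℝ}

/-- The covariance function of the observed process. -/
theorem IsBrownianSystem.integral_mul (h : IsBrownianSystem lam ξ W P) (hd : 1 ≤ d) (hr : 0 < r)
    (hσ : 0 < σ) {s t : ℝ} (hs : 0 ≤ s) (ht : 0 ≤ t) :
    Integrable (fun ω => (count ξ W r σ ω s - rho d lam r) * (count ξ W r σ ω t - rho d lam r)) P ∧
    ∫ ω, (count ξ W r σ ω s - rho d lam r) * (count ξ W r σ ω t - rho d lam r) ∂P
      = rho d lam r * corr d r σ (t - s) := by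
  have : IsProbabilityMeasure (P.map fun ω t => W 0 t ω) :=
    Measure.isProbabilityMeasure_map (h.brownian 0).measurable_path.aemeasurable
  have h1 := h.isMarkedPoisson.integral_mul (measurableSet_visitSet r σ s.toNNReal)
    (measurableSet_visitSet r σ t.toNNReal) (prod_visitSet_ne_top r σ _)
    (prod_visitSet_ne_top r σ _)
  rw [intensity_visitSet_inter hd (h.brownian 0) lam hr hσ, Real.coe_toNNReal _ hs,
    Real.coe_toNNReal _ ht] at h1
  simp only [centredCount, intensity_visitSet] at h1
  exact h1

/-- The covariances of the products `(N(s) - ρ) (N(s + t) - ρ)`. -/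
theorem IsBrownianSystem.cov_mul_le (h : IsBrownianSystem lam ξ W P) (hd : 1 ≤ d) (hr : 0 < r)
    (hσ : 0 < σ) {s s' t : ℝ} (hs : 0 ≤ s) (hs' : 0 ≤ s') (ht : 0 ≤ t) :
    let ρ := rho d lam r
    let X := fun ω u => count ξ W r σ ω u - ρ
    let Y := fun ω u => X ω u * X ω (u + t) - ρ * corr d r σ t
    Integrable (fun ω => Y ω s * Y ω s') P ∧ ∫ ω, Y ω s * Y ω s' ∂P
      ≤ (ρ + ρ ^ 2) * corr d r σ (s' - s) +
        ρ ^ 2 / 2 * (corr d r σ (s' - s + t) + corr d r σ (s' - s - t)) := by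
  intro ρ X Y
  have : IsProbabilityMeasure (P.map fun ω t => W 0 t ω) :=
    Measure.isProbabilityMeasure_map (h.brownian 0).measurable_path.aemeasurable
  have hρ : 0 ≤ ρ := mul_nonneg lam.2 measureReal_nonneg
  obtain ⟨hi1, he1⟩ := h.integral_mul hd hr hσ hs (add_nonneg hs ht)
  obtain ⟨hi2, he2⟩ := h.integral_mul hd hr hσ hs' (add_nonneg hs' ht)
  rw [add_sub_cancel_left] at he1 he2
  let τ : Fin 4 → ℝ≥0 := ![s.toNNReal, (s + t).toNNReal, s'.toNNReal, (s' + t).toNNReal]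
  obtain ⟨hi4, he4⟩ := h.isMarkedPoisson.integral_prod_four
    (D := fun i => visitSet d r σ (τ i)) (fun i => measurableSet_visitSet r σ _)
    (fun i => prod_visitSet_ne_top r σ _)
  simp only [Fin.prod_univ_four, centredCount, intensity_visitSet,
    intensity_visitSet_inter hd (h.brownian 0) lam hr hσ] at hi4 he4
  -- The fourth cumulant only decreases under further intersections, so the visits at `s` and `s'`
  -- alone bound it.
  have hκ : intensity lam (P.map fun ω t => W 0 t ω) (⋂ i, visitSet d r σ (τ i))
      ≤ ρ * corr d r σ (s' - s) := by
    have h0 := intensity_visitSet_inter hd (h.brownian 0) lam hr hσ s.toNNReal s'.toNNReal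
    rw [Real.coe_toNNReal _ hs, Real.coe_toNNReal _ hs'] at h0
    rw [← h0]
    refine mul_le_mul_of_nonneg_left (measureReal_mono (Set.subset_inter
      (Set.iInter_subset _ 0) (Set.iInter_subset _ 2)) (prod_visitSet_inter r σ _ _).1) lam.2
  have e0 : ((τ 0 : ℝ≥0) : ℝ) = s := Real.coe_toNNReal _ hs
  have e1 : ((τ 1 : ℝ≥0) : ℝ) = s + t := Real.coe_toNNReal _ (add_nonneg hs ht)
  have e2 : ((τ 2 : ℝ≥0) : ℝ) = s' := Real.coe_toNNReal _ hs'
  have e3 : ((τ 3 : ℝ≥0) : ℝ) = s' + t := Real.coe_toNNReal _ (add_nonneg hs' ht)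
  rw [e0, e1, e2, e3] at he4
  change Integrable (fun ω => X ω s * X ω (s + t) * X ω s' * X ω (s' + t)) P at hi4
  change ∫ ω, X ω s * X ω (s + t) * X ω s' * X ω (s' + t) ∂P = _ at he4
  change Integrable (fun ω => X ω s * X ω (s + t)) P at hi1
  change Integrable (fun ω => X ω s' * X ω (s' + t)) P at hi2
  change ∫ ω, X ω s * X ω (s + t) ∂P = ρ * corr d r σ t at he1
  change ∫ ω, X ω s' * X ω (s' + t) ∂P = ρ * corr d r σ t at he2
  set c := ρ * corr d r σ t with hc
  have hYY : ∀ ω, Y ω s * Y ω s' = X ω s * X ω (s + t) * X ω s' * X ω (s' + t)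
      - c * (X ω s * X ω (s + t)) - c * (X ω s' * X ω (s' + t)) + c ^ 2 := fun ω => by
    simp only [Y]
    ring
  simp_rw [hYY]
  have hia : Integrable (fun ω => X ω s * X ω (s + t) * X ω s' * X ω (s' + t)
      - c * (X ω s * X ω (s + t))) P := hi4.sub (hi1.const_mul c)
  have hib : Integrable (fun ω => X ω s * X ω (s + t) * X ω s' * X ω (s' + t)
      - c * (X ω s * X ω (s + t)) - c * (X ω s' * X ω (s' + t))) P := hia.sub (hi2.const_mul c)
  refine ⟨hib.add (integrable_const _), ?_⟩
  rw [integral_add hib (integrable_const _), integral_sub hia (hi2.const_mul c),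
    integral_sub hi4 (hi1.const_mul c), integral_const_mul, integral_const_mul, he1, he2, he4]
  have hc1 := corr_le_one hd r σ
  have hc0 := corr_nonneg hd r σ
  have q1 : corr d r σ (s' - s) * corr d r σ (s' - s) ≤ corr d r σ (s' - s) :=
    mul_le_of_le_one_right (hc0 _) (hc1 _)
  -- For `a, b` in `[0, 1]` one has `ab ≤ (a + b) / 2`; after this linearisation only integrals of
  -- single correlations remain.
  have q2 : corr d r σ (s' - s + t) * corr d r σ (s' - s - t)
      ≤ (corr d r σ (s' - s + t) + corr d r σ (s' - s - t)) / 2 := by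
    nlinarith [hc0 (s' - s + t), hc0 (s' - s - t), hc1 (s' - s + t), hc1 (s' - s - t)]
  have hρ2 : 0 ≤ ρ ^ 2 := sq_nonneg _
  have q3 := mul_le_mul_of_nonneg_left q1 hρ2
  have q4 := mul_le_mul_of_nonneg_left q2 hρ2
  rw [show s + t - s = t by ring, show s' + t - s' = t by ring,
    show s' + t - (s + t) = s' - s by ring, show s' + t - s = s' - s + t by ring,
    show s' - (s + t) = s' - s - t by ring]
  simp only [integral_const, probReal_univ, smul_eq_mul, one_mul]
  -- Of the three pairings the first equals `c ^ 2` and cancels against the centring.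
  change _ + (ρ * corr d r σ t * (ρ * corr d r σ t) + ρ * corr d r σ (s' - s) *
    (ρ * corr d r σ (s' - s)) + ρ * corr d r σ (s' - s + t) * (ρ * corr d r σ (s' - s - t)))
    - _ - _ + _ ≤ _
  rw [hc]
  linarith

end Moments

end

/-! ### Mean square error of the empirical covariance. -/

section

variable {d : ℕ}

lemma intervalIntegrable_corr (hd : 1 ≤ d) (r σ a b : ℝ) :
    IntervalIntegrable (corr d r σ) volume a b :=
  ⟨integrableOn_corr hd r σ measure_Ioc_lt_top.ne, integrableOn_corr hd r σ measure_Ioc_lt_top.ne⟩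

/-- The shifted window lies in `[-T, T]`, and the correlation is even. -/
lemma setIntegral_corr_add_le (hd : 1 ≤ d) (r σ : ℝ) {L T x : ℝ} (hL : 0 ≤ L) (hx : -T ≤ x)
    (hxL : x + L ≤ T) :
    IntegrableOn (fun u => corr d r σ (u + x)) (Set.Ioc 0 L) ∧
    ∫ u in Set.Ioc 0 L, corr d r σ (u + x) ≤ 2 * ∫ u in Set.Ioc 0 T, corr d r σ u := by
  have hT : 0 ≤ T := by linarith
  constructor
  · refine Measure.integrableOn_of_bounded measure_Ioc_lt_top.ne
      ((measurable_corr hd r σ).comp (by fun_prop)).aestronglyMeasurable (M := 1)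
      (ae_of_all _ fun u => ?_)
    rw [Real.norm_eq_abs, abs_of_nonneg (corr_nonneg hd r σ _)]
    exact corr_le_one hd r σ _
  rw [← intervalIntegral.integral_of_le hL, ← intervalIntegral.integral_of_le hT,
    intervalIntegral.integral_comp_add_right (corr d r σ), zero_add]
  have h1 : ∫ u in x..L + x, corr d r σ u ≤ ∫ u in -T..T, corr d r σ u :=
    intervalIntegral.integral_mono_interval hx (by linarith) (by linarith)
      (ae_of_all _ fun u => corr_nonneg hd r σ u) (intervalIntegrable_corr hd r σ _ _)
  have h2 : ∫ u in -T..0, corr d r σ u = ∫ u in (0 : ℝ)..T, corr d r σ u := by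
    have := intervalIntegral.integral_comp_neg (a := 0) (b := T) (corr d r σ)
    simp only [corr_neg, neg_zero] at this
    exact this.symm
  rw [← intervalIntegral.integral_add_adjacent_intervals (a := -T) (b := 0)
    (intervalIntegrable_corr hd r σ _ _) (intervalIntegrable_corr hd r σ _ _), h2] at h1
  linarith

variable {Ω : Type*} [MeasurableSpace Ω] {P : Measure Ω} [IsProbabilityMeasure P]
  {lam : ℝ≥0} {ξ : ℤ → Ω → EuclideanSpace ℝ (Fin d)}
  {W : ℤ → ℝ≥0 → Ω → EuclideanSpace ℝ (Fin d)} {r σ : ℝ}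

/-- The mean square error of the empirical covariance function. -/
theorem IsBrownianSystem.covEst_error (h : IsBrownianSystem lam ξ W P) (hd : 1 ≤ d) (hr : 0 < r)
    (hσ : 0 < σ) {N : Ω → ℝ → ℝ} (hN : Measurable (Function.uncurry N))
    (hNc : ∀ᵐ ω ∂P, count ξ W r σ ω = N ω) {t T : ℝ} (ht : 0 ≤ t) (hT : 0 < T)
    (htT : t ≤ T / 2) :
    Integrable (fun ω => (covEst (rho d lam r) T (N ω) t - rho d lam r * corr d r σ t) ^ 2) P ∧
    ∫ ω, (covEst (rho d lam r) T (N ω) t - rho d lam r * corr d r σ t) ^ 2 ∂P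
      ≤ 8 / T * (rho d lam r + rho d lam r ^ 2) * ∫ u in Set.Ioc 0 T, corr d r σ u := by
  set ρ := rho d lam r with hρ
  have hρ0 : 0 ≤ ρ := mul_nonneg lam.2 measureReal_nonneg
  set I := ∫ u in Set.Ioc 0 T, corr d r σ u with hI
  have hI0 : 0 ≤ I := integral_nonneg fun u => corr_nonneg hd r σ u
  set L := T - t with hL
  have hL2 : T / 2 ≤ L := by linarith
  have hL0 : 0 < L := by linarith
  set ν : Measure ℝ := volume.restrict (Set.Ioc 0 L) with hν
  let Y : Ω → ℝ → ℝ := fun ω s => (N ω s - ρ) * (N ω (s + t) - ρ) - ρ * corr d r σ t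
  have hY : Measurable (Function.uncurry Y) := by
    have h2 : Measurable fun p : Ω × ℝ => N p.1 (p.2 + t) :=
      hN.comp (by fun_prop : Measurable fun p : Ω × ℝ => (p.1, p.2 + t))
    exact ((hN.sub_const ρ).mul (h2.sub_const ρ)).sub_const _
  have hcov : ∀ s s', 0 ≤ s → 0 ≤ s' → Integrable (fun ω => Y ω s * Y ω s') P ∧
      ∫ ω, Y ω s * Y ω s' ∂P ≤ (ρ + ρ ^ 2) * corr d r σ (s' - s) +
        ρ ^ 2 / 2 * (corr d r σ (s' - s + t) + corr d r σ (s' - s - t)) := by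
    intro s s' hs hs'
    obtain ⟨h1, h2⟩ := h.cov_mul_le hd hr hσ hs hs' ht
    have hae := hNc.mono fun ω hω => congrArg
      (fun n : ℝ → ℝ => ((n s - ρ) * (n (s + t) - ρ) - ρ * corr d r σ t) *
        ((n s' - ρ) * (n (s' + t) - ρ) - ρ * corr d r σ t)) hω
    exact ⟨h1.congr hae, (integral_congr_ae hae).symm.trans_le h2⟩
  have hpos : ∀ᵐ s ∂ν, s ∈ Set.Ioc 0 L := ae_restrict_mem measurableSet_Ioc
  have hK : ∀ᵐ s ∂ν, Integrable (fun ω => Y ω s ^ 2) P ∧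
      ∫ ω, Y ω s ^ 2 ∂P ≤ (ρ + ρ ^ 2) * corr d r σ 0 +
        ρ ^ 2 / 2 * (corr d r σ (0 + t) + corr d r σ (0 - t)) := by
    filter_upwards [hpos] with s hs
    have := hcov s s hs.1.le hs.1.le
    rw [sub_self] at this
    simp_rw [sq (Y _ s)]
    exact this
  -- Moving the constant into the time integral needs an integrable path section, hence the almost
  -- sure statement.
  have heq : ∀ᵐ ω ∂P, (covEst ρ T (N ω) t - ρ * corr d r σ t) ^ 2
      = (1 / L) ^ 2 * (∫ s, Y ω s ∂ν) ^ 2 := by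
    filter_upwards [integrable_section_of_sq hY hK] with ω hω
    have hc : Integrable (fun _ : ℝ => ρ * corr d r σ t) ν := integrable_const _
    have h1 : ∫ s, (N ω s - ρ) * (N ω (s + t) - ρ) ∂ν
        = (∫ s, Y ω s ∂ν) + L * (ρ * corr d r σ t) := by
      have h2 := integral_add hω hc
      simp only [Y, sub_add_cancel, integral_const, smul_eq_mul] at h2
      rw [h2, hν, measureReal_restrict_apply_univ, Real.volume_real_Ioc_of_le hL0.le, sub_zero]
    rw [covEst, ← hL, intervalIntegral.integral_of_le hL0.le, h1, ← mul_pow]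
    congr 1
    field_simp
    ring
  obtain ⟨hi, he⟩ := integral_sq_integral hY hK
  refine ⟨(hi.const_mul _).congr (heq.mono fun ω hω => hω.symm), ?_⟩
  rw [integral_congr_ae heq, integral_const_mul, he]
  have hF := (integrable_mul_sections hY hK).integral_prod_right
  have hM : ∀ᵐ s ∂ν, ∫ s', (∫ ω, Y ω s * Y ω s' ∂P) ∂ν ≤ 4 * (ρ + ρ ^ 2) * I := by
    filter_upwards [hpos, hF.prod_right_ae] with s hs hFs
    -- With `0 < s ≤ T - t` the windows shifted by `-s` and `-s ± t` all stay in `[-T, T]`. They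
    -- contribute `2 (ρ + ρ²) I` and `2 ρ² I`, at most `4 (ρ + ρ²) I` in total.
    obtain ⟨a1, a2⟩ := setIntegral_corr_add_le hd r σ (T := T) (x := -s) hL0.le
      (by linarith [hs.2]) (by linarith [hs.1])
    obtain ⟨b1, b2⟩ := setIntegral_corr_add_le hd r σ (T := T) (x := -s + t) hL0.le
      (by linarith [hs.2]) (by linarith [hs.1])
    obtain ⟨c1, c2⟩ := setIntegral_corr_add_le hd r σ (T := T) (x := -s - t) hL0.le
      (by linarith [hs.2]) (by linarith [hs.1])
    have hbc : Integrable (fun u => corr d r σ (u + (-s + t)) + corr d r σ (u + (-s - t))) ν :=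
      b1.add c1
    have hle : ∫ s', (∫ ω, Y ω s * Y ω s' ∂P) ∂ν
        ≤ ∫ u, ((ρ + ρ ^ 2) * corr d r σ (u + -s) +
        ρ ^ 2 / 2 * (corr d r σ (u + (-s + t)) + corr d r σ (u + (-s - t)))) ∂ν := by
      refine integral_mono_ae hFs ((a1.const_mul _).add (hbc.const_mul _)) ?_
      filter_upwards [hpos] with s' hs'
      have := (hcov s s' hs.1.le hs'.1.le).2
      rwa [sub_add, sub_sub, sub_eq_add_neg s' (s - t), sub_eq_add_neg s' (s + t),
        neg_sub, neg_add', sub_eq_add_neg s' s, sub_eq_neg_add t] at this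
    rw [integral_add (a1.const_mul _) (hbc.const_mul _), integral_const_mul, integral_const_mul,
      integral_add b1 c1] at hle
    have hρ2 : 0 ≤ ρ ^ 2 / 2 := by positivity
    have m1 := mul_le_mul_of_nonneg_left a2 (show 0 ≤ ρ + ρ ^ 2 by positivity)
    have m2 := mul_le_mul_of_nonneg_left (add_le_add b2 c2) hρ2
    have m3 : 0 ≤ ρ * I := mul_nonneg hρ0 hI0
    nlinarith
  have hle : ∫ q, (∫ ω, Y ω q.1 * Y ω q.2 ∂P) ∂(ν.prod ν) ≤ L * (4 * (ρ + ρ ^ 2) * I) := by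
    rw [integral_prod _ hF]
    refine (integral_mono_ae hF.integral_prod_left (integrable_const _) hM).trans_eq ?_
    rw [integral_const, smul_eq_mul, hν, measureReal_restrict_apply_univ,
      Real.volume_real_Ioc_of_le hL0.le, sub_zero]
  refine (mul_le_mul_of_nonneg_left hle (by positivity)).trans ?_
  -- The restriction `t ≤ T / 2` enters here and turns the constant `4` into `8`.
  have h3 : 1 / L ≤ 2 / T := by
    rw [div_le_div_iff₀ hL0 hT]
    linarith
  have h4 : 0 ≤ 4 * (ρ + ρ ^ 2) * I := by positivity
  calc (1 / L) ^ 2 * (L * (4 * (ρ + ρ ^ 2) * I)) = 1 / L * (4 * (ρ + ρ ^ 2) * I) := by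
        field_simp
    _ ≤ 2 / T * (4 * (ρ + ρ ^ 2) * I) := mul_le_mul_of_nonneg_right h3 h4
    _ = _ := by ring

end

/-! ### From the error of `psiEst` to the relative loss, and the tuning parameters. -/

section

/-- Bernoulli's inequality, applied to `u` when `u ≤ 1` and to `u⁻¹` when `u ≥ 1`, where division by
`u ^ p + 1` prevents growth. The bound is in `u⁻¹` because `u` will be `Ψ / Ψ̂`. -/
lemma rpow_sub_one_div_le {u p : ℝ} (hu : 0 < u) (hp : 1 ≤ p) :
    |u ^ p - 1| / (u ^ p + 1) ≤ p * |u⁻¹ - 1| := by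
  have hup : 0 < u ^ p := Real.rpow_pos_of_pos hu p
  have bern : ∀ v : ℝ, 0 < v → 1 - v ^ p ≤ p * (1 - v) := fun v hv => by
    have := one_add_mul_self_le_rpow_one_add (s := v - 1) (by linarith) hp
    rw [add_sub_cancel] at this
    linarith
  rcases le_total 1 u with h | h
  · have h1 : 1 ≤ u ^ p := Real.one_le_rpow h (by linarith)
    have hv : u⁻¹ ≤ 1 := inv_le_one_of_one_le₀ h
    rw [abs_of_nonneg (by linarith), abs_of_nonpos (by linarith), neg_sub]
    refine le_trans ?_ (bern u⁻¹ (inv_pos.2 hu))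
    rw [Real.inv_rpow hu.le, div_le_iff₀ (by linarith)]
    have : (u ^ p)⁻¹ * u ^ p = 1 := inv_mul_cancel₀ hup.ne'
    nlinarith [inv_le_one_of_one_le₀ h1]
  · have h1 : u ^ p ≤ 1 := Real.rpow_le_one hu.le h (by linarith)
    have hv : 1 ≤ u⁻¹ := (one_le_inv₀ hu).2 h
    rw [abs_of_nonpos (by linarith), abs_of_nonneg (by linarith), neg_sub]
    have h2 : (1 - u ^ p) / (u ^ p + 1) ≤ 1 - u ^ p :=
      div_le_self (by linarith) (by linarith)
    have h3 : 1 - u ≤ u⁻¹ - 1 := by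
      have : u⁻¹ * u = 1 := inv_mul_cancel₀ hu.ne'
      nlinarith
    exact h2.trans ((bern u hu).trans (mul_le_mul_of_nonneg_left h3 (by linarith)))

/-- The relative loss of the estimator of `σ²` in terms of the relative error of `psiEst`. -/
lemma relLoss_le {x m s α : ℝ} (hx : 0 ≤ x) (hm : 0 < m) (hs : 0 < s) (hα0 : 0 < α)
    (hα1 : α ≤ 1) :
    relLoss ((s ^ α * m / x) ^ (1 / α)) s ≤ 1 / α * (|x - m| / m) := by
  have hp : 1 ≤ 1 / α := (one_le_div hα0).2 hα1
  rcases hx.eq_or_lt with rfl | hx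
  -- At `x = 0` the estimator is `0` by division by zero and its loss is `1`, while the right side
  -- is `1 / α ≥ 1`.
  · rw [div_zero, Real.zero_rpow (by positivity), relLoss, zero_sub, zero_add, zero_sub, abs_neg,
      abs_neg, abs_of_pos hs, abs_of_pos hm, div_self hs.ne', div_self hm.ne', mul_one]
    exact hp
  · have hsα : (s ^ α * m / x) ^ (1 / α) = s * (m / x) ^ (1 / α) := by
      rw [mul_div_assoc, Real.mul_rpow (by positivity) (by positivity), ← Real.rpow_mul hs.le,
        mul_one_div_cancel hα0.ne', Real.rpow_one]
    have hq : 0 < (m / x) ^ (1 / α) := Real.rpow_pos_of_pos (by positivity) _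
    have h1 : relLoss (s * (m / x) ^ (1 / α)) s
        = |(m / x) ^ (1 / α) - 1| / ((m / x) ^ (1 / α) + 1) := by
      rw [relLoss, ← mul_sub_one, ← mul_add_one, abs_mul, abs_of_pos hs,
        mul_div_mul_left _ _ hs.ne']
    have h2 : |x - m| / m = |(m / x)⁻¹ - 1| := by
      rw [inv_div, ← div_self hm.ne', ← sub_div, abs_div, abs_of_pos hm]
    rw [hsα, h1, h2]
    exact rpow_sub_one_div_le (by positivity) hp

lemma psiEst_nonneg {ρ T α b : ℝ} (hρ : 0 ≤ ρ) (hb : 0 ≤ b) (N : ℝ → ℝ) :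
    0 ≤ psiEst ρ T α b N := by
  refine intervalIntegral.integral_nonneg hb fun t ht => div_nonneg ?_ (Real.rpow_nonneg ht.1 _)
  exact mul_nonneg (by positivity) (le_max_right _ _)

section Tuning

variable {d : ℕ} {T : ℝ}

lemma four_lt_exp_four : (4 : ℝ) < Real.exp 4 := by
  have := Real.add_one_lt_exp (show (4 : ℝ) ≠ 0 by norm_num)
  linarith

lemma four_le_log (hT : Real.exp 4 ≤ T) : 4 ≤ Real.log T :=
  (Real.le_log_iff_exp_le ((Real.exp_pos 4).trans_le hT)).2 hT

lemma bStar_pos (d : ℕ) (hT : Real.exp 4 ≤ T) : 0 < bStar d T := by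
  have h0 : 0 < T := (Real.exp_pos 4).trans_le hT
  have hl : 0 < Real.log T := by linarith [four_le_log hT]
  unfold bStar
  split_ifs <;> positivity

/-- In every dimension `b_* ≤ √T`, and `√T ≤ T / 2` once `T ≥ 4`. This admits all lags up to `b_*`
in the covariance bound. -/
lemma bStar_le (d : ℕ) (hT : Real.exp 4 ≤ T) : bStar d T ≤ T / 2 := by
  have h4 : 4 < T := four_lt_exp_four.trans_le hT
  have h0 : 0 < T := by linarith
  have hl : 1 ≤ Real.log T := by linarith [four_le_log hT]
  have hs : √T ≤ T / 2 := by
    rw [Real.sqrt_le_left (by linarith)]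
    nlinarith
  refine le_trans ?_ hs
  have hdiv : ∀ k : ℕ, T / Real.log T ^ k ≤ T := fun k => div_le_self h0.le (one_le_pow₀ hl)
  unfold bStar
  split_ifs with h1 h2
  · rw [Real.sqrt_eq_rpow]
    refine (Real.rpow_le_rpow (by positivity) (hdiv 2) (by positivity)).trans
      (Real.rpow_le_rpow_of_exponent_le (by linarith) ?_)
    have : (2 : ℝ) ≤ d := by exact_mod_cast h1.le
    exact one_div_le_one_div_of_le two_pos this
  · rw [Real.sqrt_eq_rpow]
    exact Real.rpow_le_rpow (by positivity) (hdiv 3) (by norm_num)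
  · exact div_le_self (Real.sqrt_nonneg T) (one_le_pow₀ hl)

/-- The reason for the choice of `b_*`: the squared truncation error, of order `b ^ (-d)`, matches
the target rate. -/
lemma inv_bStar_pow (hd : 1 ≤ d) (hT : Real.exp 4 ≤ T) : (bStar d T ^ d)⁻¹ = phi d T := by
  have h0 : 0 < T := (Real.exp_pos 4).trans_le hT
  have hl : 0 < Real.log T := by linarith [four_le_log hT]
  unfold bStar phi
  split_ifs with h1 h2
  · rw [one_div, Real.rpow_inv_natCast_pow (by positivity) (by omega), inv_div]
  · rw [h2, ← Real.sqrt_eq_rpow, Real.sq_sqrt (by positivity), inv_div]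
  · obtain rfl : d = 1 := by omega
    rw [pow_one, inv_div]

lemma phi_pos (d : ℕ) (hT : Real.exp 4 ≤ T) : 0 < phi d T := by
  have h0 : 0 < T := (Real.exp_pos 4).trans_le hT
  have hl : 0 < Real.log T := by linarith [four_le_log hT]
  unfold phi
  split_ifs <;> positivity

/-- The reason for the choice of `α_*`: powers `x ^ α` with `1/T ≤ x ≤ T` stay between `1/e` and
`e`. -/
lemma rpow_alphaStar_self (hT : 1 < T) : T ^ alphaStar T = Real.exp 1 := by
  have hl : 0 < Real.log T := Real.log_pos hT
  rw [Real.rpow_def_of_pos (by linarith), alphaStar, mul_one_div_cancel hl.ne']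

lemma alphaStar_pos (hT : Real.exp 4 ≤ T) : 0 < alphaStar T :=
  one_div_pos.2 (by linarith [four_le_log hT])

lemma alphaStar_le (hT : Real.exp 4 ≤ T) : alphaStar T ≤ 1 / 4 :=
  one_div_le_one_div_of_le (by norm_num) (four_le_log hT)

end Tuning

end

/-! ### The error of `psiEst` and the risk bound. -/

section

/-- The measure `t ^ (α - 1) dt` on `(0, b]`. -/
noncomputable def powerMeasure (α b : ℝ) : Measure ℝ :=
  (volume.restrict (Set.Ioc 0 b)).withDensity fun t => ENNReal.ofReal (t ^ (α - 1))

section PowerMeasure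

variable {α b : ℝ}

lemma measurable_ofReal_rpow (α : ℝ) :
    Measurable fun t : ℝ => ENNReal.ofReal (t ^ (α - 1)) := by fun_prop

lemma isFiniteMeasure_powerMeasure (hα : 0 < α) (hb : 0 ≤ b) :
    IsFiniteMeasure (powerMeasure α b) :=
  isFiniteMeasure_withDensity_ofReal (integrableOn_rpow_Ioc hα hb).2

lemma ae_powerMeasure_mem (α b : ℝ) : ∀ᵐ t ∂powerMeasure α b, t ∈ Set.Ioc 0 b :=
  (withDensity_absolutelyContinuous _ _).ae_le (ae_restrict_mem measurableSet_Ioc)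

lemma ofReal_rpow_smul_ae (α b : ℝ) (f : ℝ → ℝ) :
    (fun t => (ENNReal.ofReal (t ^ (α - 1))).toReal • f t)
      =ᵐ[volume.restrict (Set.Ioc 0 b)] fun t => f t / t ^ (1 - α) := by
  filter_upwards [ae_restrict_mem measurableSet_Ioc] with t ht
  rw [ENNReal.toReal_ofReal (Real.rpow_nonneg ht.1.le _), smul_eq_mul, div_rpow_one_sub _ ht.1,
    mul_comm]

lemma integrable_powerMeasure_iff {f : ℝ → ℝ} :
    Integrable f (powerMeasure α b) ↔ IntegrableOn (fun t => f t / t ^ (1 - α)) (Set.Ioc 0 b) := by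
  rw [powerMeasure, integrable_withDensity_iff_integrable_smul' (measurable_ofReal_rpow α)
    (ae_of_all _ fun _ => ENNReal.ofReal_lt_top)]
  exact integrable_congr (ofReal_rpow_smul_ae α b f)

lemma integral_powerMeasure (f : ℝ → ℝ) :
    ∫ t, f t ∂powerMeasure α b = ∫ t in Set.Ioc 0 b, f t / t ^ (1 - α) := by
  rw [powerMeasure, integral_withDensity_eq_integral_toReal_smul (measurable_ofReal_rpow α)
    (ae_of_all _ fun _ => ENNReal.ofReal_lt_top)]
  exact integral_congr_ae (ofReal_rpow_smul_ae α b f)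

/-- This mass is squared in the Minkowski bound and produces the factor `ln² T` of the stochastic
error. -/
lemma powerMeasure_real_univ (hα : 0 < α) (hb : 0 ≤ b) :
    (powerMeasure α b).real Set.univ = b ^ α / α := by
  rw [← setIntegral_rpow_Ioc hα hb]
  have h := integral_powerMeasure (α := α) (b := b) fun _ => 1
  rw [integral_const, smul_eq_mul, mul_one] at h
  rw [h]
  refine setIntegral_congr_fun measurableSet_Ioc fun t ht => ?_
  simp only [div_rpow_one_sub 1 ht.1, one_mul]

end PowerMeasure

variable {d : ℕ} {Ω : Type*} [MeasurableSpace Ω] {P : Measure Ω} [IsProbabilityMeasure P]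
  {lam : ℝ≥0} {ξ : ℤ → Ω → EuclideanSpace ℝ (Fin d)}
  {W : ℤ → ℝ≥0 → Ω → EuclideanSpace ℝ (Fin d)} {r σ : ℝ}

/-- Taking the positive part is a contraction that fixes the nonnegative target `ρ c`. -/
lemma sq_corrEst_sub_le {ρ c : ℝ} (hρ : 0 < ρ) (hc : 0 ≤ c) (T : ℝ) (N : ℝ → ℝ) (t : ℝ) :
    (corrEst ρ T N t - c) ^ 2 ≤ (1 / ρ) ^ 2 * (covEst ρ T N t - ρ * c) ^ 2 := by
  have h1 : corrEst ρ T N t - c = 1 / ρ * (max (covEst ρ T N t) 0 - ρ * c) := by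
    rw [corrEst]
    field_simp
  have h2 : |max (covEst ρ T N t) 0 - ρ * c| ≤ |covEst ρ T N t - ρ * c| := by
    have := abs_max_sub_max_le_abs (covEst ρ T N t) (ρ * c) 0
    rwa [max_eq_left (show 0 ≤ ρ * c by positivity)] at this
  rw [h1, mul_pow]
  exact mul_le_mul_of_nonneg_left (sq_le_sq.2 h2) (sq_nonneg _)

/-- The mean square error of the estimated integral of the correlation function. -/
theorem IsBrownianSystem.psiEst_error (h : IsBrownianSystem lam ξ W P) (hd : 1 ≤ d) (hr : 0 < r)
    (hσ : 0 < σ) (hlam : 0 < lam) {N : Ω → ℝ → ℝ} (hN : Measurable (Function.uncurry N))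
    (hNc : ∀ᵐ ω ∂P, count ξ W r σ ω = N ω) {T α b : ℝ} (hα0 : 0 < α) (hα : α < (d : ℝ) / 2)
    (hb : 0 < b) (hbT : b ≤ T / 2) :
    Integrable (fun ω => (psiEst (rho d lam r) T α b (N ω) - psi d r σ α) ^ 2) P ∧
    ∫ ω, (psiEst (rho d lam r) T α b (N ω) - psi d r σ α) ^ 2 ∂P
      ≤ 2 * (8 / T * (1 + 1 / rho d lam r) * (∫ u in Set.Ioc 0 T, corr d r σ u) *
        (b ^ α / α) ^ 2) + 2 * (∫ t in Set.Ioi b, corr d r σ t / t ^ (1 - α)) ^ 2 := by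
  have hT : 0 < T := by linarith
  have hρ0 : 0 < rho d lam r := rho_pos hlam hr
  set ρ := rho d lam r with hρ
  set I := ∫ u in Set.Ioc 0 T, corr d r σ u with hI
  set tail := ∫ t in Set.Ioi b, corr d r σ t / t ^ (1 - α) with htail
  set ν := powerMeasure α b with hν
  have : IsFiniteMeasure ν := isFiniteMeasure_powerMeasure hα0 hb.le
  let Y : Ω → ℝ → ℝ := fun ω t => corrEst ρ T (N ω) t - corr d r σ t
  have hY : Measurable (Function.uncurry Y) :=
    (measurable_corrEst hN ρ T).sub ((measurable_corr hd r σ).comp measurable_snd)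
  have hK : ∀ᵐ t ∂ν, Integrable (fun ω => Y ω t ^ 2) P ∧
      ∫ ω, Y ω t ^ 2 ∂P ≤ 8 / T * (1 + 1 / ρ) * I := by
    filter_upwards [ae_powerMeasure_mem α b] with t ht
    obtain ⟨h1, h2⟩ := h.covEst_error hd hr hσ hN hNc ht.1.le hT (ht.2.trans hbT)
    have hle : ∀ ω, Y ω t ^ 2 ≤ (1 / ρ) ^ 2 * (covEst ρ T (N ω) t - ρ * corr d r σ t) ^ 2 :=
      fun ω => sq_corrEst_sub_le hρ0 (corr_nonneg hd r σ t) T (N ω) t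
    have h3 : Integrable (fun ω => Y ω t ^ 2) P := by
      refine (h1.const_mul ((1 / ρ) ^ 2)).mono'
        ((hY.comp measurable_prodMk_right).pow_const 2).aestronglyMeasurable (ae_of_all _ fun ω => ?_)
      rw [Real.norm_eq_abs, abs_of_nonneg (sq_nonneg _)]
      exact hle ω
    refine ⟨h3, (integral_mono h3 (h1.const_mul _) hle).trans ?_⟩
    rw [integral_const_mul]
    refine (mul_le_mul_of_nonneg_left h2 (sq_nonneg _)).trans_eq ?_
    rw [← hρ, ← hI]
    field_simp
    ring
  obtain ⟨hi, -⟩ := integral_sq_integral hY hK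
  have hle := integral_sq_integral_le hY hK
  rw [hν, powerMeasure_real_univ hα0 hb.le, ← hν] at hle
  have hpt : ∀ᵐ ω ∂P, (psiEst ρ T α b (N ω) - psi d r σ α) ^ 2
      ≤ 2 * (∫ t, Y ω t ∂ν) ^ 2 + 2 * tail ^ 2 := by
    filter_upwards [integrable_section_of_sq hY hK] with ω hω
    have hc : Integrable (corr d r σ) ν :=
      integrable_powerMeasure_iff.2 (integrableOn_corr_div_Ioc hd r σ hα0 hb.le)
    have h1 := integral_add hω hc
    simp only [Y, sub_add_cancel] at h1
    rw [integral_powerMeasure, integral_powerMeasure,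
      ← intervalIntegral.integral_of_le hb.le] at h1
    rw [psiEst, h1, psi_eq_add hd r hσ hα0 hα hb, integral_powerMeasure (corr d r σ), ← htail]
    rw [hν, integral_powerMeasure (Y ω)]
    set A := ∫ t in Set.Ioc 0 b, corr d r σ t / t ^ (1 - α)
    change ((∫ t in Set.Ioc 0 b, Y ω t / t ^ (1 - α)) + A - _) ^ 2 ≤ _
    -- The error is the stochastic integral minus the tail, and `(x - y)² ≤ 2x² + 2y²`.
    nlinarith [sq_nonneg ((∫ t in Set.Ioc 0 b, Y ω t / t ^ (1 - α)) + tail)]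
  have hG : Integrable (fun ω => 2 * (∫ t, Y ω t ∂ν) ^ 2 + 2 * tail ^ 2) P :=
    (hi.const_mul 2).add (integrable_const _)
  have hint : Integrable (fun ω => (psiEst ρ T α b (N ω) - psi d r σ α) ^ 2) P := by
    refine hG.mono' (((measurable_psiEst hN ρ T α b).sub_const _).pow_const 2).aestronglyMeasurable
      (hpt.mono fun ω hω => ?_)
    rw [Real.norm_eq_abs, abs_of_nonneg (sq_nonneg _)]
    exact hω
  refine ⟨hint, (integral_mono_ae hint hG hpt).trans ?_⟩
  rw [integral_add (hi.const_mul 2) (integrable_const _), integral_const_mul, integral_const,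
    probReal_univ, one_smul]
  linarith

/-- The risk of the estimator of `σ²`, with a constant that depends only on the dimension. -/
theorem exists_risk_le (hd : 1 ≤ d) : ∃ C : ℝ, 0 < C ∧
    ∀ {Ω : Type*} [MeasurableSpace Ω] {P : Measure Ω} [IsProbabilityMeasure P]
      {lam : ℝ≥0} {ξ : ℤ → Ω → EuclideanSpace ℝ (Fin d)}
      {W : ℤ → ℝ≥0 → Ω → EuclideanSpace ℝ (Fin d)}, IsBrownianSystem lam ξ W P →
      ∀ {r σ T : ℝ}, 0 < r → 0 < lam → 0 < σ → Real.exp 4 ≤ T → σ ^ 2 ≤ r ^ 2 * T →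
      ∫ ω, relLoss (sigmaSqStar d r (rho d lam r) T (count ξ W r σ ω)) (σ ^ 2) ^ 2 ∂P
        ≤ C * (((1 + 1 / rho d lam r) * (r / σ) ^ min d 2 + (r / σ) ^ (2 * d)) * phi d T) := by
  obtain ⟨C₁, hC₁, hI⟩ := exists_integral_corr_le hd
  set c₀ := J d 1 1 with hc₀
  have hc₀pos : 0 < c₀ := J_one_pos hd
  set D := decayConst d
  -- One factor `e²` comes from the lower bound on `Ψ`, the other from `b ^ α ≤ e`; `1 / c₀²` comes
  -- from that lower bound too. `16 C₁ = 2 · 8 C₁` is stochastic, `32 D² = 2 · 4² D²` is truncation.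
  refine ⟨Real.exp 1 ^ 4 / c₀ ^ 2 * (16 * C₁ + 32 * D ^ 2), ?_, ?_⟩
  · have := Real.exp_pos 1
    positivity
  intro Ω _ P _ lam ξ W h r σ T hr hlam hσ hT4 hσT
  have hρ0 : 0 < rho d lam r := rho_pos hlam hr
  have hT0 : 0 < T := (Real.exp_pos 4).trans_le hT4
  have hT2 : Real.exp 2 < T := (Real.exp_lt_exp.2 (by norm_num)).trans_le hT4
  have hT1 : 1 < T := (Real.one_lt_exp_iff.2 two_pos).trans hT2
  set ρ := rho d lam r with hρ
  set α := alphaStar T with hαdef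
  set b := bStar d T with hbdef
  have hα0 : 0 < α := alphaStar_pos hT4
  have hα4 : α ≤ 1 / 4 := alphaStar_le hT4
  have hd' : (1 : ℝ) / 2 ≤ d / 2 := by
    have : (1 : ℝ) ≤ d := by exact_mod_cast hd
    linarith
  have hαd : α < (d : ℝ) / 2 := by linarith
  have hb0 : 0 < b := bStar_pos d hT4
  have hbT : b ≤ T / 2 := bStar_le d hT4
  have hαinv : 1 / α = Real.log T := by rw [hαdef, alphaStar, one_div_one_div]
  have he : 0 < Real.exp 1 := Real.exp_pos 1
  have hbα : b ^ α ≤ Real.exp 1 := by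
    rw [← rpow_alphaStar_self hT1]
    exact Real.rpow_le_rpow hb0.le (by linarith) hα0.le
  have hbα0 : 0 < b ^ α := Real.rpow_pos_of_pos hb0 α
  obtain ⟨N, hN, hNc⟩ := h.exists_measurable_count r σ
  obtain ⟨herr, herr2⟩ := h.psiEst_error hd hr hσ hlam hN hNc hα0 hαd hb0 hbT
  rw [← hρ] at herr herr2
  set Ψ := psi d r σ α with hΨ
  -- The constraint `σ² ≤ r² T` enters through `(r/σ)² ≥ 1/T`, whose power `α` is at least `1/e`.
  -- The factor `1 / α` on the left offsets the one in the loss.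
  have hΨge : c₀ * (Real.exp 1)⁻¹ * (1 / α) ≤ Ψ := by
    refine le_trans ?_ (le_psi hd hr hσ hα0 hαd)
    have hexp : (Real.exp 1)⁻¹ ≤ ((r / σ) ^ 2) ^ α := by
      rw [← rpow_alphaStar_self hT1, ← Real.inv_rpow hT0.le]
      refine Real.rpow_le_rpow (by positivity) ?_ hα0.le
      rw [div_pow, le_div_iff₀ (by positivity), inv_mul_le_iff₀ hT0]
      linarith
    rw [mul_assoc, mul_one_div, ← hc₀]
    gcongr
  have hΨ0 : 0 < Ψ := lt_of_lt_of_le (by positivity) hΨge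
  have hloss : ∀ᵐ ω ∂P,
      relLoss (sigmaSqStar d r ρ T (count ξ W r σ ω)) (σ ^ 2) ^ 2
      ≤ Real.exp 1 ^ 2 / c₀ ^ 2 * (psiEst ρ T α b (N ω) - Ψ) ^ 2 := by
    filter_upwards [hNc] with ω hω
    rw [hω]
    have hs : (0 : ℝ) < σ ^ 2 := by positivity
    have hJ : Jalpha d r α = (σ ^ 2) ^ α * Ψ := by
      rw [hΨ, psi_eq d r hσ, ← mul_assoc, ← Real.rpow_add hs, add_neg_cancel, Real.rpow_zero,
        one_mul]
    have h1 := relLoss_le (psiEst_nonneg (T := T) (α := α) hρ0.le hb0.le (N ω)) hΨ0 hs hα0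
      (by linarith)
    rw [← hJ] at h1
    have h2 : 0 ≤ relLoss ((Jalpha d r α / psiEst ρ T α b (N ω)) ^ (1 / α)) (σ ^ 2) := by
      refine div_nonneg (abs_nonneg _) (add_nonneg (Real.rpow_nonneg (div_nonneg ?_
        (psiEst_nonneg hρ0.le hb0.le _)) _) hs.le)
      rw [hJ]
      positivity
    have h3 : 1 / α * (|psiEst ρ T α b (N ω) - Ψ| / Ψ)
        ≤ Real.exp 1 / c₀ * |psiEst ρ T α b (N ω) - Ψ| := by
      rw [mul_div_assoc', div_le_iff₀ hΨ0, mul_right_comm]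
      refine mul_le_mul_of_nonneg_right ?_ (abs_nonneg _)
      calc 1 / α = Real.exp 1 / c₀ * (c₀ * (Real.exp 1)⁻¹ * (1 / α)) := by field_simp
        _ ≤ _ := mul_le_mul_of_nonneg_left hΨge (by positivity)
    refine (pow_le_pow_left₀ h2 (h1.trans h3) 2).trans_eq ?_
    rw [mul_pow, div_pow, sq_abs]
  have hmain : ∫ ω, relLoss (sigmaSqStar d r ρ T (count ξ W r σ ω)) (σ ^ 2) ^ 2 ∂P
      ≤ Real.exp 1 ^ 2 / c₀ ^ 2 * ∫ ω, (psiEst ρ T α b (N ω) - Ψ) ^ 2 ∂P := by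
    rw [← integral_const_mul]
    exact integral_mono_of_nonneg (ae_of_all _ fun ω => sq_nonneg _) (herr.const_mul _) hloss
  have htail0 : 0 ≤ ∫ t in Set.Ioi b, corr d r σ t / t ^ (1 - α) :=
    setIntegral_nonneg measurableSet_Ioi fun t ht => corr_div_nonneg hd r σ α (hb0.trans ht).le
  have htail : (∫ t in Set.Ioi b, corr d r σ t / t ^ (1 - α)) ^ 2
      ≤ 16 * D ^ 2 * Real.exp 1 ^ 2 * ((r / σ) ^ (2 * d) * phi d T) := by
    have h1 : ∫ t in Set.Ioi b, corr d r σ t / t ^ (1 - α)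
        ≤ D * (r / σ) ^ d * (Real.exp 1 * b ^ (-((d : ℝ) / 2)) * 4) := by
      refine (integral_corr_div_Ioi_le hd r hσ hαd hb0).trans ?_
      have h2 : ((r / σ) ^ 2) ^ ((d : ℝ) / 2) = (r / σ) ^ d := by
        rw [← Real.rpow_natCast (r / σ) 2, ← Real.rpow_mul (by positivity),
          ← Real.rpow_natCast (r / σ) d]
        congr 1
        push_cast
        ring
      rw [h2, sub_eq_add_neg α, Real.rpow_add hb0, div_eq_mul_inv (b ^ α * _)]
      -- Here `d / 2 ≥ 1 / 2` and `α ≤ 1 / 4`.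
      have h3 : ((d : ℝ) / 2 - α)⁻¹ ≤ 4 := by
        rw [inv_le_comm₀ (by linarith) (by norm_num)]
        linarith
      have hD0 : 0 ≤ D := (decayConst_pos hd).le
      have h5 : 0 ≤ ((d : ℝ) / 2 - α)⁻¹ := inv_nonneg.2 (by linarith)
      gcongr
    refine (pow_le_pow_left₀ htail0 h1 2).trans_eq ?_
    have h4 : (b ^ (-((d : ℝ) / 2))) ^ 2 = phi d T := by
      rw [← inv_bStar_pow hd hT4, ← Real.rpow_natCast _ 2, ← Real.rpow_mul hb0.le,
        ← Real.rpow_natCast _ d, ← Real.rpow_neg hb0.le]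
      congr 1
      push_cast
      ring
    rw [← h4, pow_mul']
    ring
  have hvar : 8 / T * (1 + 1 / ρ) * (∫ u in Set.Ioc 0 T, corr d r σ u) * (b ^ α / α) ^ 2
      ≤ 8 * C₁ * Real.exp 1 ^ 2 * ((1 + 1 / ρ) * (r / σ) ^ min d 2 * phi d T) := by
    have h1 := hI r σ T hr hσ hT2 hσT
    have h2 : (b ^ α / α) ^ 2 ≤ Real.exp 1 ^ 2 * Real.log T ^ 2 := by
      rw [div_eq_mul_one_div, hαinv, mul_pow]
      gcongr
    have h3 : 0 ≤ 1 / T * ∫ u in Set.Ioc 0 T, corr d r σ u :=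
      mul_nonneg (by positivity) (integral_nonneg fun u => corr_nonneg hd r σ u)
    calc _ = 8 * (1 + 1 / ρ) * (1 / T * ∫ u in Set.Ioc 0 T, corr d r σ u) * (b ^ α / α) ^ 2 := by
          ring
      _ ≤ 8 * (1 + 1 / ρ) * (C₁ * (r / σ) ^ min d 2 * stochRate d T) *
          (Real.exp 1 ^ 2 * Real.log T ^ 2) :=
        mul_le_mul (mul_le_mul_of_nonneg_left h1 (by positivity)) h2 (sq_nonneg _)
          (mul_nonneg (by positivity) (h3.trans h1))
      _ = _ := by
        rw [← log_sq_mul_stochRate]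
        ring
  have hphi := phi_pos d hT4
  refine hmain.trans ?_
  have hsum := herr2.trans (add_le_add (mul_le_mul_of_nonneg_left hvar two_pos.le)
    (mul_le_mul_of_nonneg_left htail two_pos.le))
  refine (mul_le_mul_of_nonneg_left hsum (by positivity)).trans ?_
  set A := (1 + 1 / ρ) * (r / σ) ^ min d 2
  set B := (r / σ) ^ (2 * d)
  have hA : 0 ≤ A := by positivity
  have hB : 0 ≤ B := by positivity
  -- The missing cross terms are nonnegative and are added to bring both contributions under the
  -- common factor `A + B`.
  have hle : 2 * (8 * C₁ * Real.exp 1 ^ 2 * (A * phi d T)) +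
      2 * (16 * D ^ 2 * Real.exp 1 ^ 2 * (B * phi d T))
      ≤ Real.exp 1 ^ 2 * (16 * C₁ + 32 * D ^ 2) * ((A + B) * phi d T) := by
    have h1 : 0 ≤ Real.exp 1 ^ 2 * C₁ * (B * phi d T) := by positivity
    have h2 : 0 ≤ Real.exp 1 ^ 2 * D ^ 2 * (A * phi d T) := by positivity
    linarith
  refine (mul_le_mul_of_nonneg_left hle (by positivity)).trans_eq ?_
  ring

end

end Smoluchowski

theorem mainTheorem4 (d : ℕ) (hd : 1 ≤ d) :
    ∃ C : ℝ, 0 < C ∧ ∀ (r : ℝ) (lam : ℝ≥0), 0 < r → 0 < lam →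
      ∀ {Ω : Type*} [MeasurableSpace Ω] (P : Measure Ω) [IsProbabilityMeasure P]
        (ξ : ℤ → Ω → EuclideanSpace ℝ (Fin d))
        (W : ℤ → ℝ≥0 → Ω → EuclideanSpace ℝ (Fin d)),
        IsBrownianSystem lam ξ W P →
        (∀ T σ : ℝ, Real.exp 2 < T → 0 < σ →
          AEMeasurable (fun ω => sigmaSqStar d r (rho d lam r) T (count ξ W r σ ω)) P) ∧
        limsup (fun T : ℝ => ⨆ (σ : ℝ) (_ : 0 < σ) (_ : σ ^ 2 ≤ r ^ 2 * T),
          ENNReal.ofReal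
            (((1 + 1 / rho d lam r) * (r / σ) ^ (min d 2) + (r / σ) ^ (2 * d))⁻¹ * (phi d T)⁻¹ *
              ∫ ω, relLoss (sigmaSqStar d r (rho d lam r) T (count ξ W r σ ω)) (σ ^ 2) ^ 2 ∂P))
          atTop ≤ ENNReal.ofReal C := by
  obtain ⟨C, hC, hrisk⟩ := exists_risk_le hd
  refine ⟨C, hC, fun r lam hr hlam Ω _ P _ ξ W h => ⟨fun T σ _ _ => ?_, ?_⟩⟩
  · obtain ⟨N, hN, hNc⟩ := h.exists_measurable_count r σ
    exact ⟨_, measurable_sigmaSqStar hN d r (rho d lam r) T, hNc.mono fun ω hω => by simp only [hω]⟩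
  · refine limsup_le_of_le (h := ?_)
    -- The risk bound holds for each such `T` uniformly in `σ`, so the supremum is bounded before
    -- the limit is taken.
    filter_upwards [eventually_ge_atTop (Real.exp 4)] with T hT
    refine iSup_le fun σ => iSup_le fun hσ => iSup_le fun hσT => ENNReal.ofReal_le_ofReal ?_
    have hρ : 0 < rho d lam r := rho_pos hlam hr
    have hphi := phi_pos d hT
    rw [← mul_inv, inv_mul_le_iff₀ (by positivity), mul_comm _ C]
    exact hrisk h hr hlam hσ hT hσT
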